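/- Throughout, functions are complex valued, $C^\infty(X)$ carries its Fréchet topology (uniform convergence of all derivatives), $\hat\otimes$ is the completed projective tensor product over $\mathbb C$ (so that $C^\infty(X)\hat\otimes C^\infty(Y)=C^\infty(X\times Y)$ for compact $X,Y$), and $\hat\otimes_B$ is its quotient by the closed linear span of the elements $ab\otimes c-a\otimes bc$ with $b\in B$. Let $G$ be a compact Lie group (for instance a compact semisimple one), let $M$ be a compact smooth manifold (without boundary) with a smooth action $\sigma$ of the torus $\mathbb T^n=\mathbb R^n/\mathbb Z^n$ (for instance a compact four-dimensional Riemannian manifold with an isometric action of $\mathbb T^2$), and let $\pi:P\to M$ be a smooth principal $G$-bundle, with $G$ acting on $P$ by $(g,p)\mapsto g\cdot p$. Let $c:\tilde{\mathbb T}^n\to\mathbb T^n$ be a covering homomorphism of $n$-tori, given by an integer matrix $C$ with $\det C\neq0$, and let $\tilde\sigma$ be a smooth action of $\tilde{\mathbb T}^n$ on $P$ that commutes with the action of $G$ and lifts $\sigma$, that is, $\pi(\tilde\sigma_s(p))=\sigma_{Cs}(\pi(p))$. Let $\theta'$ be a real antisymmetric $n\times n$ matrix and put $\theta=C\theta'C^{t}$.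 For $f\in C^\infty(P)$ and $s\in\mathbb R^n$ write $\tilde\sigma_s(f)=f\circ\tilde\sigma_s$, and let $f=\sum_{r\in\mathbb Z^n}f_r$ be the decomposition of $f$ with $\tilde\sigma_s(f_r)=e^{2\pi i r\cdot s}f_r$. Let $C^\infty(P_\theta)$ be the vector space $C^\infty(P)$ with the product $$f\times_{\theta}g=\sum_{r}f_r\,\tilde\sigma_{\frac12 r\cdot\theta'}(g),\qquad (r\cdot\theta')_k=\sum_j r_j\theta'_{jk},$$ and define $C^\infty(M_\theta)$ in the same way from $C^\infty(M)$, $\sigma$ and $\theta$. Let $C^\infty(G)$ be the topological Hopf algebra of smooth functions on $G$, with pointwise product, coproduct $h\mapsto\big((g,g')\mapsto h(gg')\big)$, counit $h\mapsto h(1)$ and antipode $h\mapsto\big(g\mapsto h(g^{-1})\big)$, and let $\Delta_R:C^\infty(P_\theta)\to C^\infty(P_\theta)\hat\otimes C^\infty(G)$ be the coaction dual to the action of $G$, $\Delta_R(f)(p,g)=f(g^{-1}\cdot p)$. Then $C^\infty(P_\theta)$ and $C^\infty(M_\theta)$ are well-defined unital associative topological algebras, and $\pi^*:C^\infty(M_\theta)\hookrightarrow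 C^\infty(P_\theta)$ is a Hopf–Galois $C^\infty(G)$-extension: $\pi^*$ is a continuous injective unital algebra homomorphism; $\Delta_R$ makes $C^\infty(P_\theta)$ into a right $C^\infty(G)$-comodule algebra; the image of $\pi^*$ is the set of coinvariants $\{f:\Delta_R(f)=f\otimes1\}$; and the canonical map $$\chi:C^\infty(P_\theta)\,\hat\otimes_{C^\infty(M_\theta)}\,C^\infty(P_\theta)\to C^\infty(P_\theta)\,\hat\otimes\,C^\infty(G),\qquad f'\otimes f\mapsto f'\,\Delta_R(f),$$ is bijective. The same holds for the undeformed inclusion $\pi^*:C^\infty(M)\hookrightarrow C^\infty(P)$, with canonical map $\chi^{(0)}$. Moreover there is a linear homeomorphism $$T:C^\infty(P_\theta)\,\hat\otimes_{C^\infty(M_\theta)}\,C^\infty(P_\theta)\to C^\infty(P)\,\hat\otimes_{C^\infty(M)}\,C^\infty(P)$$ such that $T(f'\otimes f)=f'\otimes\tilde\sigma_{\frac12 r\cdot\theta'}(f)$ whenever $f'$ is homogeneous of degree $r$, and such that $\chi=\chi^{(0)}\circ T$, where the vector spaces $C^\infty(P_\theta)$ and $C^\infty(P)$ are identified. -/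

import Mathlib

open scoped Manifold ContDiff TensorProduct Matrix

noncomputable section

/-! ### Completed projective tensor products of complex topological vector spaces -/

section Tensor

variable (E F : Type*) [AddCommGroup E] [Module ℂ E] [TopologicalSpace E]
  [AddCommGroup F] [Module ℂ F] [TopologicalSpace F]

/-- The algebraic tensor product `E ⊗ F`, to be given the projective topology. -/
def PTensor : Type _ := E ⊗[ℂ] F

namespace PTensor

instance : AddCommGroup (PTensor E F) := inferInstanceAs (AddCommGroup (E ⊗[ℂ] F))
instance : Module ℂ (PTensor E F) := inferInstanceAs (Module ℂ (E ⊗[ℂ] F))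

variable {E F} in
/-- The elementary tensor `x ⊗ y`. -/
def tmul (x : E) (y : F) : PTensor E F := x ⊗ₜ[ℂ] y

/-- The vector space topologies on `E ⊗ F` that are locally convex and make the canonical bilinear
map `E × F → E ⊗ F` (jointly) continuous. -/
def admissible : Set (TopologicalSpace (PTensor E F)) :=
  {t | @IsTopologicalAddGroup _ t _ ∧ @ContinuousSMul ℂ _ _ _ t ∧
    @LocallyConvexSpace ℝ _ _ _ _ _ t ∧
    @Continuous (E × F) (PTensor E F) _ t (fun x => tmul x.1 x.2)}

/-- The projective topology on `E ⊗ F`: the finest locally convex topology for which the canonical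
bilinear map `E × F → E ⊗ F` is continuous. -/
abbrev projTopology : TopologicalSpace (PTensor E F) := sInf (admissible E F)

theorem projTopology_addGroup : @IsTopologicalAddGroup _ (projTopology E F) _ :=
  topologicalAddGroup_sInf fun _ ht => ht.1

/-- The translation-invariant uniformity of the projective topology. -/
instance : UniformSpace (PTensor E F) :=
  @IsTopologicalAddGroup.rightUniformSpace _ _ (projTopology E F) (projTopology_addGroup E F)

theorem topology_eq :
    (inferInstance : TopologicalSpace (PTensor E F)) = sInf (admissible E F) := rfl

instance : IsTopologicalAddGroup (PTensor E F) := projTopology_addGroup E F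

instance : IsUniformAddGroup (PTensor E F) := isUniformAddGroup_of_addCommGroup

instance : ContinuousSMul ℂ (PTensor E F) := continuousSMul_sInf fun _ ht => ht.2.1

instance : LocallyConvexSpace ℝ (PTensor E F) :=
  LocallyConvexSpace.sInf fun _ ht => ht.2.2.1

instance : UniformContinuousConstSMul ℂ (PTensor E F) :=
  uniformContinuousConstSMul_of_continuousConstSMul ℂ (PTensor E F)

theorem continuous_tmul : Continuous fun x : E × F => (tmul x.1 x.2 : PTensor E F) :=
  continuous_sInf_rng.2 fun _ ht => ht.2.2.2

variable {E F} in
/-- A linear map on `E ⊗ F` into a locally convex space is continuous as soon as the corresponding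
bilinear map is. -/
theorem continuous_of_tmul {V : Type*} [AddCommGroup V] [Module ℂ V] [TopologicalSpace V]
    [IsTopologicalAddGroup V] [ContinuousSMul ℂ V] [LocallyConvexSpace ℝ V]
    (f : PTensor E F →ₗ[ℂ] V) (hf : Continuous fun x : E × F => f (tmul x.1 x.2)) :
    Continuous f := by
  rw [continuous_iff_le_induced]
  refine sInf_le ⟨?_, ?_, ?_, ?_⟩
  · exact topologicalAddGroup_induced f
  · exact continuousSMul_induced f
  · exact LocallyConvexSpace.induced (f.restrictScalars ℝ)
  · exact continuous_induced_rng.2 hf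

variable {E F} {E' F' : Type*} [AddCommGroup E'] [Module ℂ E'] [TopologicalSpace E']
  [AddCommGroup F'] [Module ℂ F'] [TopologicalSpace F']

/-- `φ ⊗ ψ` on algebraic tensor products, as a linear map. -/
def mapLin (φ : E →L[ℂ] E') (ψ : F →L[ℂ] F') : PTensor E F →ₗ[ℂ] PTensor E' F' :=
  TensorProduct.map φ.toLinearMap ψ.toLinearMap

/-- `φ ⊗ ψ` on algebraic tensor products. -/
def map (φ : E →L[ℂ] E') (ψ : F →L[ℂ] F') : PTensor E F →L[ℂ] PTensor E' F' where
  toLinearMap := mapLin φ ψ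
  cont := continuous_of_tmul (mapLin φ ψ) <| (continuous_tmul E' F').comp
    ((φ.continuous.comp continuous_fst).prodMk (ψ.continuous.comp continuous_snd))

/-- The functional `x ⊗ y ↦ φ x * ψ y` on the algebraic tensor product, as a linear map. -/
def pairLin (φ : E →L[ℂ] ℂ) (ψ : F →L[ℂ] ℂ) : PTensor E F →ₗ[ℂ] ℂ :=
  LinearMap.mul' ℂ ℂ ∘ₗ TensorProduct.map φ.toLinearMap ψ.toLinearMap

/-- The functional `x ⊗ y ↦ φ x * ψ y` on the algebraic tensor product. -/
def pair (φ : E →L[ℂ] ℂ) (ψ : F →L[ℂ] ℂ) : PTensor E F →L[ℂ] ℂ where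
  toLinearMap := pairLin φ ψ
  cont := continuous_of_tmul (pairLin φ ψ) <|
    (φ.continuous.comp continuous_fst).mul (ψ.continuous.comp continuous_snd)

end PTensor

/-- The completed projective tensor product `E ⊗̂ F`: the Hausdorff completion of `E ⊗ F` in the
projective topology. -/
abbrev CTensor : Type _ := UniformSpace.Completion (PTensor E F)

namespace CTensor

variable {E F} {E' F' : Type*} [AddCommGroup E'] [Module ℂ E'] [TopologicalSpace E']
  [AddCommGroup F'] [Module ℂ F'] [TopologicalSpace F']

/-- The elementary tensor `x ⊗ y` in `E ⊗̂ F`. -/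
def tmul (x : E) (y : F) : CTensor E F := ((PTensor.tmul x y : PTensor E F) : CTensor E F)

/-- `φ ⊗̂ ψ : E ⊗̂ F → E' ⊗̂ F'`. -/
def map (φ : E →L[ℂ] E') (ψ : F →L[ℂ] F') : CTensor E F →L[ℂ] CTensor E' F' :=
  (PTensor.map φ ψ).completion

/-- The functional `x ⊗ y ↦ φ x * ψ y` on `E ⊗̂ F`. -/
def pair (φ : E →L[ℂ] ℂ) (ψ : F →L[ℂ] ℂ) : CTensor E F →L[ℂ] ℂ :=
  (PTensor.pair φ ψ).fromCompletion

theorem map_tmul (φ : E →L[ℂ] E') (ψ : F →L[ℂ] F') (x : E) (y : F) :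
    map φ ψ (tmul x y) = tmul (φ x) (ψ y) :=
  ContinuousLinearMap.completion_apply_coe _ _

theorem pair_tmul (φ : E →L[ℂ] ℂ) (ψ : F →L[ℂ] ℂ) (x : E) (y : F) :
    pair φ ψ (tmul x y) = φ x * ψ y :=
  ContinuousLinearMap.fromCompletion_apply_coe _ _

end CTensor

end Tensor

/-! ### Topological algebras, Hopf algebras and Hopf-Galois extensions -/

/-- A unital associative algebra structure with jointly continuous product on a complex topological
vector space. It is kept as data (not as a type class) since one and the same space of functions
carries several products. -/
structure TopAlg (A : Type*) [AddCommGroup A] [Module ℂ A] [TopologicalSpace A] where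
  mul : A →ₗ[ℂ] A →ₗ[ℂ] A
  one : A
  continuous_mul : Continuous fun x : A × A => mul x.1 x.2
  mul_assoc : ∀ a b c, mul (mul a b) c = mul a (mul b c)
  one_mul : ∀ a, mul one a = a
  mul_one : ∀ a, mul a one = a

section Algebra

variable {A B H : Type*} [AddCommGroup A] [Module ℂ A] [TopologicalSpace A]
  [AddCommGroup B] [Module ℂ B] [TopologicalSpace B]
  [AddCommGroup H] [Module ℂ H] [TopologicalSpace H]

/-- Left multiplication by `a`. -/
def TopAlg.mulLeft (𝒜 : TopAlg A) (a : A) : A →L[ℂ] A where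
  toLinearMap := 𝒜.mul a
  cont := 𝒜.continuous_mul.comp (continuous_const.prodMk continuous_id)

/-- `𝒯` is the tensor product algebra structure on `A ⊗̂ H`. -/
def IsTensorAlg (𝒜 : TopAlg A) (ℋ : TopAlg H) (𝒯 : TopAlg (CTensor A H)) : Prop :=
  𝒯.one = CTensor.tmul 𝒜.one ℋ.one ∧
  ∀ a a' h h', 𝒯.mul (CTensor.tmul a h) (CTensor.tmul a' h') =
    CTensor.tmul (𝒜.mul a a') (ℋ.mul h h')

/-- `α` is the associativity map `(A ⊗̂ B) ⊗̂ H → A ⊗̂ (B ⊗̂ H)`. -/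
def IsAssociator (α : CTensor (CTensor A B) H →L[ℂ] CTensor A (CTensor B H)) : Prop :=
  ∀ a b h, α (CTensor.tmul (CTensor.tmul a b) h) = CTensor.tmul a (CTensor.tmul b h)

variable (H) in
/-- A topological Hopf algebra, with coproduct in the completed tensor product. -/
structure TopHopfAlg extends TopAlg H where
  comul : H →L[ℂ] CTensor H H
  counit : H →L[ℂ] ℂ
  antipode : H →L[ℂ] H
  comul_one : comul one = CTensor.tmul one one
  comul_mul : ∃ 𝒯 : TopAlg (CTensor H H), IsTensorAlg toTopAlg toTopAlg 𝒯 ∧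
    ∀ h k, comul (mul h k) = 𝒯.mul (comul h) (comul k)
  counit_one : counit one = 1
  counit_mul : ∀ h k, counit (mul h k) = counit h * counit k
  coassoc : ∃ α : CTensor (CTensor H H) H →L[ℂ] CTensor H (CTensor H H), IsAssociator α ∧
    ∀ h, α (CTensor.map comul (.id ℂ H) (comul h)) = CTensor.map (.id ℂ H) comul (comul h)
  counit_comul : ∀ h, CTensor.map counit (.id ℂ H) (comul h) = CTensor.tmul 1 h
  comul_counit : ∀ h, CTensor.map (.id ℂ H) counit (comul h) = CTensor.tmul h 1
  antipode_comul : ∃ μ : CTensor H H →L[ℂ] H, (∀ h k, μ (CTensor.tmul h k) = mul h k) ∧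
    ∀ h, μ (CTensor.map antipode (.id ℂ H) (comul h)) = counit h • one ∧
      μ (CTensor.map (.id ℂ H) antipode (comul h)) = counit h • one

/-- `δ` makes the algebra `A` into a right `H`-comodule algebra. -/
structure IsComoduleAlgebra (ℋ : TopHopfAlg H) (𝒜 : TopAlg A) (δ : A →L[ℂ] CTensor A H) :
    Prop where
  coassoc : ∃ α : CTensor (CTensor A H) H →L[ℂ] CTensor A (CTensor H H), IsAssociator α ∧
    ∀ a, α (CTensor.map δ (.id ℂ H) (δ a)) = CTensor.map (.id ℂ A) ℋ.comul (δ a)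
  counit : ∀ a, CTensor.map (.id ℂ A) ℋ.counit (δ a) = CTensor.tmul a 1
  map_one : δ 𝒜.one = CTensor.tmul 𝒜.one ℋ.one
  map_mul : ∃ 𝒯 : TopAlg (CTensor A H), IsTensorAlg 𝒜 ℋ.toTopAlg 𝒯 ∧
    ∀ a b, δ (𝒜.mul a b) = 𝒯.mul (δ a) (δ b)

/-- The span of the elements `a b ⊗ c - a ⊗ b c` of `A ⊗̂ A` with `a, c ∈ A` and `b ∈ B`, where
`ι : B → A` is the inclusion of the subalgebra. -/
def balancingRelations (𝒜 : TopAlg A) (ι : B →ₗ[ℂ] A) : Submodule ℂ (CTensor A A) :=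
  Submodule.span ℂ {t | ∃ (a c : A) (b : B),
    t = CTensor.tmul (𝒜.mul a (ι b)) c - CTensor.tmul a (𝒜.mul (ι b) c)}

/-- The completed balanced tensor product `A ⊗̂_B A`: the quotient of `A ⊗̂ A` by the closed linear
span of the elements `a b ⊗ c - a ⊗ b c`. -/
abbrev BalTensor (𝒜 : TopAlg A) (ι : B →ₗ[ℂ] A) : Type _ :=
  CTensor A A ⧸ (balancingRelations 𝒜 ι).topologicalClosure

/-- The class of `a ⊗ c` in `A ⊗̂_B A`. -/
def BalTensor.tmul (𝒜 : TopAlg A) (ι : B →ₗ[ℂ] A) (a c : A) : BalTensor 𝒜 ι :=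
  Submodule.Quotient.mk (CTensor.tmul a c)

/-- `χ` is the canonical map `A ⊗̂_B A → A ⊗̂ H`, `a ⊗ c ↦ a δ(c)`. -/
def IsCanonicalMap (𝒜 : TopAlg A) (ι : B →ₗ[ℂ] A) (δ : A →L[ℂ] CTensor A H)
    (χ : BalTensor 𝒜 ι →L[ℂ] CTensor A H) : Prop :=
  ∀ a c, χ (BalTensor.tmul 𝒜 ι a c) = CTensor.map (𝒜.mulLeft a) (.id ℂ H) (δ c)

/-- The inclusion `ι : B → A` is a Hopf-Galois `H`-extension with respect to the coaction `δ`. -/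
structure IsHopfGaloisExtension (ℋ : TopHopfAlg H) (ℬ : TopAlg B) (𝒜 : TopAlg A)
    (ι : B →ₗ[ℂ] A) (δ : A →L[ℂ] CTensor A H) : Prop where
  incl_continuous : Continuous ι
  incl_injective : Function.Injective ι
  incl_one : ι ℬ.one = 𝒜.one
  incl_mul : ∀ b b', ι (ℬ.mul b b') = 𝒜.mul (ι b) (ι b')
  comodule : IsComoduleAlgebra ℋ 𝒜 δ
  coinvariants : ∀ a, δ a = CTensor.tmul a ℋ.one ↔ a ∈ LinearMap.range ι
  canonical : ∃ χ : BalTensor 𝒜 ι →L[ℂ] CTensor A H,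
    IsCanonicalMap 𝒜 ι δ χ ∧ Function.Bijective χ

end Algebra

/-! ### Smooth functions with their Fréchet topology -/

section Smooth

variable (E : Type*) [NormedAddCommGroup E] [NormedSpace ℝ E]
  (X : Type*) [TopologicalSpace X] [ChartedSpace E X]

/-- The complex vector space of smooth complex valued functions on `X`. -/
def smoothSubmodule : Submodule ℂ (X → ℂ) where
  carrier := {f | ContMDiff 𝓘(ℝ, E) 𝓘(ℝ, ℂ) ∞ f}
  add_mem' hf hg := ContMDiff.add hf hg
  zero_mem' := contMDiff_const
  smul_mem' c f hf := by
    have h : ContMDiff 𝓘(ℝ, ℂ) 𝓘(ℝ, ℂ) ∞ fun z : ℂ => c • z := (contDiff_const_smul c).contMDiff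
    exact h.comp hf

/-- `C^∞(X)`, complex valued, for a manifold `X` modelled on `E`. -/
def Cinf : Type _ := smoothSubmodule E X

namespace Cinf

instance : AddCommGroup (Cinf E X) := inferInstanceAs (AddCommGroup (smoothSubmodule E X))
instance : Module ℂ (Cinf E X) := inferInstanceAs (Module ℂ (smoothSubmodule E X))
instance : CoeFun (Cinf E X) (fun _ => X → ℂ) := ⟨fun f => f.1⟩

/-- The restriction to compact subsets of the chart domain at `x` of the `k`-th derivative of `f`
read in that chart. -/
def chartDeriv (x : X) (k : ℕ) (f : Cinf E X) :
    UniformOnFun E (E [×k]→L[ℝ] ℂ) {K | IsCompact K ∧ K ⊆ (chartAt E x).target} :=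
  UniformOnFun.ofFun _ (iteratedFDeriv ℝ k fun y => f ((chartAt E x).symm y))

/-- The `C^∞` topology: uniform convergence of all derivatives, in charts, on compact subsets of the
chart domains. -/
instance : TopologicalSpace (Cinf E X) :=
  ⨅ (x : X) (k : ℕ), TopologicalSpace.induced (chartDeriv E X x k) inferInstance

variable {X}

theorem continuous_eval (x : X) : Continuous fun f : Cinf E X => f x := by
  have h1 : Continuous (chartDeriv E X x 0) :=
    continuous_iInf_dom (i := x) (continuous_iInf_dom (i := 0) continuous_induced_dom)
  have hx : chartAt E x x ∈ (chartAt E x).target := mem_chart_target E x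
  have h2 := (UniformOnFun.uniformContinuous_eval_of_mem (β := E [×0]→L[ℝ] ℂ)
    {K : Set E | IsCompact K ∧ K ⊆ (chartAt E x).target} (Set.mem_singleton (chartAt E x x))
    ⟨isCompact_singleton, Set.singleton_subset_iff.2 hx⟩).continuous.comp h1
  have h3 : Continuous fun m : E [×0]→L[ℝ] ℂ => m 0 :=
    (ContinuousMultilinearMap.apply ℝ (fun _ : Fin 0 => E) ℂ 0).continuous
  have h4 := h3.comp h2
  refine h4.congr fun f => ?_
  change iteratedFDeriv ℝ 0 (fun y => f ((chartAt E x).symm y)) (chartAt E x x) 0 = f x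
  rw [iteratedFDeriv_zero_apply, (chartAt E x).left_inv (mem_chart_source E x)]

/-- Evaluation at the point `x`. -/
def eval (x : X) : Cinf E X →L[ℂ] ℂ where
  toFun f := f x
  map_add' _ _ := rfl
  map_smul' _ _ := rfl
  cont := continuous_eval E x

variable {E} {E' : Type*} [NormedAddCommGroup E'] [NormedSpace ℝ E']
  {Y : Type*} [TopologicalSpace Y] [ChartedSpace E' Y]

/-- Pull-back `f ↦ f ∘ φ` along a smooth map `φ`. -/
def pullback (φ : X → Y) (hφ : ContMDiff 𝓘(ℝ, E) 𝓘(ℝ, E') ∞ φ) : Cinf E' Y →ₗ[ℂ] Cinf E X where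
  toFun f := ⟨fun x => f (φ x), ContMDiff.comp (I' := 𝓘(ℝ, E')) f.2 hφ⟩
  map_add' _ _ := rfl
  map_smul' _ _ := rfl

end Cinf

end Smooth

/-! ### Torus actions and the deformed product -/

section Torus

variable (n : ℕ) (E : Type*) [NormedAddCommGroup E] [NormedSpace ℝ E]
  (X : Type*) [TopologicalSpace X] [ChartedSpace E X]

/-- A smooth action of the torus `𝕋ⁿ = ℝⁿ / ℤⁿ` on `X`, written as a `ℤⁿ`-periodic action of
`ℝⁿ`. -/
structure TorusAction where
  act : (Fin n → ℝ) → X → X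
  zero_act : ∀ x, act 0 x = x
  add_act : ∀ s t x, act (s + t) x = act s (act t x)
  periodic : ∀ (k : Fin n → ℤ) x, act (fun i => (k i : ℝ)) x = x
  smooth : ContMDiff (𝓘(ℝ, Fin n → ℝ).prod 𝓘(ℝ, E)) 𝓘(ℝ, E) ∞
    fun y : (Fin n → ℝ) × X => act y.1 y.2

variable {n E X}

namespace TorusAction

theorem smooth_act (σ : TorusAction n E X) (s : Fin n → ℝ) :
    ContMDiff 𝓘(ℝ, E) 𝓘(ℝ, E) ∞ (σ.act s) :=
  σ.smooth.comp (contMDiff_const.prodMk contMDiff_id)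

/-- The induced action on functions, `(σ_s f)(x) = f (σ_s x)`. -/
def onFun (σ : TorusAction n E X) (s : Fin n → ℝ) : Cinf E X →ₗ[ℂ] Cinf E X :=
  Cinf.pullback (σ.act s) (σ.smooth_act s)

/-- The character `s ↦ e^{2 π i r ⬝ s}` of the torus. -/
def char (r : Fin n → ℤ) (s : Fin n → ℝ) : ℂ :=
  Complex.exp (2 * Real.pi * Complex.I * ((∑ j, (r j : ℝ) * s j : ℝ) : ℂ))

/-- `f` lies in the spectral subspace of degree `r`. -/
def IsHomogeneous (σ : TorusAction n E X) (r : Fin n → ℤ) (f : Cinf E X) : Prop :=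
  ∀ s, σ.onFun s f = char r s • f

/-- The value at `x` of the degree `r` component `f_r` of `f = ∑_r f_r`. -/
def component (σ : TorusAction n E X) (f : Cinf E X) (r : Fin n → ℤ) (x : X) : ℂ :=
  ∫ s in Set.Icc (0 : Fin n → ℝ) 1, char (-r) s * f (σ.act s x)

end TorusAction

/-- The vector `½ r ⬝ θ`, whose `k`-th entry is `½ ∑_j r_j θ_{jk}`. -/
def halfTwist (θ : Matrix (Fin n) (Fin n) ℝ) (r : Fin n → ℤ) : Fin n → ℝ :=
  (1 / 2 : ℝ) • ((fun j => (r j : ℝ)) ᵥ* θ)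

/-- `𝒜` is the algebra `C^∞(X_θ)`: the space `C^∞(X)` with the usual unit and the product
`f ×_θ g = ∑_r f_r σ_{½ r ⬝ θ}(g)`, where `f = ∑_r f_r` is the spectral decomposition of `f`. -/
def IsToricDeformation (σ : TorusAction n E X) (θ : Matrix (Fin n) (Fin n) ℝ)
    (𝒜 : TopAlg (Cinf E X)) : Prop :=
  (∀ x, 𝒜.one x = 1) ∧
  ∀ f g x, HasSum (fun r : Fin n → ℤ => σ.component f r x * g (σ.act (halfTwist θ r) x))
    (𝒜.mul f g x)

/-- `𝒜` is `C^∞(X)` with the pointwise product. -/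
def IsPointwise (𝒜 : TopAlg (Cinf E X)) : Prop :=
  (∀ x, 𝒜.one x = 1) ∧ ∀ f g x, 𝒜.mul f g x = f x * g x

end Torus

/-! ### Principal bundles and the Hopf algebra of functions on a Lie group -/

section Bundle

variable {EM EP EG M P G : Type*}
  [NormedAddCommGroup EM] [NormedSpace ℝ EM] [NormedAddCommGroup EP] [NormedSpace ℝ EP]
  [NormedAddCommGroup EG] [NormedSpace ℝ EG]
  [TopologicalSpace M] [ChartedSpace EM M] [TopologicalSpace P] [ChartedSpace EP P]
  [TopologicalSpace G] [ChartedSpace EG G] [Group G]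

variable (EM EP EG G) in
/-- `π : P → M` is a smooth principal `G`-bundle, where `G` acts on `P` by `(g, p) ↦ g • p` (the
corresponding right action is `p ◁ g = g⁻¹ • p`): locally over `M` there are `G`-equivariant
diffeomorphisms of `π⁻¹(U)` with `U × G` over `U`. -/
structure IsSmoothPrincipalBundle [MulAction G P] (π : P → M) : Prop where
  smooth_proj : ContMDiff 𝓘(ℝ, EP) 𝓘(ℝ, EM) ∞ π
  smooth_smul : ContMDiff (𝓘(ℝ, EG).prod 𝓘(ℝ, EP)) 𝓘(ℝ, EP) ∞ fun x : G × P => x.1 • x.2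
  proj_smul : ∀ (g : G) (p : P), π (g • p) = π p
  locally_trivial : ∀ m : M, ∃ e : Bundle.Trivialization G π, m ∈ e.baseSet ∧
    ContMDiffOn 𝓘(ℝ, EP) (𝓘(ℝ, EM).prod 𝓘(ℝ, EG)) ∞ e e.source ∧
    ContMDiffOn (𝓘(ℝ, EM).prod 𝓘(ℝ, EG)) 𝓘(ℝ, EP) ∞ e.toOpenPartialHomeomorph.symm e.target ∧
    ∀ (g : G) (p : P), p ∈ e.source → (e (g • p)).2 = g * (e p).2

/-- `ℋ` is the Hopf algebra `C^∞(G)`, with the pointwise product and the structure maps dual to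
multiplication, unit and inversion of `G`. -/
structure IsFunctionHopfAlg (ℋ : TopHopfAlg (Cinf EG G)) : Prop where
  pointwise : IsPointwise ℋ.toTopAlg
  comul_apply : ∀ h g g',
    CTensor.pair (Cinf.eval EG g) (Cinf.eval EG g') (ℋ.comul h) = h (g * g')
  counit_apply : ∀ h, ℋ.counit h = h 1
  antipode_apply : ∀ (h : Cinf EG G) (g : G), ℋ.antipode h g = h g⁻¹

/-- `δ` is the coaction dual to the action `α_g(f)(p) = f(g⁻¹ • p)` of `G` on functions on `P`:
under `C^∞(P) ⊗̂ C^∞(G) = C^∞(P × G)`, `δ(f)` is the function `(p, g) ↦ f(g⁻¹ • p)`. -/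
def IsDualCoaction [MulAction G P] (δ : Cinf EP P →L[ℂ] CTensor (Cinf EP P) (Cinf EG G)) : Prop :=
  ∀ f p g, CTensor.pair (Cinf.eval EP p) (Cinf.eval EG g) (δ f) = f (g⁻¹ • p)

end Bundle

end

/-! Undeformed case. Under `C^∞(P) ⊗̂ C^∞(P) = C^∞(P × P)` and `C^∞(P) ⊗̂ C^∞(G) = C^∞(P × G)`
(`tensorEquiv`), the canonical map is induced by pull-back along the shear `(p, g) ↦ (p, g⁻¹ • p)`,
which identifies `P × G` with the fibre product `P ×_M P` inside `P × P`. Bijectivity therefore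
means two things: functions on `P ×_M P` extend to `P × P`, and a function vanishing on `P ×_M P`
lies in the closed span of the balancing relations. `exists_shear_inverse` gives both at once. A
partition of unity on `M` and local trivializations yield a continuous extension operator `R` with
`shear ∘ R = id` and `R ∘ shear = id` modulo the relations. The second identity amounts to moving
the base point from the first to the second variable (`exists_balanced`), and by density this need
only be checked on products, where it is a balancing relation.

Deformed case. The map `f' ⊗ f ↦ ∑_r f'_r ⊗ σ'_{½ r ⬝ θ'}(f)` on `C^∞(P) ⊗̂ C^∞(P)` is invertible,
with inverse the same map for `-θ'`. On homogeneous elements the deformed product is a scalar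
multiple of the pointwise one, so the map carries deformed relations to multiples of undeformed ones
and its inverse does the converse; this gives `T` on the quotients (`untwist`). Since the torus
commutes with `G`, the product `(a ⊗ 1) δ(c)` deforms by the same shift of `c`, so `χ = χ₀ ∘ T`
(`canonicalTensor_deformed`), and bijectivity is inherited.

Analysis. `C^∞(X)` is a Fréchet space, hence barrelled, and Banach–Steinhaus makes continuity almost
automatic: a linear map into `C^∞(X)` need only be pointwise continuous, a bilinear map only
separately continuous, and a convergent series of operators has a continuous sum. Rapid decay of
Fourier coefficients makes the spectral series converge absolutely in every seminorm. The same
decay, applied after parametrizing a neighbourhood by a torus, proves the kernel theorem `C^∞(X) ⊗̂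
C^∞(Y) = C^∞(X × Y)`. Identities are then checked on elementary tensors of homogeneous functions. -/

open scoped Manifold ContDiff TensorProduct Matrix

noncomputable section

open Filter Topology Set

/-! ### The seminorms of `C^∞(X)` -/

namespace Cinf

section Basic

variable {E : Type*} [NormedAddCommGroup E] [NormedSpace ℝ E]
  {X : Type*} [TopologicalSpace X] [ChartedSpace E X]

/-- A smooth function as an element of `C^∞(X)`. -/
def mk (f : X → ℂ) (hf : ContMDiff 𝓘(ℝ, E) 𝓘(ℝ, ℂ) ∞ f) : Cinf E X := ⟨f, hf⟩

@[simp] theorem mk_apply (f : X → ℂ) (hf : ContMDiff 𝓘(ℝ, E) 𝓘(ℝ, ℂ) ∞ f) (x : X) :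
    mk f hf x = f x := rfl

theorem contMDiff (f : Cinf E X) : ContMDiff 𝓘(ℝ, E) 𝓘(ℝ, ℂ) ∞ f := f.2

@[ext] theorem ext {f g : Cinf E X} (h : ∀ x, f x = g x) : f = g := Subtype.ext (funext h)

@[simp] theorem add_apply (f g : Cinf E X) (x : X) : (f + g) x = f x + g x := rfl
@[simp] theorem zero_apply (x : X) : (0 : Cinf E X) x = 0 := rfl
@[simp] theorem smul_apply (c : ℂ) (f : Cinf E X) (x : X) : (c • f) x = c * f x := rfl
@[simp] theorem eval_apply (f : Cinf E X) (x : X) : eval E x f = f x := rfl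

@[simp] theorem sum_apply {ι : Type*} (s : Finset ι) (f : ι → Cinf E X) (x : X) :
    (∑ i ∈ s, f i) x = ∑ i ∈ s, f i x :=
  map_sum (eval E x) f s

/-- The function `f` read in the chart at `x`. -/
def inChart (x : X) (f : Cinf E X) : E → ℂ := fun y => f ((chartAt E x).symm y)

/-- The indices of the seminorms of `C^∞(X)`: a chart, an order of derivation and a compact subset
of the image of the chart. -/
abbrev SeminormIndex (E X : Type*) [NormedAddCommGroup E] [NormedSpace ℝ E]
    [TopologicalSpace X] [ChartedSpace E X] : Type _ :=
  Σ x : X, ℕ × {K : Set E // IsCompact K ∧ K ⊆ (chartAt E x).target}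

theorem tendsto_iff_tendstoUniformlyOn {ι : Type*} {l : Filter ι} {u : ι → Cinf E X}
    {f : Cinf E X} : Tendsto u l (𝓝 f) ↔ ∀ i : SeminormIndex E X,
      TendstoUniformlyOn (fun j => iteratedFDeriv ℝ i.2.1 (inChart i.1 (u j)))
        (iteratedFDeriv ℝ i.2.1 (inChart i.1 f)) l i.2.2.1 := by
  simp only [nhds_iInf, tendsto_iInf, nhds_induced, tendsto_comap_iff,
    UniformOnFun.tendsto_iff_tendstoUniformlyOn]
  exact ⟨fun h i => h i.1 i.2.1 i.2.2.1 i.2.2.2, fun h x k K hK => h ⟨x, k, K, hK⟩⟩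

instance : T2Space (Cinf E X) :=
  T2Space.of_injective_continuous (f := fun (f : Cinf E X) (x : X) => f x)
    (fun _ _ h => ext fun x => congrFun h x) (continuous_pi fun x => continuous_eval E x)

variable [IsManifold 𝓘(ℝ, E) ∞ X]

theorem contDiffOn_inChart (x : X) (f : Cinf E X) :
    ContDiffOn ℝ ∞ (inChart x f) (chartAt E x).target := by
  rw [← contMDiffOn_iff_contDiffOn]
  exact ContMDiff.comp_contMDiffOn (I' := 𝓘(ℝ, E)) f.2 contMDiffOn_chart_symm

theorem contDiffAt_inChart (x : X) (f : Cinf E X) {y : E} (hy : y ∈ (chartAt E x).target) :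
    ContDiffAt ℝ ∞ (inChart x f) y :=
  (contDiffOn_inChart x f).contDiffAt ((chartAt E x).open_target.mem_nhds hy)

theorem iteratedFDeriv_inChart_add (x : X) (k : ℕ) (f g : Cinf E X) {y : E}
    (hy : y ∈ (chartAt E x).target) :
    iteratedFDeriv ℝ k (inChart x (f + g)) y =
      iteratedFDeriv ℝ k (inChart x f) y + iteratedFDeriv ℝ k (inChart x g) y :=
  iteratedFDeriv_add_apply ((contDiffAt_inChart x f hy).of_le (mod_cast le_top))
    ((contDiffAt_inChart x g hy).of_le (mod_cast le_top))

theorem iteratedFDeriv_inChart_smul (x : X) (k : ℕ) (c : ℂ) (f : Cinf E X) {y : E}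
    (hy : y ∈ (chartAt E x).target) :
    iteratedFDeriv ℝ k (inChart x (c • f)) y = c • iteratedFDeriv ℝ k (inChart x f) y :=
  iteratedFDeriv_const_smul_apply (a := c) ((contDiffAt_inChart x f hy).of_le (mod_cast le_top))

theorem iteratedFDeriv_inChart_sub (x : X) (k : ℕ) (f g : Cinf E X) {y : E}
    (hy : y ∈ (chartAt E x).target) :
    iteratedFDeriv ℝ k (inChart x (f - g)) y =
      iteratedFDeriv ℝ k (inChart x f) y - iteratedFDeriv ℝ k (inChart x g) y := by
  have h := iteratedFDeriv_inChart_add x k f ((-1 : ℂ) • g) hy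
  rw [iteratedFDeriv_inChart_smul x k _ _ hy] at h
  rw [sub_eq_add_neg f g, ← neg_one_smul ℂ g, h, neg_one_smul, sub_eq_add_neg]

theorem continuousOn_iteratedFDeriv_inChart (x : X) (k : ℕ) (f : Cinf E X) :
    ContinuousOn (iteratedFDeriv ℝ k (inChart x f)) (chartAt E x).target := by
  have h := (contDiffOn_inChart x f).continuousOn_iteratedFDerivWithin (m := k)
    (mod_cast le_top) (chartAt E x).open_target.uniqueDiffOn
  exact h.congr fun y hy => (iteratedFDerivWithin_of_isOpen k (chartAt E x).open_target hy).symm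

theorem bddAbove_iteratedFDeriv (i : SeminormIndex E X) (f : Cinf E X) :
    BddAbove (range fun y : i.2.2.1 => ‖iteratedFDeriv ℝ i.2.1 (inChart i.1 f) y‖) := by
  have h := (i.2.2.2.1.image_of_continuousOn
    (((continuousOn_iteratedFDeriv_inChart i.1 i.2.1 f).mono i.2.2.2.2).norm)).bddAbove
  rwa [image_eq_range] at h

/-- The seminorm `f ↦ sup_K ‖D^k f‖`, the derivative being taken in a chart. -/
def semi : SeminormFamily ℂ (Cinf E X) (SeminormIndex E X) := fun i =>
  Seminorm.of (fun f => ⨆ y : i.2.2.1, ‖iteratedFDeriv ℝ i.2.1 (inChart i.1 f) y‖)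
    (fun f g => by
      refine Real.iSup_le (fun y => ?_) (add_nonneg (Real.iSup_nonneg fun _ => norm_nonneg _)
        (Real.iSup_nonneg fun _ => norm_nonneg _))
      rw [iteratedFDeriv_inChart_add _ _ _ _ (i.2.2.2.2 y.2)]
      exact (norm_add_le _ _).trans (add_le_add (le_ciSup (bddAbove_iteratedFDeriv i f) y)
        (le_ciSup (bddAbove_iteratedFDeriv i g) y)))
    (fun c f => by
      rw [Real.mul_iSup_of_nonneg (norm_nonneg _)]
      refine iSup_congr fun y => ?_
      rw [iteratedFDeriv_inChart_smul _ _ _ _ (i.2.2.2.2 y.2), norm_smul])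

theorem semi_le_iff (i : SeminormIndex E X) (f : Cinf E X) {a : ℝ} (ha : 0 ≤ a) :
    semi i f ≤ a ↔ ∀ y ∈ i.2.2.1, ‖iteratedFDeriv ℝ i.2.1 (inChart i.1 f) y‖ ≤ a :=
  ⟨fun h y hy => (le_ciSup (bddAbove_iteratedFDeriv i f) ⟨y, hy⟩).trans h,
    fun h => Real.iSup_le (fun y => h y y.2) ha⟩

theorem le_semi (i : SeminormIndex E X) (f : Cinf E X) {y : E} (hy : y ∈ i.2.2.1) :
    ‖iteratedFDeriv ℝ i.2.1 (inChart i.1 f) y‖ ≤ semi i f :=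
  (semi_le_iff i f (apply_nonneg _ _)).1 le_rfl y hy

theorem tendsto_iff_semi {ι : Type*} {l : Filter ι} {u : ι → Cinf E X} {f : Cinf E X} :
    Tendsto u l (𝓝 f) ↔ ∀ i ε, 0 < ε → ∀ᶠ j in l, semi i (u j - f) < ε := by
  rw [tendsto_iff_tendstoUniformlyOn]
  refine forall_congr' fun i => ?_
  rw [Metric.tendstoUniformlyOn_iff]
  constructor
  · intro h ε hε
    filter_upwards [h (ε / 2) (half_pos hε)] with j hj
    refine lt_of_le_of_lt ((semi_le_iff i _ (half_pos hε).le).2 fun y hy => ?_) (half_lt_self hε)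
    rw [iteratedFDeriv_inChart_sub _ _ _ _ (i.2.2.2.2 hy), ← dist_eq_norm, dist_comm]
    exact (hj y hy).le
  · intro h ε hε
    filter_upwards [h ε hε] with j hj y hy
    rw [dist_comm, dist_eq_norm, ← iteratedFDeriv_inChart_sub _ _ _ _ (i.2.2.2.2 hy)]
    exact (le_semi i _ hy).trans_lt hj

/-- Two topologies agree once the same filters lie below the neighbourhood filter of each point. For
both topologies this is uniform convergence of derivatives on the indexing compact sets. -/
theorem withSeminorms : WithSeminorms (semi (E := E) (X := X)) := by
  constructor
  refine TopologicalSpace.ext_nhds fun f => ?_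
  have h : ∀ l : Filter (Cinf E X), l ≤ 𝓝 f ↔
      l ≤ @nhds _ (semi (E := E) (X := X)).moduleFilterBasis.topology f := fun l => by
    rw [← tendsto_id', tendsto_iff_semi, ← tendsto_id']
    let _ := (semi (E := E) (X := X)).moduleFilterBasis.topology
    exact ((WithSeminorms.mk rfl : WithSeminorms (semi (E := E) (X := X))).tendsto_nhds id f).symm
  exact le_antisymm ((h _).1 le_rfl) ((h _).2 le_rfl)

instance : IsTopologicalAddGroup (Cinf E X) := withSeminorms.topologicalAddGroup
instance : ContinuousSMul ℂ (Cinf E X) := withSeminorms.continuousSMul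
instance : PolynormableSpace ℂ (Cinf E X) := withSeminorms.toPolynormableSpace
instance : LocallyConvexSpace ℝ (Cinf E X) := withSeminorms.toLocallyConvexSpace

instance : UniformSpace (Cinf E X) := IsTopologicalAddGroup.rightUniformSpace _
instance : IsUniformAddGroup (Cinf E X) := isUniformAddGroup_of_addCommGroup

end Basic

end Cinf
end

noncomputable section

open Filter Topology Set

/-! ### `C^∞(X)` is a Fréchet space -/

namespace Cinf

section Frechet

variable {E : Type*} [NormedAddCommGroup E] [NormedSpace ℝ E]
  {X : Type*} [TopologicalSpace X] [ChartedSpace E X]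

theorem hasFDerivAt_iteratedFDeriv_of_contDiffAt {F : Type*} [NormedAddCommGroup F]
    [NormedSpace ℝ F] {h : E → F} {y : E} (hh : ContDiffAt ℝ ∞ h y) (k : ℕ) :
    HasFDerivAt (iteratedFDeriv ℝ k h) (iteratedFDeriv ℝ (k + 1) h y).curryLeft y := by
  have h1 : DifferentiableAt ℝ (iteratedFDeriv ℝ k h) y :=
    hh.differentiableAt_iteratedFDeriv (mod_cast WithTop.coe_lt_top (k : ℕ))
  have h2 := h1.hasFDerivAt
  rwa [fderiv_iteratedFDeriv] at h2

variable [IsManifold 𝓘(ℝ, E) ∞ X]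

/-- Smoothness in the preferred chart of each point suffices, because that chart is itself smooth.
Most functions below are shown to be smooth through this criterion. -/
theorem contMDiff_of_contDiffOn_chart {F : X → ℂ}
    (hF : ∀ x, ContDiffOn ℝ ∞ (fun y => F ((chartAt E x).symm y)) (chartAt E x).target) :
    ContMDiff 𝓘(ℝ, E) 𝓘(ℝ, ℂ) ∞ F := by
  intro x
  have h1 : ContMDiffOn 𝓘(ℝ, E) 𝓘(ℝ, ℂ) ∞
      ((fun y => F ((chartAt E x).symm y)) ∘ chartAt E x) (chartAt E x).source :=
    (hF x).contMDiffOn.comp (I' := 𝓘(ℝ, E)) contMDiffOn_chart (chartAt E x).mapsTo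
  have h2 : ContMDiffOn 𝓘(ℝ, E) 𝓘(ℝ, ℂ) ∞ F (chartAt E x).source :=
    h1.congr fun z hz => by simp [(chartAt E x).left_inv hz]
  exact h2.contMDiffAt ((chartAt E x).open_source.mem_nhds (mem_chart_source E x))

/-- Near a point of the domain of two charts, the derivatives of `f` in one chart are bounded by
those in the other one. -/
theorem eventually_norm_iteratedFDeriv_le (x x' : X) (k : ℕ) {K' : Set E} (hK' : IsCompact K')
    (hKt : K' ⊆ (chartAt E x').target) {y : E} (hy : y ∈ (chartAt E x).target)
    (hy' : (chartAt E x).symm y ∈ (chartAt E x').source)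
    (hi : chartAt E x' ((chartAt E x).symm y) ∈ interior K') :
    ∃ C : ℝ, 0 ≤ C ∧ ∀ᶠ z in 𝓝 y, ∀ f : Cinf E X, ‖iteratedFDeriv ℝ k (inChart x f) z‖ ≤
      C * ∑ j ∈ Finset.range (k + 1), semi ⟨x', j, K', hK', hKt⟩ f := by
  set ψ : OpenPartialHomeomorph E E := (chartAt E x).symm.trans (chartAt E x') with hψ
  have hs : IsOpen ψ.source := ψ.open_source
  have hys : y ∈ ψ.source := by simp [hψ, hy, hy']
  have hψd : ContDiffOn ℝ ∞ ψ ψ.source := by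
    rw [← contMDiffOn_iff_contDiffOn]
    have h1 : ContMDiffOn 𝓘(ℝ, E) 𝓘(ℝ, E) ∞ (chartAt E x').toFun (chartAt E x').source :=
      contMDiffOn_chart
    have h2 : ContMDiffOn 𝓘(ℝ, E) 𝓘(ℝ, E) ∞ (chartAt E x).symm (chartAt E x).target :=
      contMDiffOn_chart_symm
    exact h1.comp (h2.mono fun z hz => by simpa using hz.1) fun z hz => by simpa using hz.2
  -- The bound for derivatives of a composition asks for `‖D^j ψ‖ ≤ D ^ j`. A single bound `D` for
  -- all orders gives this because `1 ≤ D`.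
  obtain ⟨D, hD1, hD⟩ : ∃ D : ℝ, 1 ≤ D ∧ ∀ᶠ z in 𝓝 y, ∀ j ∈ Finset.range (k + 1),
      ‖iteratedFDerivWithin ℝ j ψ ψ.source z‖ ≤ D := by
    refine ⟨1 + ∑ j ∈ Finset.range (k + 1), (‖iteratedFDerivWithin ℝ j ψ ψ.source y‖ + 1),
      le_add_of_nonneg_right (Finset.sum_nonneg fun _ _ => by positivity), ?_⟩
    rw [Finset.eventually_all]
    intro j hj
    have hc : ContinuousAt (iteratedFDerivWithin ℝ j ψ ψ.source) y :=
      (hψd.continuousOn_iteratedFDerivWithin (m := j) (mod_cast le_top)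
        hs.uniqueDiffOn).continuousAt (hs.mem_nhds hys)
    filter_upwards [hc.norm.eventually_lt_const (lt_add_one _)] with z hz
    refine hz.le.trans (le_trans ?_ (le_add_of_nonneg_left zero_le_one))
    exact Finset.single_le_sum (f := fun j => ‖iteratedFDerivWithin ℝ j ψ ψ.source y‖ + 1)
      (fun _ _ => by positivity) hj
  have hint : ∀ᶠ z in 𝓝 y, ψ z ∈ interior K' :=
    (ψ.continuousAt hys).eventually (isOpen_interior.mem_nhds (by simpa [hψ] using hi))
  refine ⟨k.factorial * D ^ k, by positivity, ?_⟩
  filter_upwards [hD, hint, hs.mem_nhds hys] with z hzD hzi hzs f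
  have hcomp : ∀ w ∈ ψ.source, inChart x f w = (inChart x' f ∘ ψ) w := fun w hw => by
    have hw2 : (chartAt E x).symm w ∈ (chartAt E x').source := by simpa using hw.2
    simp [inChart, hψ, (chartAt E x').left_inv hw2]
  rw [← iteratedFDerivWithin_of_isOpen k hs hzs, iteratedFDerivWithin_congr hcomp hzs]
  refine (norm_iteratedFDerivWithin_comp_le (contDiffOn_inChart x' f) hψd (mod_cast le_top)
    (chartAt E x').open_target.uniqueDiffOn hs.uniqueDiffOn
    (fun w hw => (chartAt E x').map_source (by simpa using hw.2)) hzs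
    (C := ∑ j ∈ Finset.range (k + 1), semi ⟨x', j, K', hK', hKt⟩ f) (D := D) ?_ ?_).trans
    (le_of_eq (by ring))
  · intro j hj
    rw [iteratedFDerivWithin_of_isOpen j (chartAt E x').open_target (hKt (interior_subset hzi))]
    refine (le_semi ⟨x', j, K', hK', hKt⟩ f (interior_subset hzi)).trans ?_
    exact Finset.single_le_sum (f := fun j => semi ⟨x', j, K', hK', hKt⟩ f)
      (fun _ _ => apply_nonneg _ _) (Finset.mem_range.2 (by omega))
  · intro j hj1 hj
    exact (hzD j (Finset.mem_range.2 (by omega))).trans (le_self_pow₀ hD1 (by omega))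

/-- A family of compact subsets of chart images whose interiors cover `X` suffices to define the
topology. -/
theorem withSeminorms_of_cover {ι : Type*} (c : ι → X) (K : ι → Set E)
    (hK : ∀ a, IsCompact (K a)) (hKt : ∀ a, K a ⊆ (chartAt E (c a)).target)
    (hcov : ∀ z : X, ∃ a, z ∈ (chartAt E (c a)).source ∧ chartAt E (c a) z ∈ interior (K a)) :
    WithSeminorms (fun a : ι × ℕ =>
      (semi ⟨c a.1, a.2, K a.1, hK a.1, hKt a.1⟩ : Seminorm ℂ (Cinf E X))) := by
  set q : SeminormFamily ℂ (Cinf E X) (ι × ℕ) := fun a =>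
    semi ⟨c a.1, a.2, K a.1, hK a.1, hKt a.1⟩ with hq
  have hqs : ∀ (s : Finset (ι × ℕ)) (f : Cinf E X) (a), a ∈ s → q a f ≤ s.sup q f :=
    fun s f a ha => Seminorm.le_def.1 (Finset.le_sup (f := q) ha) f
  refine withSeminorms.congr ?_ ?_
  · exact fun a => ⟨{⟨c a.1, a.2, K a.1, hK a.1, hKt a.1⟩}, 1, by
      rw [Finset.sup_singleton, one_smul]; exact le_rfl⟩
  intro i
  obtain ⟨x, k, L, hL, hLt⟩ := i
  -- Compactness induction on `L`: such a bound passes to subsets and to finite unions, and it holds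
  -- near each point by the change of charts estimate.
  have key : ∃ (s : Finset (ι × ℕ)) (C : ℝ), 0 ≤ C ∧ ∀ y ∈ L, ∀ f : Cinf E X,
      ‖iteratedFDeriv ℝ k (inChart x f) y‖ ≤ C * s.sup q f := by
    refine hL.induction_on (p := fun S => ∃ (s : Finset (ι × ℕ)) (C : ℝ), 0 ≤ C ∧
      ∀ y ∈ S, ∀ f : Cinf E X, ‖iteratedFDeriv ℝ k (inChart x f) y‖ ≤ C * s.sup q f)
      ⟨∅, 0, le_rfl, by simp⟩ ?_ ?_ ?_
    · rintro S S' hSS ⟨s, C, hC, h⟩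
      exact ⟨s, C, hC, fun y hy => h y (hSS hy)⟩
    · classical
      rintro S S' ⟨s, C, hC, h⟩ ⟨s', C', hC', h'⟩
      have hmono : ∀ {t t' : Finset (ι × ℕ)}, t ⊆ t' → ∀ f : Cinf E X, t.sup q f ≤ t'.sup q f :=
        fun ht f => Seminorm.le_def.1 (Finset.sup_mono ht) f
      refine ⟨s ∪ s', max C C', le_max_of_le_left hC, ?_⟩
      rintro y (hy | hy) f
      · exact (h y hy f).trans (mul_le_mul (le_max_left _ _)
          (hmono Finset.subset_union_left f) (apply_nonneg _ _) (le_max_of_le_left hC))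
      · exact (h' y hy f).trans (mul_le_mul (le_max_right _ _)
          (hmono Finset.subset_union_right f) (apply_nonneg _ _) (le_max_of_le_left hC))
    · intro y hy
      obtain ⟨a, ha1, ha2⟩ := hcov ((chartAt E x).symm y)
      obtain ⟨C, hC, hev⟩ := eventually_norm_iteratedFDeriv_le x (c a) k (hK a) (hKt a)
        (hLt hy) ha1 ha2
      classical
      refine ⟨_, mem_nhdsWithin_of_mem_nhds hev,
        (Finset.range (k + 1)).image fun j => (a, j), C * (k + 1), by positivity, ?_⟩
      intro z hz f
      refine (hz f).trans ?_
      rw [mul_assoc]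
      refine mul_le_mul_of_nonneg_left ?_ hC
      have : ∀ j ∈ Finset.range (k + 1), semi ⟨c a, j, K a, hK a, hKt a⟩ f ≤
          ((Finset.range (k + 1)).image fun j => (a, j)).sup q f := fun j hj =>
        hqs _ f (a, j) (Finset.mem_image_of_mem _ hj)
      exact (Finset.sum_le_card_nsmul _ _ _ this).trans (by simp)
  obtain ⟨s, C, hC, h⟩ := key
  refine ⟨s, ⟨C, hC⟩, Seminorm.le_def.2 fun f => ?_⟩
  exact (semi_le_iff _ _ (mul_nonneg hC (apply_nonneg _ _))).2 fun y hy => h y hy f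

variable [FiniteDimensional ℝ E]

/-- By σ-compactness countably many charts and compact sets have interiors covering `X`, so
countably many seminorms define the topology. -/
theorem firstCountableTopology [SigmaCompactSpace X] : FirstCountableTopology (Cinf E X) := by
  have h : ∀ z : X, ∃ K : Set E, IsCompact K ∧ chartAt E z z ∈ interior K ∧
      K ⊆ (chartAt E z).target := fun z =>
    haveI := FiniteDimensional.proper_real E
    exists_compact_subset (chartAt E z).open_target (mem_chart_target E z)
  choose K hK hz hKt using h
  obtain ⟨s, hs, hcov⟩ := countable_cover_nhds_of_sigmaCompact
    (f := fun z => (chartAt E z).source ∩ chartAt E z ⁻¹' interior (K z)) fun z =>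
      ((chartAt E z).isOpen_inter_preimage isOpen_interior).mem_nhds ⟨mem_chart_source E z, hz z⟩
  have : Countable s := hs.to_subtype
  refine (withSeminorms_of_cover (fun a : s => (a : X)) (fun a => K a) (fun a => hK a)
    (fun a => hKt a) fun z => ?_).firstCountableTopology
  have hzU : z ∈ ⋃ x ∈ s, (chartAt E x).source ∩ chartAt E x ⁻¹' interior (K x) :=
    hcov ▸ mem_univ z
  simp only [mem_iUnion] at hzU
  obtain ⟨x, hx, h1, h2⟩ := hzU
  exact ⟨⟨x, hx⟩, h1, h2⟩

/-- In each chart all derivatives converge locally uniformly, so their limits form a Taylor series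
of the limit function. That function is therefore smooth, and it is the limit in `C^∞(X)`. -/
theorem exists_tendsto_of_cauchySeq {u : ℕ → Cinf E X} (hu : CauchySeq u) :
    ∃ f, Tendsto u atTop (𝓝 f) := by
  have h0 : Tendsto (fun p : ℕ × ℕ => u p.2 - u p.1) atTop (𝓝 0) := by
    have := cauchySeq_iff_tendsto.1 hu
    rw [uniformity_eq_comap_nhds_zero, tendsto_comap_iff] at this
    exact this
  have hunif : ∀ i : SeminormIndex E X, UniformCauchySeqOn
      (fun n => iteratedFDeriv ℝ i.2.1 (inChart i.1 (u n))) atTop i.2.2.1 := by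
    intro i
    rw [Metric.uniformCauchySeqOn_iff]
    intro ε hε
    have h1 := tendsto_iff_semi.1 h0 i ε hε
    rw [eventually_atTop] at h1
    obtain ⟨N, hN⟩ := h1
    refine ⟨max N.1 N.2, fun m hm n hn y hy => ?_⟩
    have h2 := hN (n, m) ⟨(le_max_left _ _).trans hn, (le_max_right _ _).trans hm⟩
    rw [dist_eq_norm, ← iteratedFDeriv_inChart_sub _ _ _ _ (i.2.2.2.2 hy)]
    refine lt_of_le_of_lt (le_semi i _ hy) ?_
    simpa using h2
  have hlim : ∀ (x : X) (k : ℕ) (y : E), ∃ g, y ∈ (chartAt E x).target →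
      Tendsto (fun n => iteratedFDeriv ℝ k (inChart x (u n)) y) atTop (𝓝 g) := by
    intro x k y
    by_cases hy : y ∈ (chartAt E x).target
    · have h2 := (hunif ⟨x, k, {y}, isCompact_singleton, singleton_subset_iff.2 hy⟩).cauchySeq
        (mem_singleton y)
      obtain ⟨g, hg⟩ := cauchySeq_tendsto_of_complete h2
      exact ⟨g, fun _ => hg⟩
    · exact ⟨0, fun h => absurd h hy⟩
  choose g hg using hlim
  have hgu : ∀ i : SeminormIndex E X, TendstoUniformlyOn
      (fun n => iteratedFDeriv ℝ i.2.1 (inChart i.1 (u n))) (g i.1 i.2.1) atTop i.2.2.1 :=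
    fun i => (hunif i).tendstoUniformlyOn_of_tendsto fun y hy => hg _ _ _ (i.2.2.2.2 hy)
  have := FiniteDimensional.proper_real E
  have hgl : ∀ x k, TendstoLocallyUniformlyOn (fun n => iteratedFDeriv ℝ k (inChart x (u n)))
      (g x k) atTop (chartAt E x).target := fun x k => by
    rw [tendstoLocallyUniformlyOn_iff_forall_isCompact (chartAt E x).open_target]
    exact fun K hKt hK => hgu ⟨x, k, K, hK, hKt⟩
  -- The limit function is read off at each point in that point's own chart. Uniqueness of pointwise
  -- limits later identifies it with the limit computed in any other chart.
  set F : X → ℂ := fun x => g x 0 (chartAt E x x) 0 with hF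
  have hFlim : ∀ x, Tendsto (fun n => u n x) atTop (𝓝 (F x)) := fun x => by
    have h1 := hg x 0 (chartAt E x x) (mem_chart_target E x)
    have h2 := ((ContinuousMultilinearMap.apply ℝ (fun _ : Fin 0 => E) ℂ 0).continuous.tendsto
      _).comp h1
    refine h2.congr fun n => ?_
    simp [inChart, (chartAt E x).left_inv (mem_chart_source E x)]
  have hder : ∀ x k, ∀ y ∈ (chartAt E x).target,
      HasFDerivAt (g x k) (g x (k + 1) y).curryLeft y := by
    intro x k y hy
    refine hasFDerivAt_of_tendstoLocallyUniformlyOn (l := atTop)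
      (f := fun n => iteratedFDeriv ℝ k (inChart x (u n)))
      (f' := fun n z => (iteratedFDeriv ℝ (k + 1) (inChart x (u n)) z).curryLeft)
      (g' := fun z => (g x (k + 1) z).curryLeft) (chartAt E x).open_target ?_
      (fun n z hz => hasFDerivAt_iteratedFDeriv_of_contDiffAt (contDiffAt_inChart x (u n) hz) k)
      (fun z hz => hg x k z hz) hy
    exact (continuousMultilinearCurryLeftEquiv ℝ (fun _ : Fin (k + 1) => E)
      ℂ).isometry.uniformContinuous.comp_tendstoLocallyUniformlyOn (hgl x (k + 1))
  have htay : ∀ x, HasFTaylorSeriesUpToOn ∞ (fun y => F ((chartAt E x).symm y))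
      (fun y k => g x k y) (chartAt E x).target := fun x => by
    refine ⟨fun y hy => ?_, fun m _ y hy => (hder x m y hy).hasFDerivWithinAt,
      fun m _ y hy => (hder x m y hy).continuousAt.continuousWithinAt⟩
    refine tendsto_nhds_unique ?_ (hFlim _)
    refine (((ContinuousMultilinearMap.apply ℝ (fun _ : Fin 0 => E) ℂ 0).continuous.tendsto
      _).comp (hg x 0 y hy)).congr fun n => ?_
    simp [inChart]
  refine ⟨mk F (contMDiff_of_contDiffOn_chart fun x => (htay x).contDiffOn), ?_⟩
  rw [tendsto_iff_tendstoUniformlyOn]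
  intro i
  refine (hgu i).congr_right fun y hy => ?_
  rw [← iteratedFDerivWithin_of_isOpen _ (chartAt E i.1).open_target (i.2.2.2.2 hy)]
  exact (htay i.1).eq_iteratedFDerivWithin_of_uniqueDiffOn (mod_cast le_top)
    (chartAt E i.1).open_target.uniqueDiffOn (i.2.2.2.2 hy)

variable [SigmaCompactSpace X]

instance : (uniformity (Cinf E X)).IsCountablyGenerated := by
  have := firstCountableTopology (E := E) (X := X)
  exact IsUniformAddGroup.uniformity_countably_generated

instance : CompleteSpace (Cinf E X) :=
  UniformSpace.complete_of_cauchySeq_tendsto fun _ hu => exists_tendsto_of_cauchySeq hu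

-- A complete space with countably generated uniformity is pseudometrizable, hence Baire, hence
-- barrelled.
instance : BarrelledSpace ℂ (Cinf E X) := by
  have : BaireSpace (Cinf E X) := by
    have := UniformSpace.pseudoMetrizableSpace (X := Cinf E X)
    let _ := UniformSpace.pseudoMetricSpace (Cinf E X)
    infer_instance
  infer_instance

end Frechet

/-! ### Automatic continuity of pointwise continuous linear maps into `C^∞(X)`. -/

section ContinuousOfEval

variable {E : Type*} [NormedAddCommGroup E] [NormedSpace ℝ E]
  {X : Type*} [TopologicalSpace X] [ChartedSpace E X] [IsManifold 𝓘(ℝ, E) ∞ X]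
  {V : Type*} [AddCommGroup V] [Module ℂ V] [UniformSpace V] [IsUniformAddGroup V]
  [ContinuousSMul ℂ V] [BarrelledSpace ℂ V]

/-- A linear map from a barrelled space to `C^∞(X)` is continuous if all its compositions with
evaluations are. -/
theorem continuous_of_continuous_eval (T : V →ₗ[ℂ] Cinf E X)
    (hT : ∀ x, Continuous fun v => T v x) : Continuous T := by
  -- By induction on the order, each derivative of `T v` at a point is a pointwise limit in `v` of
  -- difference quotients that are continuous in `v`. By Banach–Steinhaus a sequential limit of
  -- continuous functionals on a barrelled space is continuous.
  have key : ∀ (x : X) (k : ℕ), ∀ y ∈ (chartAt E x).target, ∀ w : Fin k → E,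
      Continuous fun v => iteratedFDeriv ℝ k (inChart x (T v)) y w := by
    intro x k
    induction k with
    | zero => exact fun y _ w => by simpa [inChart] using hT _
    | succ k ih =>
      intro y hy w
      have hcont : ∀ᶠ n : ℕ in atTop, y + ((n : ℝ))⁻¹ • w 0 ∈ (chartAt E x).target := by
        have : Tendsto (fun n : ℕ => y + ((n : ℝ))⁻¹ • w 0) atTop (𝓝 (y + (0 : ℝ) • w 0)) :=
          tendsto_const_nhds.add ((tendsto_inv_atTop_zero.comp
            tendsto_natCast_atTop_atTop).smul_const _)
        rw [zero_smul, add_zero] at this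
        exact this.eventually ((chartAt E x).open_target.mem_nhds hy)
      obtain ⟨N, hN⟩ := eventually_atTop.1 hcont
      -- The shift by `N` keeps every increment inside the chart image, where the derivatives are
      -- additive in `v`.
      let G : ℕ → V →L[ℂ] ℂ := fun n =>
        { toFun := fun v => (((n + N : ℕ) : ℝ) : ℂ) *
            (iteratedFDeriv ℝ k (inChart x (T v)) (y + (((n + N : ℕ) : ℝ))⁻¹ • w 0) (Fin.tail w) -
              iteratedFDeriv ℝ k (inChart x (T v)) y (Fin.tail w))
          map_add' := fun v v' => by
            rw [map_add, iteratedFDeriv_inChart_add _ _ _ _ hy,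
              iteratedFDeriv_inChart_add _ _ _ _ (hN _ (Nat.le_add_left _ _))]
            simp only [_root_.add_apply]
            ring
          map_smul' := fun c v => by
            rw [map_smul, iteratedFDeriv_inChart_smul _ _ _ _ hy,
              iteratedFDeriv_inChart_smul _ _ _ _ (hN _ (Nat.le_add_left _ _))]
            simp only [_root_.smul_apply, smul_eq_mul, RingHom.id_apply]
            ring
          cont := continuous_const.mul
            ((ih _ (hN _ (Nat.le_add_left _ _)) _).sub (ih _ hy _)) }
      refine (continuousLinearMapOfTendsto (l := atTop) G
        (f := fun v => iteratedFDeriv ℝ (k + 1) (inChart x (T v)) y w) ?_).continuous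
      rw [tendsto_pi_nhds]
      intro v
      have hd := hasFDerivAt_iteratedFDeriv_of_contDiffAt (contDiffAt_inChart x (T v) hy) k
      have hl := hd.lim (w 0) (c := fun n : ℕ => ((n + N : ℕ) : ℝ))
        (l := atTop) (tendsto_norm_atTop_atTop.comp
          (tendsto_natCast_atTop_atTop.comp (tendsto_add_atTop_nat N)))
      have hl2 := ((ContinuousMultilinearMap.apply ℝ (fun _ : Fin k => E) ℂ
        (Fin.tail w)).continuous.tendsto _).comp hl
      refine (hl2.congr fun n => ?_).trans_eq ?_
      · simp [G]
      · simp [ContinuousMultilinearMap.curryLeft_apply, Fin.cons_self_tail]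
  refine (withSeminorms.continuous_iff_continuous_comp T).2 fun i => ?_
  -- On a barrelled space a lower semicontinuous seminorm is continuous. The sublevel sets here are
  -- intersections of closed conditions, one for each point and each tuple of vectors.
  refine Seminorm.continuous_of_lowerSemicontinuous _ ?_
  rw [lowerSemicontinuous_iff_isClosed_preimage]
  intro a
  rcases lt_or_ge a 0 with ha | ha
  · convert isClosed_empty
    ext v
    simpa using ha.trans_le (apply_nonneg (semi i) (T v))
  · have : ((semi i).comp T) ⁻¹' Iic a = ⋂ (y ∈ i.2.2.1) (w : Fin i.2.1 → E),
        {v | ‖iteratedFDeriv ℝ i.2.1 (inChart i.1 (T v)) y w‖ ≤ a * ∏ j, ‖w j‖} := by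
      ext v
      simp only [mem_preimage, Seminorm.comp_apply, mem_Iic, mem_iInter, mem_ofPred_eq]
      rw [semi_le_iff _ _ ha]
      exact forall₂_congr fun y _ => ContinuousMultilinearMap.opNorm_le_iff ha
    rw [this]
    exact isClosed_biInter fun y hy => isClosed_iInter fun w =>
      isClosed_le (key _ _ y (i.2.2.2.2 hy) w).norm continuous_const

/-- A linear map from a barrelled space to `C^∞(X)` which is pointwise continuous, as a continuous
linear map. -/
def mkCLM (T : V →ₗ[ℂ] Cinf E X) (hT : ∀ x, Continuous fun v => T v x) : V →L[ℂ] Cinf E X :=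
  ⟨T, continuous_of_continuous_eval T hT⟩

end ContinuousOfEval

end Cinf
end

noncomputable section

set_option linter.unusedSectionVars false

open Filter Topology Set

/-! ### Separately continuous bilinear maps -/

/-- A separately continuous bilinear map on first countable spaces, the first of which is barrelled,
is jointly continuous. -/
theorem continuous_of_separately_continuous {V W Z : Type*}
    [AddCommGroup V] [Module ℂ V] [UniformSpace V] [IsUniformAddGroup V] [ContinuousSMul ℂ V]
    [BarrelledSpace ℂ V] [(uniformity V).IsCountablyGenerated]
    [AddCommGroup W] [Module ℂ W] [UniformSpace W] [IsUniformAddGroup W] [ContinuousSMul ℂ W]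
    [(uniformity W).IsCountablyGenerated]
    [AddCommGroup Z] [Module ℂ Z] [UniformSpace Z] [IsUniformAddGroup Z] [ContinuousSMul ℂ Z]
    [PolynormableSpace ℂ Z] (B : V →ₗ[ℂ] W →ₗ[ℂ] Z) (h1 : ∀ w, Continuous fun v => B v w)
    (h2 : ∀ v, Continuous (B v)) : Continuous fun x : V × W => B x.1 x.2 := by
  refine continuous_iff_seqContinuous.2 fun u a hu => ?_
  have hu1 : Tendsto (fun n => (u n).1) atTop (𝓝 a.1) := (continuous_fst.tendsto a).comp hu
  have hu2 : Tendsto (fun n => (u n).2) atTop (𝓝 a.2) := (continuous_snd.tendsto a).comp hu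
  -- The operators `B(·, w_n)` along a convergent sequence are pointwise bounded, hence
  -- equicontinuous. The claim follows from `B(v_n, w_n) = B(v_n - v, w_n) + B(v, w_n)`.
  let G : ℕ → V →L[ℂ] Z := fun n => ⟨B.flip (u n).2, h1 (u n).2⟩
  have hG : UniformEquicontinuous ((↑) ∘ G : ℕ → V → Z) :=
    PolynormableSpace.banach_steinhaus fun v =>
      (((h2 v).tendsto _).comp hu2).isVonNBounded_range ℂ
  have h3 : Tendsto (fun n => G n ((u n).1 - a.1)) atTop (𝓝 0) := by
    have h4 : Tendsto (fun n => (u n).1 - a.1) atTop (𝓝 0) := by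
      simpa using hu1.sub_const a.1
    have h5 := hG.equicontinuous 0
    rw [tendsto_def]
    intro s hs
    have h6 : {p : Z × Z | p.2 - p.1 ∈ s} ∈ uniformity Z := by
      rw [uniformity_eq_comap_nhds_zero]
      exact ⟨s, hs, fun p hp => hp⟩
    filter_upwards [h4.eventually (h5 _ h6)] with n hn
    simpa using hn n
  have h7 : Tendsto (fun n => B a.1 (u n).2) atTop (𝓝 (B a.1 a.2)) :=
    ((h2 a.1).tendsto _).comp hu2
  have h8 := h3.add h7
  rw [zero_add] at h8
  refine h8.congr fun n => ?_
  change B ((u n).1 - a.1) (u n).2 + B a.1 (u n).2 = B (u n).1 (u n).2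
  rw [map_sub, LinearMap.sub_apply, sub_add_cancel]

/-! ### Products of manifolds -/

section Prod

variable {E : Type*} [NormedAddCommGroup E] [NormedSpace ℝ E]
  {X : Type*} [TopologicalSpace X] [ChartedSpace E X]
  {E' : Type*} [NormedAddCommGroup E'] [NormedSpace ℝ E']
  {Y : Type*} [TopologicalSpace Y] [ChartedSpace E' Y]
  {E'' : Type*} [NormedAddCommGroup E''] [NormedSpace ℝ E'']
  {Z : Type*} [TopologicalSpace Z] [ChartedSpace E'' Z]

/-- The product of two manifolds, modelled on the product of the model spaces. -/
instance (priority := 50) prodChartedSpaceSelf : ChartedSpace (E × E') (X × Y) :=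
  prodChartedSpace E X E' Y

instance prodIsManifold [IsManifold 𝓘(ℝ, E) ∞ X] [IsManifold 𝓘(ℝ, E') ∞ Y] :
    IsManifold 𝓘(ℝ, E × E') ∞ (X × Y) := by
  rw [modelWithCornersSelf_prod]
  exact IsManifold.prod (I := 𝓘(ℝ, E)) (I' := 𝓘(ℝ, E')) X Y

/-- The model `𝓘(ℝ, E × E')` equals the product model only by rewriting. Function spaces on products
use the former, actions and bundles the latter. -/
theorem contMDiff_prod_dom {f : X × Y → Z} :
    ContMDiff 𝓘(ℝ, E × E') 𝓘(ℝ, E'') ∞ f ↔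
      ContMDiff (𝓘(ℝ, E).prod 𝓘(ℝ, E')) 𝓘(ℝ, E'') ∞ f := by
  rw [modelWithCornersSelf_prod]

theorem contMDiffOn_prod_dom {f : X × Y → Z} {s : Set (X × Y)} :
    ContMDiffOn 𝓘(ℝ, E × E') 𝓘(ℝ, E'') ∞ f s ↔
      ContMDiffOn (𝓘(ℝ, E).prod 𝓘(ℝ, E')) 𝓘(ℝ, E'') ∞ f s := by
  rw [modelWithCornersSelf_prod]

theorem contMDiffOn_prod_codom {f : Z → X × Y} {s : Set Z} :
    ContMDiffOn 𝓘(ℝ, E'') 𝓘(ℝ, E × E') ∞ f s ↔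
      ContMDiffOn 𝓘(ℝ, E'') (𝓘(ℝ, E).prod 𝓘(ℝ, E')) ∞ f s := by
  rw [modelWithCornersSelf_prod]

theorem contMDiffFst : ContMDiff 𝓘(ℝ, E × E') 𝓘(ℝ, E) ∞ (Prod.fst : X × Y → X) :=
  contMDiff_prod_dom.2 contMDiff_fst

theorem contMDiffSnd : ContMDiff 𝓘(ℝ, E × E') 𝓘(ℝ, E') ∞ (Prod.snd : X × Y → Y) :=
  contMDiff_prod_dom.2 contMDiff_snd

theorem ContMDiffOn.cmul {f g : X → ℂ} {s : Set X} (hf : ContMDiffOn 𝓘(ℝ, E) 𝓘(ℝ, ℂ) ∞ f s)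
    (hg : ContMDiffOn 𝓘(ℝ, E) 𝓘(ℝ, ℂ) ∞ g s) :
    ContMDiffOn 𝓘(ℝ, E) 𝓘(ℝ, ℂ) ∞ (fun x => f x * g x) s := by
  have h : ContDiff ℝ ∞ fun p : ℂ × ℂ => p.1 * p.2 := contDiff_fst.mul contDiff_snd
  exact h.contMDiff.comp_contMDiffOn (hf.prodMk_space hg)

theorem ContMDiff.cmul {f g : X → ℂ} (hf : ContMDiff 𝓘(ℝ, E) 𝓘(ℝ, ℂ) ∞ f)
    (hg : ContMDiff 𝓘(ℝ, E) 𝓘(ℝ, ℂ) ∞ g) : ContMDiff 𝓘(ℝ, E) 𝓘(ℝ, ℂ) ∞ fun x => f x * g x :=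
  contMDiffOn_univ.1 (hf.contMDiffOn.cmul hg.contMDiffOn)

theorem ContMDiffOn.pair {f : Z → X} {g : Z → Y} {s : Set Z}
    (hf : ContMDiffOn 𝓘(ℝ, E'') 𝓘(ℝ, E) ∞ f s) (hg : ContMDiffOn 𝓘(ℝ, E'') 𝓘(ℝ, E') ∞ g s) :
    ContMDiffOn 𝓘(ℝ, E'') 𝓘(ℝ, E × E') ∞ (fun z => (f z, g z)) s :=
  contMDiffOn_prod_codom.2 (hf.prodMk hg)

theorem ContMDiff.pair {f : Z → X} {g : Z → Y}
    (hf : ContMDiff 𝓘(ℝ, E'') 𝓘(ℝ, E) ∞ f) (hg : ContMDiff 𝓘(ℝ, E'') 𝓘(ℝ, E') ∞ g) :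
    ContMDiff 𝓘(ℝ, E'') 𝓘(ℝ, E × E') ∞ fun z => (f z, g z) :=
  contMDiffOn_univ.1 (hf.contMDiffOn.pair hg.contMDiffOn)

end Prod

/-! ### Continuous linear maps between function spaces -/

namespace Cinf

section Maps

variable {E : Type*} [NormedAddCommGroup E] [NormedSpace ℝ E] [FiniteDimensional ℝ E]
  {X : Type*} [TopologicalSpace X] [ChartedSpace E X] [IsManifold 𝓘(ℝ, E) ∞ X]
  [SigmaCompactSpace X]
  {E' : Type*} [NormedAddCommGroup E'] [NormedSpace ℝ E'] [FiniteDimensional ℝ E']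
  {Y : Type*} [TopologicalSpace Y] [ChartedSpace E' Y] [IsManifold 𝓘(ℝ, E') ∞ Y]
  [SigmaCompactSpace Y]
  {E'' : Type*} [NormedAddCommGroup E''] [NormedSpace ℝ E''] [FiniteDimensional ℝ E'']
  {Z : Type*} [TopologicalSpace Z] [ChartedSpace E'' Z] [IsManifold 𝓘(ℝ, E'') ∞ Z]
  [SigmaCompactSpace Z]

/-- Pull-back along a smooth map, as a continuous linear map. -/
def comap (φ : X → Y) (hφ : ContMDiff 𝓘(ℝ, E) 𝓘(ℝ, E') ∞ φ) : Cinf E' Y →L[ℂ] Cinf E X :=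
  mkCLM (pullback φ hφ) fun x => continuous_eval E' (φ x)

@[simp] theorem comap_apply (φ : X → Y) (hφ : ContMDiff 𝓘(ℝ, E) 𝓘(ℝ, E') ∞ φ) (f : Cinf E' Y)
    (x : X) : comap φ hφ f x = f (φ x) := rfl

/-- The pointwise product. -/
def pmul : Cinf E X →ₗ[ℂ] Cinf E X →ₗ[ℂ] Cinf E X :=
  LinearMap.mk₂ ℂ (fun f g => mk (fun x => f x * g x) (f.contMDiff.cmul g.contMDiff))
    (fun _ _ _ => by ext; simp [add_mul]) (fun _ _ _ => by ext; simp [mul_assoc])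
    (fun _ _ _ => by ext; simp [mul_add]) (fun _ _ _ => by ext; simp [mul_left_comm])

@[simp] theorem pmul_apply (f g : Cinf E X) (x : X) : pmul f g x = f x * g x := rfl

theorem continuous_pmul : Continuous fun x : Cinf E X × Cinf E X => pmul x.1 x.2 :=
  continuous_of_separately_continuous pmul
    (fun g => continuous_of_continuous_eval (pmul.flip g) fun x =>
      (continuous_eval E x).mul continuous_const)
    (fun f => continuous_of_continuous_eval (pmul f) fun x =>
      continuous_const.mul (continuous_eval E x))

/-- The constant function `1`. -/
def one : Cinf E X := mk (fun _ => 1) contMDiff_const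

@[simp] theorem one_apply (x : X) : (one : Cinf E X) x = 1 := rfl

/-- The function `(x, y) ↦ f x * g y`, as a bilinear map. -/
def box : Cinf E X →ₗ[ℂ] Cinf E' Y →ₗ[ℂ] Cinf (E × E') (X × Y) :=
  LinearMap.mk₂ ℂ (fun f g => pmul (comap Prod.fst contMDiffFst f) (comap Prod.snd contMDiffSnd g))
    (fun _ _ _ => by simp) (fun _ _ _ => by simp) (fun _ _ _ => by simp) (fun _ _ _ => by simp)

@[simp] theorem box_apply (f : Cinf E X) (g : Cinf E' Y) (z : X × Y) :
    box f g z = f z.1 * g z.2 := rfl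

theorem continuous_box : Continuous fun x : Cinf E X × Cinf E' Y => box x.1 x.2 :=
  continuous_pmul.comp (((comap Prod.fst contMDiffFst).continuous.comp continuous_fst).prodMk
    ((comap Prod.snd contMDiffSnd).continuous.comp continuous_snd))

end Maps

end Cinf
end

noncomputable section

set_option linter.unusedSectionVars false

open Filter Topology Set MeasureTheory

/-! ### Fourier expansion of functions which are periodic in some variables -/

namespace Cinf

section FourierCoeff

variable {d : ℕ} {E : Type*} [NormedAddCommGroup E] [NormedSpace ℝ E] [FiniteDimensional ℝ E]
  {Y : Type*} [TopologicalSpace Y] [ChartedSpace E Y] [IsManifold 𝓘(ℝ, E) ∞ Y]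
  [SigmaCompactSpace Y]

open scoped BoundedContinuousFunction

theorem contDiffOn_prodChart (F : Cinf ((Fin d → ℝ) × E) ((Fin d → ℝ) × Y)) (y : Y) :
    ContDiffOn ℝ ∞ (fun z : (Fin d → ℝ) × E => F (z.1, (chartAt E y).symm z.2))
      (univ ×ˢ (chartAt E y).target) :=
  contDiffOn_inChart ((0 : Fin d → ℝ), y) F

theorem contDiff_left (F : Cinf ((Fin d → ℝ) × E) ((Fin d → ℝ) × Y)) (y : Y) :
    ContDiff ℝ ∞ fun t => F (t, y) := by
  have h := F.contMDiff.comp (contMDiff_id.pair (contMDiff_const (c := y)))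
  exact contMDiff_iff_contDiff.1 h

theorem continuous_left (F : Cinf ((Fin d → ℝ) × E) ((Fin d → ℝ) × Y)) (y : Y) :
    Continuous fun t => F (t, y) := (contDiff_left F y).continuous

theorem integrableOn_mul_left (g : (Fin d → ℝ) →ᵇ ℂ)
    (F : Cinf ((Fin d → ℝ) × E) ((Fin d → ℝ) × Y)) (y : Y) :
    IntegrableOn (fun t => g t * F (t, y)) (Icc 0 1) :=
  (g.continuous.mul (continuous_left F y)).continuousOn.integrableOn_compact isCompact_Icc

theorem norm_le_one_of_mem_Icc {t : Fin d → ℝ} (ht : t ∈ Icc (0 : Fin d → ℝ) 1) : ‖t‖ ≤ 1 :=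
  (pi_norm_le_iff_of_nonneg zero_le_one).2 fun j => by
    rw [Real.norm_of_nonneg (ht.1 j)]; exact ht.2 j

/-- The integral is a convolution evaluated at `0`, so smooth dependence on `y` follows from
smoothness of convolutions with parameters. -/
theorem contMDiff_integral (g : (Fin d → ℝ) →ᵇ ℂ)
    (F : Cinf ((Fin d → ℝ) × E) ((Fin d → ℝ) × Y)) :
    ContMDiff 𝓘(ℝ, E) 𝓘(ℝ, ℂ) ∞ fun y => ∫ t in Icc (0 : Fin d → ℝ) 1, g t * F (t, y) := by
  refine contMDiff_of_contDiffOn_chart fun y => ?_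
  -- The unit cube lies in the sup-norm ball of radius `1`, so this bump is `1` at `-t` for every
  -- `t` in the cube. Its compact support makes the convolution lemma applicable without changing
  -- the integral.
  let b : ContDiffBump (0 : Fin d → ℝ) := ⟨2, 3, by norm_num, by norm_num⟩
  let h : E → (Fin d → ℝ) → ℂ := fun p x => (b x : ℂ) * F (-x, (chartAt E y).symm p)
  have hh : ContDiffOn ℝ ∞ (Function.uncurry h) ((chartAt E y).target ×ˢ univ) := by
    refine ContDiffOn.mul ?_ ?_
    · exact (Complex.ofRealCLM.contDiff.comp (b.contDiff.comp contDiff_snd)).contDiffOn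
    · exact (contDiffOn_prodChart F y).comp (contDiff_snd.neg.prodMk contDiff_fst).contDiffOn
        fun z hz => ⟨mem_univ _, hz.1⟩
  have hint : LocallyIntegrable ((Icc (0 : Fin d → ℝ) 1).indicator g) volume :=
    ((integrable_indicator_iff measurableSet_Icc).2
      (g.continuous.continuousOn.integrableOn_compact isCompact_Icc)).locallyIntegrable
  have := contDiffOn_convolution_right_with_param_comp (n := ⊤) (ContinuousLinearMap.mul ℝ ℂ)
    (v := fun _ : E => (0 : Fin d → ℝ)) (μ := volume) contDiffOn_const (chartAt E y).open_target
    (isCompact_closedBall (0 : Fin d → ℝ) 3) (g := h) (fun p x _ hx => by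
      have : b x = 0 := b.zero_of_le_dist (by
        simpa [b] using (not_le.1 (fun h => hx (Metric.mem_closedBall.2 h))).le)
      simp [h, this]) hint hh
  refine this.congr fun z hz => ?_
  rw [convolution_def, ← integral_indicator measurableSet_Icc]
  refine integral_congr_ae (.of_forall fun t => ?_)
  by_cases ht : t ∈ Icc (0 : Fin d → ℝ) 1
  · have : b (-t) = 1 := b.one_of_mem_closedBall (by
      simpa [b] using (norm_le_one_of_mem_Icc ht).trans one_le_two)
    simp [indicator_of_mem ht, h, this]
  · simp [indicator_of_notMem ht]

/-- The function `y ↦ ∫ g(t) F(t, y) dt`, the integral being over the unit cube. -/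
def integralMul (g : (Fin d → ℝ) →ᵇ ℂ) (F : Cinf ((Fin d → ℝ) × E) ((Fin d → ℝ) × Y)) :
    Cinf E Y :=
  mk (fun y => ∫ t in Icc (0 : Fin d → ℝ) 1, g t * F (t, y)) (contMDiff_integral g F)

/-- The seminorm takes no derivative and uses the compact set formed by the cube times one point of
the chart image. -/
theorem exists_norm_left_le (y : Y) : ∃ i : SeminormIndex ((Fin d → ℝ) × E) ((Fin d → ℝ) × Y),
    ∀ (F : Cinf ((Fin d → ℝ) × E) ((Fin d → ℝ) × Y)), ∀ t ∈ Icc (0 : Fin d → ℝ) 1,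
      ‖F (t, y)‖ ≤ semi i F := by
  refine ⟨⟨(0, y), 0, Icc 0 1 ×ˢ {chartAt E y y}, isCompact_Icc.prod isCompact_singleton, ?_⟩, ?_⟩
  · rintro ⟨t, z⟩ ⟨-, hz⟩
    obtain rfl : z = _ := hz
    exact ⟨mem_univ _, mem_chart_target E y⟩
  · intro F t ht
    have h := le_semi ⟨(0, y), 0, Icc 0 1 ×ˢ {chartAt E y y},
      isCompact_Icc.prod isCompact_singleton, by
        rintro ⟨t, z⟩ ⟨-, hz⟩
        obtain rfl : z = _ := hz
        exact ⟨mem_univ _, mem_chart_target E y⟩⟩ F (y := (t, chartAt E y y)) ⟨ht, rfl⟩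
    rw [norm_iteratedFDeriv_zero] at h
    have h2 : inChart ((0 : Fin d → ℝ), y) F (t, chartAt E y y) = F (t, y) := by
      change F (t, (chartAt E y).symm (chartAt E y y)) = _
      rw [(chartAt E y).left_inv (mem_chart_source E y)]
    rwa [h2] at h

theorem norm_setIntegral_Icc_le {f : (Fin d → ℝ) → ℂ} {C : ℝ}
    (hf : ∀ t ∈ Icc (0 : Fin d → ℝ) 1, ‖f t‖ ≤ C) :
    ‖∫ t in Icc (0 : Fin d → ℝ) 1, f t‖ ≤ C := by
  have h := norm_setIntegral_le_of_norm_le_const (μ := volume) (s := Icc (0 : Fin d → ℝ) 1)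
    (isCompact_Icc.measure_lt_top) hf
  simpa [measureReal_def, Real.volume_Icc_pi] using h

/-- For fixed `F`, the functions `∫ g(t) F(t, ·) dt` depend continuously on the test function
`g`. -/
def integralMulLeft (F : Cinf ((Fin d → ℝ) × E) ((Fin d → ℝ) × Y)) :
    ((Fin d → ℝ) →ᵇ ℂ) →L[ℂ] Cinf E Y :=
  mkCLM
    { toFun := fun g => integralMul g F
      map_add' := fun g g' => by
        ext y
        simp only [integralMul, mk_apply, BoundedContinuousFunction.add_apply, add_mul, add_apply]
        exact integral_add (integrableOn_mul_left g F y) (integrableOn_mul_left g' F y)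
      map_smul' := fun c g => by
        ext y
        simp only [integralMul, mk_apply, BoundedContinuousFunction.coe_smul, smul_eq_mul,
          mul_assoc, smul_apply, RingHom.id_apply]
        exact integral_const_mul _ _ }
    fun y => by
      obtain ⟨i, hi⟩ := exists_norm_left_le (d := d) (E := E) y
      let φ : ((Fin d → ℝ) →ᵇ ℂ) →ₗ[ℂ] ℂ :=
        { toFun := fun g => ∫ t in Icc (0 : Fin d → ℝ) 1, g t * F (t, y)
          map_add' := fun g g' => by
            simp only [BoundedContinuousFunction.add_apply, add_mul]
            exact integral_add (integrableOn_mul_left g F y) (integrableOn_mul_left g' F y)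
          map_smul' := fun c g => by
            simp only [BoundedContinuousFunction.coe_smul, smul_eq_mul, mul_assoc,
              RingHom.id_apply]
            exact integral_const_mul _ _ }
      refine (φ.mkContinuous (semi i F) fun g => ?_).continuous
      refine norm_setIntegral_Icc_le fun t ht => ?_
      rw [norm_mul, mul_comm]
      exact mul_le_mul (hi F t ht) (g.norm_coe_le_norm t) (norm_nonneg _) (apply_nonneg _ _)

/-- For a fixed test function `g`, the functions `∫ g(t) F(t, ·) dt` depend continuously on
`F`. -/
def integralMulRight (g : (Fin d → ℝ) →ᵇ ℂ) :
    Cinf ((Fin d → ℝ) × E) ((Fin d → ℝ) × Y) →L[ℂ] Cinf E Y :=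
  mkCLM
    { toFun := fun F => integralMul g F
      map_add' := fun F F' => by
        ext y
        simp only [integralMul, mk_apply, mul_add, add_apply]
        exact integral_add (integrableOn_mul_left g F y) (integrableOn_mul_left g F' y)
      map_smul' := fun c F => by
        ext y
        simp only [integralMul, mk_apply, mul_left_comm _ c, smul_apply, RingHom.id_apply]
        exact integral_const_mul _ _ }
    fun y => by
      obtain ⟨i, hi⟩ := exists_norm_left_le (d := d) (E := E) y
      let φ : Cinf ((Fin d → ℝ) × E) ((Fin d → ℝ) × Y) →ₗ[ℂ] ℂ :=
        { toFun := fun F => ∫ t in Icc (0 : Fin d → ℝ) 1, g t * F (t, y)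
          map_add' := fun F F' => by
            simp only [mul_add, add_apply]
            exact integral_add (integrableOn_mul_left g F y) (integrableOn_mul_left g F' y)
          map_smul' := fun c F => by
            simp only [mul_left_comm _ c, smul_apply, RingHom.id_apply, smul_eq_mul]
            exact integral_const_mul _ _ }
      refine withSeminorms.continuous_normedSpace_rng ℂ φ ⟨{i}, ⟨‖g‖, norm_nonneg _⟩, ?_⟩
      refine Seminorm.le_def.2 fun F => ?_
      rw [Finset.sup_singleton]
      refine norm_setIntegral_Icc_le fun t ht => ?_
      rw [norm_mul]
      exact mul_le_mul (g.norm_coe_le_norm t) (hi F t ht) (norm_nonneg _) (norm_nonneg _)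

open TorusAction

theorem norm_char (r : Fin d → ℤ) (s : Fin d → ℝ) : ‖char r s‖ = 1 := by
  rw [char, mul_right_comm, show (2 * Real.pi * ((∑ j, (r j : ℝ) * s j : ℝ) : ℂ) * Complex.I) =
    ((2 * Real.pi * ∑ j, (r j : ℝ) * s j : ℝ) : ℂ) * Complex.I by push_cast; ring]
  exact Complex.norm_exp_ofReal_mul_I _

theorem contDiff_char (r : Fin d → ℤ) : ContDiff ℝ ∞ (char r) := by
  unfold char
  have h : ContDiff ℝ ∞ fun s : Fin d → ℝ => ∑ j, (r j : ℝ) * s j := by fun_prop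
  exact ContDiff.cexp (contDiff_const.mul (Complex.ofRealCLM.contDiff.comp h))

theorem char_add_right (r : Fin d → ℤ) (s t : Fin d → ℝ) :
    char r (s + t) = char r s * char r t := by
  simp only [char, ← Complex.exp_add, Pi.add_apply, mul_add, Finset.sum_add_distrib]
  push_cast
  ring_nf

theorem char_add_left (r r' : Fin d → ℤ) (s : Fin d → ℝ) :
    char (r + r') s = char r s * char r' s := by
  simp only [char, ← Complex.exp_add, Pi.add_apply, Int.cast_add, add_mul, Finset.sum_add_distrib]
  push_cast
  ring_nf

theorem char_int (r k : Fin d → ℤ) : char r (fun i => (k i : ℝ)) = 1 := by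
  rw [char, Complex.exp_eq_one_iff]
  exact ⟨∑ j : Fin d, r j * k j, by push_cast; ring⟩

theorem char_zero_right (r : Fin d → ℤ) : char r 0 = 1 := by simp [char]

theorem char_zero_left (s : Fin d → ℝ) : char 0 s = 1 := by simp [char]

/-- The character `char r` as a bounded continuous function. -/
def charB (r : Fin d → ℤ) : (Fin d → ℝ) →ᵇ ℂ :=
  BoundedContinuousFunction.ofNormedAddCommGroup (char r) (contDiff_char r).continuous 1
    fun s => (norm_char r s).le

theorem norm_charB_le (r : Fin d → ℤ) : ‖charB r‖ ≤ 1 :=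
  BoundedContinuousFunction.norm_ofNormedAddCommGroup_le _ zero_le_one _

/-- The `k`-th Fourier coefficient of `F`, a function of the remaining variables. -/
def coeff (k : Fin d → ℤ) : Cinf ((Fin d → ℝ) × E) ((Fin d → ℝ) × Y) →L[ℂ] Cinf E Y :=
  integralMulRight (charB (-k))

theorem coeff_apply (k : Fin d → ℤ) (F : Cinf ((Fin d → ℝ) × E) ((Fin d → ℝ) × Y)) (y : Y) :
    coeff k F y = ∫ t in Icc (0 : Fin d → ℝ) 1, char (-k) t * F (t, y) := rfl

/-- For fixed `F` the coefficient depends continuously on the test function in the sup norm, and all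
characters lie in the unit ball. No estimate of derivatives in the remaining variables is needed. -/
theorem exists_seminorm_coeff_le {q : Seminorm ℂ (Cinf E Y)} (hq : Continuous q)
    (F : Cinf ((Fin d → ℝ) × E) ((Fin d → ℝ) × Y)) : ∃ C, ∀ k, q (coeff k F) ≤ C := by
  obtain ⟨C, hC, h⟩ := Seminorm.bound_of_continuous_normedSpace
    (q.comp (integralMulLeft F).toLinearMap) (hq.comp (integralMulLeft F).continuous)
  refine ⟨C, fun k => (h (charB (-k))).trans ?_⟩
  exact (mul_le_mul_of_nonneg_left (norm_charB_le _) hC.le).trans_eq (mul_one C)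

/-- `F` is `ℤ^d`-periodic in the first variable. -/
def IsPeriodic (F : Cinf ((Fin d → ℝ) × E) ((Fin d → ℝ) × Y)) : Prop :=
  ∀ (k : Fin d → ℤ) t y, F (t + (fun i => (k i : ℝ)), y) = F (t, y)

/-- Divergence theorem for the vector field whose only nonzero component is `h` in direction `j`: by
periodicity the two opposite faces cancel. -/
theorem integral_fderiv_eq_zero {h : (Fin d → ℝ) → ℂ} (hh : ContDiff ℝ ∞ h)
    (hp : ∀ (k : Fin d → ℤ) t, h (t + (fun i => (k i : ℝ))) = h t) (j : Fin d) :
    ∫ t in Icc (0 : Fin d → ℝ) 1, fderiv ℝ h t (Pi.single j 1) = 0 := by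
  obtain ⟨m, rfl⟩ : ∃ m, d = m + 1 := Nat.exists_eq_succ_of_ne_zero (Fin.pos j).ne'
  have hc : Continuous fun t => fderiv ℝ h t (Pi.single j 1) :=
    (hh.continuous_fderiv (by simp)).clm_apply continuous_const
  have hsum : ∀ t, ∑ i, (if i = j then fderiv ℝ h t else 0) (Pi.single i 1) =
      fderiv ℝ h t (Pi.single j 1) := fun t => by
    rw [Finset.sum_eq_single j (fun i _ hi => by simp [hi]) (by simp)]
    simp
  have := integral_divergence_of_hasFDerivAt_off_countable' (0 : Fin (m + 1) → ℝ) 1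
    (fun _ => zero_le_one) (fun i => if i = j then h else 0)
    (fun i t => if i = j then fderiv ℝ h t else 0) ∅ countable_empty
    (fun i => by
      split_ifs
      · exact hh.continuous.continuousOn
      · exact continuousOn_const)
    (fun t _ i => by
      split_ifs
      · exact (hh.differentiable (by simp) t).hasFDerivAt
      · exact hasFDerivAt_const _ _)
    (by simp only [hsum]; exact hc.continuousOn.integrableOn_compact isCompact_Icc)
  simp only [hsum] at this
  rw [this]
  refine Finset.sum_eq_zero fun i _ => ?_
  split_ifs with hi
  · subst hi
    rw [sub_eq_zero]
    refine integral_congr_ae (.of_forall fun x => ?_)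
    change h (i.insertNth 1 x) = h (i.insertNth 0 x)
    rw [← hp (Pi.single i 1) (i.insertNth 0 x)]
    congr 1
    ext l
    rcases Fin.eq_self_or_eq_succAbove i l with rfl | ⟨l, rfl⟩ <;> simp
  · simp

end FourierCoeff

end Cinf
end

/-! ### Absolute convergence, decay of Fourier coefficients, and Fourier series. -/

noncomputable section

set_option linter.unusedSectionVars false

open Filter Topology Set MeasureTheory

/-- In a space whose topology is given by seminorms, an absolutely convergent series satisfies the
Cauchy criterion. -/
theorem WithSeminorms.cauchySeq_finset_sum {V κ ι : Type*} [AddCommGroup V] [Module ℂ V]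
    [UniformSpace V] [IsUniformAddGroup V] {p : SeminormFamily ℂ V κ} (hp : WithSeminorms p)
    {a : ι → V} (ha : ∀ i, Summable fun k => p i (a k)) :
    CauchySeq fun s : Finset ι => ∑ k ∈ s, a k := by
  rw [cauchySeq_finset_iff_sum_vanishing]
  intro U hU
  obtain ⟨⟨I, r⟩, hr, hI⟩ := hp.hasBasis_zero_ball.mem_iff.1 hU
  have hsum : Summable fun k => ∑ i ∈ I, p i (a k) := summable_sum fun i _ => ha i
  obtain ⟨s, hs⟩ := summable_iff_vanishing_norm.1 hsum r hr
  refine ⟨s, fun t ht => hI ?_⟩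
  rw [Seminorm.mem_ball_zero]
  have h1 : I.sup p (∑ k ∈ t, a k) ≤ ∑ k ∈ t, I.sup p (a k) :=
    
    Finset.le_sum_of_subadditive _ (map_zero (I.sup p)).le (map_add_le_add (I.sup p)) t a
  refine (h1.trans (Finset.sum_le_sum fun k _ => ?_)).trans_lt ((le_abs_self _).trans_lt (hs t ht))
  exact Seminorm.le_def.1 (Seminorm.finset_sup_le_sum p I) (a k) |>.trans_eq (by simp)

theorem WithSeminorms.summable {V κ ι : Type*} [AddCommGroup V] [Module ℂ V]
    [UniformSpace V] [IsUniformAddGroup V] [CompleteSpace V] {p : SeminormFamily ℂ V κ}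
    (hp : WithSeminorms p) {a : ι → V} (ha : ∀ i, Summable fun k => p i (a k)) : Summable a :=
  summable_iff_cauchySeq_finset.2 (hp.cauchySeq_finset_sum ha)

/-- The weight `∏ (1 + k_j²)` on `ℤ^d`. -/
def intWeight {d : ℕ} (k : Fin d → ℤ) : ℝ := ∏ j, (1 + (k j : ℝ) ^ 2)

theorem intWeight_pos {d : ℕ} (k : Fin d → ℤ) : 0 < intWeight k :=
  Finset.prod_pos fun _ _ => by positivity

theorem one_le_intWeight {d : ℕ} (k : Fin d → ℤ) : 1 ≤ intWeight k :=
  Finset.prod_induction _ (fun x => (1 : ℝ) ≤ x) (fun _ _ => one_le_mul_of_one_le_of_one_le) le_rfl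
    fun _ _ => le_add_of_nonneg_right (sq_nonneg _)

/-- The weight is a product over coordinates, so the sum splits off one factor `∑ 1 / (1 + m²)` at a
time. -/
theorem summable_intWeight_inv (d : ℕ) : Summable fun k : Fin d → ℤ => (intWeight k)⁻¹ := by
  have h1 : Summable fun m : ℤ => (1 + (m : ℝ) ^ 2)⁻¹ := by
    have h : Summable fun m : ℤ => ((m : ℝ) ^ 2)⁻¹ := by
      simpa using Real.summable_one_div_int_pow.2 one_lt_two
    refine h.of_norm_bounded_eventually ?_
    filter_upwards [(finite_singleton (0 : ℤ)).compl_mem_cofinite] with m hm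
    have hm' : (m : ℝ) ≠ 0 := by exact_mod_cast hm
    rw [norm_inv, Real.norm_of_nonneg (by positivity)]
    gcongr
    linarith
  induction d with
  | zero => exact (hasSum_fintype _).summable
  | succ d ih =>
    rw [← (Fin.consEquiv fun _ => ℤ).summable_iff]
    refine (h1.mul_of_nonneg ih (fun _ => by positivity)
      fun k => (inv_pos.2 (intWeight_pos k)).le).congr fun x => ?_
    simp [intWeight, Fin.prod_univ_succ, Fin.consEquiv, mul_comm]

namespace Cinf

open TorusAction

section FourierSeries

variable {d : ℕ} {E : Type*} [NormedAddCommGroup E] [NormedSpace ℝ E] [FiniteDimensional ℝ E]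
  {Y : Type*} [TopologicalSpace Y] [ChartedSpace E Y] [IsManifold 𝓘(ℝ, E) ∞ Y]
  [SigmaCompactSpace Y]

theorem char_neg_left (r : Fin d → ℤ) (s : Fin d → ℝ) : char (-r) s = (char r s)⁻¹ := by
  refine eq_inv_of_mul_eq_one_left ?_
  rw [← char_add_left, neg_add_cancel, char_zero_left]

theorem fderiv_char (r : Fin d → ℤ) (t : Fin d → ℝ) (j : Fin d) :
    fderiv ℝ (char r) t (Pi.single j 1) = 2 * Real.pi * Complex.I * r j * char r t := by
  have h1 : HasFDerivAt (fun s : Fin d → ℝ => ∑ i, (r i : ℝ) * s i)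
      (∑ i, (r i : ℝ) • ContinuousLinearMap.proj (R := ℝ) (φ := fun _ : Fin d => ℝ) i) t :=
    HasFDerivAt.fun_sum fun i _ => (hasFDerivAt_apply i t).const_mul _
  have h2 := ((Complex.ofRealCLM.hasFDerivAt.comp t h1).const_mul
    (2 * Real.pi * Complex.I)).cexp
  have h3 : HasFDerivAt (char r) _ t := h2
  rw [h3.fderiv]
  simp [char, Pi.single_apply]
  ring

/-- The witness is `(2πi)⁻¹ ∂_j F`. Integration by parts, with no boundary term because of
periodicity, turns the derivative into multiplication by `k j`. -/
theorem exists_coeff_eq_mul (j : Fin d) (F : Cinf ((Fin d → ℝ) × E) ((Fin d → ℝ) × Y))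
    (hF : IsPeriodic F) : ∃ F' : Cinf ((Fin d → ℝ) × E) ((Fin d → ℝ) × Y), IsPeriodic F' ∧
      ∀ k, coeff k F' = (k j : ℂ) • coeff k F := by
  have hsm : ContMDiff 𝓘(ℝ, (Fin d → ℝ) × E) 𝓘(ℝ, ℂ) ∞ fun z : (Fin d → ℝ) × Y =>
      (2 * Real.pi * Complex.I)⁻¹ * fderiv ℝ (fun t => F (t, z.2)) z.1 (Pi.single j 1) := by
    refine contMDiff_const.cmul (contMDiff_of_contDiffOn_chart ?_)
    rintro ⟨t₀, y⟩
    have hopen : IsOpen ((univ : Set (Fin d → ℝ)) ×ˢ (chartAt E y).target) :=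
      isOpen_univ.prod (chartAt E y).open_target
    have h1 := ((contDiffOn_prodChart F y).fderiv_of_isOpen (m := ∞) hopen (by simp)).clm_apply
      (contDiffOn_const (c := ((Pi.single j 1 : Fin d → ℝ), (0 : E))))
    refine h1.congr fun z hz => ?_
    have h2 : HasFDerivAt (fun w : (Fin d → ℝ) × E => F (w.1, (chartAt E y).symm w.2)) _ z :=
      (((contDiffOn_prodChart F y).contDiffAt (hopen.mem_nhds hz)).differentiableAt
        (by simp)).hasFDerivAt
    have h3 : HasFDerivAt (fun t : Fin d → ℝ => (t, z.2)) (.inl ℝ _ E) z.1 :=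
      hasFDerivAt_prodMk_left z.1 z.2
    have h4 : HasFDerivAt (fun t => F (t, (chartAt E y).symm z.2)) _ z.1 :=
      HasFDerivAt.comp (g := fun w : (Fin d → ℝ) × E => F (w.1, (chartAt E y).symm w.2)) z.1 h2 h3
    change fderiv ℝ (fun t => F (t, (chartAt E y).symm z.2)) z.1 _ = _
    rw [h4.fderiv]
    simp
  refine ⟨mk _ hsm, ?_, ?_⟩
  · intro k t y
    have h : (fun s => F (s + (fun i => (k i : ℝ)), y)) = fun s => F (s, y) :=
      funext fun s => hF k s y
    rw [mk_apply, mk_apply]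
    simp only
    rw [← fderiv_comp_add_right (f := fun s => F (s, y)), h]
  · intro k
    ext y
    set h : (Fin d → ℝ) → ℂ := fun t => F (t, y) with hh
    have hd : ContDiff ℝ ∞ h := contDiff_left F y
    have h0 := integral_fderiv_eq_zero (h := fun t => char (-k) t * h t)
      ((contDiff_char (-k)).mul hd) (fun m t => by
        rw [char_add_right, char_int, mul_one]
        exact congrArg _ (hF m t y)) j
    have h1 : ∀ t, fderiv ℝ (fun t => char (-k) t * h t) t (Pi.single j 1) =
        char (-k) t * fderiv ℝ h t (Pi.single j 1) -
          2 * Real.pi * Complex.I * k j * (char (-k) t * h t) := fun t => by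
      rw [fderiv_fun_mul ((contDiff_char (-k)).differentiable (by simp) t)
        (hd.differentiable (by simp) t)]
      simp only [_root_.add_apply, _root_.smul_apply, smul_eq_mul, fderiv_char]
      simp only [Pi.neg_apply, Int.cast_neg]
      ring
    simp only [h1] at h0
    have hc1 : Continuous fun t => char (-k) t * fderiv ℝ h t (Pi.single j 1) :=
      (contDiff_char (-k)).continuous.mul
        ((hd.continuous_fderiv (by simp)).clm_apply continuous_const)
    have hc2 : Continuous fun t => 2 * Real.pi * Complex.I * k j * (char (-k) t * h t) :=
      continuous_const.mul ((contDiff_char (-k)).continuous.mul hd.continuous)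
    rw [integral_sub (hc1.continuousOn.integrableOn_compact isCompact_Icc)
      (hc2.continuousOn.integrableOn_compact isCompact_Icc), sub_eq_zero,
      integral_const_mul] at h0
    rw [coeff_apply, smul_apply, coeff_apply]
    have h2 : ∀ t, char (-k) t * mk _ hsm (t, y) = (2 * Real.pi * Complex.I)⁻¹ *
        (char (-k) t * fderiv ℝ h t (Pi.single j 1)) := fun t => by
      rw [mk_apply]; simp only [hh]; ring
    simp only [h2]
    rw [integral_const_mul, h0]
    have : (2 * Real.pi * Complex.I : ℂ) ≠ 0 := Complex.two_pi_I_ne_zero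
    simp only [hh]
    field_simp

/-- Applying constant coefficient differential operators multiplies coefficients by a power of the
weight. Uniform boundedness of coefficients thus improves to rapid decay. -/
theorem exists_coeff_eq_weight_pow (N : ℕ) (F : Cinf ((Fin d → ℝ) × E) ((Fin d → ℝ) × Y))
    (hF : IsPeriodic F) : ∃ F' : Cinf ((Fin d → ℝ) × E) ((Fin d → ℝ) × Y),
      ∀ k, coeff k F' = ((intWeight k ^ N : ℝ) : ℂ) • coeff k F := by
  have hstep : ∀ (J : Finset (Fin d)) (F : Cinf ((Fin d → ℝ) × E) ((Fin d → ℝ) × Y)),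
      IsPeriodic F → ∃ F' : Cinf ((Fin d → ℝ) × E) ((Fin d → ℝ) × Y), IsPeriodic F' ∧
      ∀ k, coeff k F' = ((∏ j ∈ J, (1 + (k j : ℝ) ^ 2) : ℝ) : ℂ) • coeff k F := by
    intro J
    induction J using Finset.induction_on with
    | empty => exact fun F hF => ⟨F, hF, fun k => by simp⟩
    | insert j J hj ih =>
      intro F hF
      obtain ⟨F₁, hF₁, h₁⟩ := ih F hF
      obtain ⟨F₂, hF₂, h₂⟩ := exists_coeff_eq_mul j F₁ hF₁
      obtain ⟨F₃, hF₃, h₃⟩ := exists_coeff_eq_mul j F₂ hF₂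
      -- Two derivations in direction `j` give the factor `k_j²`, so the sum carries the factor `1 +
      -- k_j²`.
      refine ⟨F₁ + F₃, fun k t y => ?_, fun k => ?_⟩
      · rw [add_apply, add_apply, hF₁, hF₃]
      · rw [map_add, h₃, h₂, h₁, Finset.prod_insert hj, smul_smul, smul_smul, ← add_smul]
        congr 1
        push_cast
        ring
  have h : ∃ F' : Cinf ((Fin d → ℝ) × E) ((Fin d → ℝ) × Y), IsPeriodic F' ∧
      ∀ k, coeff k F' = ((intWeight k ^ N : ℝ) : ℂ) • coeff k F := by
    induction N with
    | zero => exact ⟨F, hF, fun k => by simp⟩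
    | succ N ih =>
      obtain ⟨F₁, hF₁, h₁⟩ := ih
      obtain ⟨F₂, hF₂, h₂⟩ := hstep Finset.univ F₁ hF₁
      refine ⟨F₂, hF₂, fun k => ?_⟩
      rw [h₂, h₁, smul_smul, pow_succ, intWeight, mul_comm (_ ^ N)]
      push_cast
      rfl
  obtain ⟨F', -, h⟩ := h
  exact ⟨F', h⟩

/-- The Fourier coefficients of a smooth periodic function are rapidly decreasing. -/
theorem exists_weight_mul_seminorm_coeff_le {q : Seminorm ℂ (Cinf E Y)} (hq : Continuous q)
    (N : ℕ) (F : Cinf ((Fin d → ℝ) × E) ((Fin d → ℝ) × Y)) (hF : IsPeriodic F) :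
    ∃ C, ∀ k, intWeight k ^ N * q (coeff k F) ≤ C := by
  obtain ⟨F', hF'⟩ := exists_coeff_eq_weight_pow N F hF
  obtain ⟨C, hC⟩ := exists_seminorm_coeff_le hq F'
  refine ⟨C, fun k => ?_⟩
  have := hC k
  rwa [hF', map_smul_eq_mul, Complex.norm_real, Real.norm_of_nonneg
    (pow_nonneg (intWeight_pos k).le N)] at this

theorem summable_seminorm_coeff {q : Seminorm ℂ (Cinf E Y)} (hq : Continuous q)
    (F : Cinf ((Fin d → ℝ) × E) ((Fin d → ℝ) × Y)) (hF : IsPeriodic F) :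
    Summable fun k => q (coeff k F) := by
  obtain ⟨C, hC⟩ := exists_weight_mul_seminorm_coeff_le hq 1 F hF
  refine ((summable_intWeight_inv d).mul_left C).of_nonneg_of_le (fun _ => apply_nonneg _ _)
    fun k => ?_
  rw [← div_eq_mul_inv, le_div_iff₀ (intWeight_pos k), mul_comm]
  simpa using hC k

theorem mFourier_coe (k : Fin d → ℤ) (t : Fin d → ℝ) :
    UnitAddTorus.mFourier k (fun i => (t i : UnitAddCircle)) = char k t := by
  simp only [UnitAddTorus.mFourier, ContinuousMap.coe_mk, fourier_coe_apply, char,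
    ← Complex.exp_sum]
  congr 1
  push_cast
  rw [Finset.mul_sum]
  refine Finset.sum_congr rfl fun i _ => ?_
  simp
  ring

/-- A periodic continuous function descends to `UnitAddTorus`, where summability of the Fourier
coefficients implies pointwise convergence. The half-open cube used there differs from the closed
one by a null set. -/
theorem hasSum_fourier_of_periodic {h : (Fin d → ℝ) → ℂ} (hc : Continuous h)
    (hp : ∀ (k : Fin d → ℤ) t, h (t + (fun i => (k i : ℝ))) = h t)
    (hs : Summable fun k : Fin d → ℤ => ∫ t in Icc (0 : Fin d → ℝ) 1, char (-k) t * h t)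
    (t : Fin d → ℝ) :
    HasSum (fun k => char k t * ∫ s in Icc (0 : Fin d → ℝ) 1, char (-k) s * h s) (h t) := by
  let q : (Fin d → ℝ) → UnitAddTorus (Fin d) := fun t i => (t i : UnitAddCircle)
  have hq : IsOpenQuotientMap q :=
    IsOpenQuotientMap.piMap fun _ => QuotientAddGroup.isOpenQuotientMap_mk
  have hfac : ∀ a b, q a = q b → h a = h b := by
    intro a b hab
    have : ∀ i, ∃ m : ℤ, (m : ℝ) = b i - a i := fun i => by
      have h1 := congrFun hab i
      rw [QuotientAddGroup.eq, AddSubgroup.mem_zmultiples_iff] at h1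
      obtain ⟨m, hm⟩ := h1
      exact ⟨m, by rw [zsmul_one] at hm; rw [hm, neg_add_eq_sub]⟩
    choose m hm using this
    rw [← hp m a]
    congr 1
    ext i
    simp [hm]
  let f : C(UnitAddTorus (Fin d), ℂ) :=
    ⟨fun x => h (Function.surjInv hq.surjective x), by
      rw [hq.isQuotientMap.continuous_iff]
      refine hc.congr fun t => ?_
      exact hfac _ _ (Function.surjInv_eq hq.surjective (q t)).symm⟩
  have hf : ∀ t, f (q t) = h t := fun t => hfac _ _ (Function.surjInv_eq hq.surjective (q t))
  have hcoef : ∀ k, UnitAddTorus.mFourierCoeff f k =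
      ∫ t in Icc (0 : Fin d → ℝ) 1, char (-k) t * h t := fun k => by
    rw [UnitAddTorus.mFourierCoeff_eq_integral f k 0]
    have hset : {x : Fin d → ℝ | ∀ i, x i ∈ Ioc ((0 : Fin d → ℝ) i) ((0 : Fin d → ℝ) i + 1)} =
        univ.pi fun i => Ioc ((0 : Fin d → ℝ) i) ((1 : Fin d → ℝ) i) := by
      ext x; simp
    have hae : (univ.pi fun i => Ioc ((0 : Fin d → ℝ) i) ((1 : Fin d → ℝ) i)) =ᵐ[volume]
      Icc 0 1 := Measure.univ_pi_Ioc_ae_eq_Icc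
    rw [hset, setIntegral_congr_set hae]
    refine integral_congr_ae (.of_forall fun t => ?_)
    simp only [mFourier_coe, smul_eq_mul]
    exact congrArg _ (hf t)
  have := UnitAddTorus.hasSum_mFourier_series_apply_of_summable (f := f)
    (by rw [funext hcoef]; exact hs) (q t)
  rw [hf] at this
  refine this.congr_fun fun k => ?_
  rw [hcoef, mFourier_coe, smul_eq_mul, mul_comm]

/-- The Fourier series of a smooth periodic function converges pointwise. -/
theorem hasSum_coeff_apply (F : Cinf ((Fin d → ℝ) × E) ((Fin d → ℝ) × Y)) (hF : IsPeriodic F)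
    (t : Fin d → ℝ) (y : Y) : HasSum (fun k => char k t * coeff k F y) (F (t, y)) := by
  refine hasSum_fourier_of_periodic (continuous_left F y) (fun k t => hF k t y) ?_ t
  exact (withSeminorms.summable fun i =>
    summable_seminorm_coeff (withSeminorms.continuous_seminorm i) F hF).map (eval E y)
    (eval E y).continuous

end FourierSeries

end Cinf
end

noncomputable section

set_option linter.unusedSectionVars false

open Filter Topology Set

/-! ### Seminorms on completions and on tensor products -/

section Completion

open UniformSpace

variable {V : Type*} [AddCommGroup V] [Module ℂ V] [UniformSpace V] [IsUniformAddGroup V]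
  [UniformContinuousConstSMul ℂ V]

theorem Seminorm.uniformContinuous_of_continuous {p : Seminorm ℂ V} (hp : Continuous p) :
    UniformContinuous p := by
  refine Seminorm.uniformContinuous (r := 1) ?_
  have h : {v | p v < 1} ∈ 𝓝 (0 : V) :=
    (isOpen_lt hp continuous_const).mem_nhds (by simp)
  exact mem_of_superset h fun v hv => by simpa [Seminorm.mem_ball_zero] using hv

/-- The extension of a continuous seminorm to the completion. -/
def Seminorm.toCompletion (p : Seminorm ℂ V) (hp : Continuous p) :
    Seminorm ℂ (Completion V) :=
  have hu : UniformContinuous p := Seminorm.uniformContinuous_of_continuous hp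
  have hc : Continuous (Completion.extension p) := Completion.continuous_extension
  Seminorm.of (Completion.extension p)
    (fun x y => Completion.induction_on₂ x y
      (isClosed_le (hc.comp (continuous_fst.add continuous_snd))
        ((hc.comp continuous_fst).add (hc.comp continuous_snd)))
      fun a b => by
        rw [← Completion.coe_add, Completion.extension_coe hu, Completion.extension_coe hu,
          Completion.extension_coe hu]
        exact map_add_le_add p a b)
    (fun c x => Completion.induction_on x
      (isClosed_eq (hc.comp (continuous_const_smul c)) (continuous_const.mul hc))
      fun a => by
        rw [← Completion.coe_smul, Completion.extension_coe hu, Completion.extension_coe hu]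
        exact map_smul_eq_mul p c a)

theorem Seminorm.toCompletion_coe (p : Seminorm ℂ V) (hp : Continuous p) (v : V) :
    p.toCompletion hp (v : Completion V) = p v :=
  Completion.extension_coe (Seminorm.uniformContinuous_of_continuous hp) v

theorem Seminorm.continuous_toCompletion (p : Seminorm ℂ V) (hp : Continuous p) :
    Continuous (p.toCompletion hp) :=
  Completion.continuous_extension (f := p)

/-- Closures of the images of balls form a neighbourhood basis of `0` in the completion. A finite
intersection of open balls of the extended seminorms lies in such a closure, because its
intersection with the dense image is dense in it. -/
theorem WithSeminorms.toCompletion {κ : Type*} {p : SeminormFamily ℂ V κ} (hp : WithSeminorms p) :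
    WithSeminorms fun i => (p i).toCompletion (hp.continuous_seminorm i) := by
  set q : SeminormFamily ℂ (Completion V) κ :=
    fun i => (p i).toCompletion (hp.continuous_seminorm i) with hq
  have hqc : ∀ i, Continuous (q i) := fun i => Seminorm.continuous_toCompletion _ _
  rw [SeminormFamily.withSeminorms_iff_nhds_eq_iInf]
  refine le_antisymm (le_iInf fun i => ?_) ?_
  · rw [← tendsto_iff_comap]
    simpa using (hqc i).tendsto 0
  · have hb := hp.hasBasis_zero_ball.hasBasis_of_isDenseInducing
      (Completion.isDenseInducing_coe (α := V))
    rw [Completion.coe_zero] at hb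
    refine hb.ge_iff.2 ?_
    rintro ⟨s, r⟩ hr
    have h1 : ∀ i ∈ s, {x : Completion V | q i x < r} ∈ ⨅ i, comap (q i) (𝓝 0) := fun i _ =>
      mem_iInf_of_mem i ⟨Iio r, Iio_mem_nhds hr, fun x hx => hx⟩
    refine mem_of_superset ((biInter_finset_mem s).2 h1) fun x hx => ?_
    have hopen : IsOpen (⋂ i ∈ s, {x : Completion V | q i x < r}) :=
      isOpen_biInter_finset fun i _ => isOpen_lt (hqc i) continuous_const
    have h2 : x ∈ closure ((⋂ i ∈ s, {x : Completion V | q i x < r}) ∩ range ((↑) : V → _)) :=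
      (Completion.denseRange_coe (α := V)).open_subset_closure_inter hopen hx
    refine closure_mono ?_ h2
    rintro _ ⟨hv, v, rfl⟩
    refine ⟨v, ?_, rfl⟩
    rw [Seminorm.mem_ball_zero]
    refine Seminorm.finset_sup_apply_lt hr fun i hi => ?_
    have := mem_iInter₂.1 hv i hi
    rw [mem_ofPred_eq, hq] at this
    rwa [Seminorm.toCompletion_coe] at this

end Completion

/-! ### Seminorms and universal property of the completed tensor product. -/

section Tensor

variable {A B C : Type*} [AddCommGroup A] [Module ℂ A] [TopologicalSpace A]
  [AddCommGroup B] [Module ℂ B] [TopologicalSpace B]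
  [AddCommGroup C] [Module ℂ C] [TopologicalSpace C]

open scoped ComplexOrder in
-- For the usual partial order on `𝕜`, convexity over `𝕜` is the same as convexity over `ℝ`, so real
-- local convexity supplies enough `𝕜`-seminorms.
theorem LocallyConvexSpace.toPolynormableSpace_of_real (𝕜 V : Type*) [RCLike 𝕜] [AddCommGroup V]
    [Module 𝕜 V] [Module ℝ V] [IsScalarTower ℝ 𝕜 V] [TopologicalSpace V] [IsTopologicalAddGroup V]
    [ContinuousSMul 𝕜 V] [LocallyConvexSpace ℝ V] : PolynormableSpace 𝕜 V := by
  have : LocallyConvexSpace 𝕜 V :=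
    LocallyConvexSpace.ofBasisZero 𝕜 V id (fun s => s ∈ 𝓝 (0 : V) ∧ Convex ℝ s)
      ((locallyConvexSpace_iff_zero ℝ V).1 inferInstance) fun s hs =>
        convex_RCLike_iff_convex_real.2 hs.2
  have : ContinuousSMul ℝ V := IsScalarTower.continuousSMul 𝕜
  infer_instance

instance : PolynormableSpace ℂ (PTensor A B) :=
  LocallyConvexSpace.toPolynormableSpace_of_real ℂ _

namespace CTensor

theorem withSeminorms : WithSeminorms fun p : {p : Seminorm ℂ (PTensor A B) // Continuous p} =>
    p.1.toCompletion p.2 :=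
  (PolynormableSpace.withSeminorms ℂ (PTensor A B)).toCompletion

instance : ContinuousSMul ℂ (CTensor A B) := withSeminorms.continuousSMul
instance : PolynormableSpace ℂ (CTensor A B) := withSeminorms.toPolynormableSpace
instance : LocallyConvexSpace ℝ (CTensor A B) := withSeminorms.toLocallyConvexSpace

theorem continuous_tmul : Continuous fun x : A × B => tmul x.1 x.2 :=
  (UniformSpace.Completion.continuous_coe _).comp (PTensor.continuous_tmul A B)

theorem tmul_add (a : A) (b b' : B) : tmul a (b + b') = tmul a b + tmul a b' := by
  rw [tmul, tmul, tmul, ← UniformSpace.Completion.coe_add]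
  exact congrArg _ (TensorProduct.tmul_add a b b')

theorem add_tmul (a a' : A) (b : B) : tmul (a + a') b = tmul a b + tmul a' b := by
  rw [tmul, tmul, tmul, ← UniformSpace.Completion.coe_add]
  exact congrArg _ (TensorProduct.add_tmul a a' b)

theorem tmul_smul (c : ℂ) (a : A) (b : B) : tmul a (c • b) = c • tmul a b := by
  rw [tmul, tmul, ← UniformSpace.Completion.coe_smul]
  exact congrArg _ (TensorProduct.tmul_smul c a b)

theorem smul_tmul (c : ℂ) (a : A) (b : B) : tmul (c • a) b = c • tmul a b := by
  rw [tmul, tmul, ← UniformSpace.Completion.coe_smul]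
  exact congrArg _ (TensorProduct.smul_tmul' c a b).symm

/-- The canonical bilinear map into the completed tensor product. -/
def tmulBilin : A →ₗ[ℂ] B →ₗ[ℂ] CTensor A B :=
  LinearMap.mk₂ ℂ tmul add_tmul smul_tmul tmul_add tmul_smul

/-- `b ↦ a ⊗ b`. -/
def tmulL (a : A) : B →L[ℂ] CTensor A B :=
  ⟨tmulBilin a, continuous_tmul.comp (continuous_const.prodMk continuous_id)⟩

/-- `a ↦ a ⊗ b`. -/
def tmulR (b : B) : A →L[ℂ] CTensor A B :=
  ⟨tmulBilin.flip b, continuous_tmul.comp (continuous_id.prodMk continuous_const)⟩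

@[simp] theorem tmulL_apply (a : A) (b : B) : tmulL a b = tmul a b := rfl
@[simp] theorem tmulR_apply (a : A) (b : B) : tmulR b a = tmul a b := rfl

/-- A closed subspace containing the elementary tensors is everything. -/
theorem mem_of_tmul_mem {S : Submodule ℂ (CTensor A B)} (hS : IsClosed (S : Set (CTensor A B)))
    (h : ∀ a b, tmul a b ∈ S) (x : CTensor A B) : x ∈ S := by
  induction x using UniformSpace.Completion.induction_on with
  | hp => exact hS
  | ih x =>
    refine TensorProduct.induction_on (motive := fun y : A ⊗[ℂ] B =>
      (UniformSpace.Completion.coe' (α := PTensor A B) y) ∈ S) x ?_ h ?_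
    · exact S.zero_mem
    · intro y z hy hz
      exact (congrArg (· ∈ S) (UniformSpace.Completion.coe_add (α := PTensor A B) y z)).mpr
        (S.add_mem hy hz)

/-- Continuous linear maps on `A ⊗̂ B` agreeing on elementary tensors are equal. -/
theorem ext_tmul {V : Type*} [AddCommGroup V] [Module ℂ V] [TopologicalSpace V] [T2Space V]
    {f g : CTensor A B →L[ℂ] V} (h : ∀ a b, f (tmul a b) = g (tmul a b)) : f = g := by
  ext x
  exact mem_of_tmul_mem (S := LinearMap.eqLocus (f : CTensor A B →ₗ[ℂ] V) g)
    (isClosed_eq f.continuous g.continuous) h x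

/-- The continuous linear map on `A ⊗̂ B` induced by a continuous bilinear map. -/
def lift {V : Type*} [AddCommGroup V] [Module ℂ V] [UniformSpace V] [IsUniformAddGroup V]
    [ContinuousSMul ℂ V] [UniformContinuousConstSMul ℂ V] [LocallyConvexSpace ℝ V]
    [CompleteSpace V] [T2Space V]
    (f : A →ₗ[ℂ] B →ₗ[ℂ] V) (hf : Continuous fun x : A × B => f x.1 x.2) :
    CTensor A B →L[ℂ] V :=
  ContinuousLinearMap.fromCompletion (α := PTensor A B)
    ⟨TensorProduct.lift f, PTensor.continuous_of_tmul _ hf⟩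

theorem lift_tmul {V : Type*} [AddCommGroup V] [Module ℂ V] [UniformSpace V] [IsUniformAddGroup V]
    [ContinuousSMul ℂ V] [UniformContinuousConstSMul ℂ V] [LocallyConvexSpace ℝ V]
    [CompleteSpace V] [T2Space V]
    (f : A →ₗ[ℂ] B →ₗ[ℂ] V) (hf : Continuous fun x : A × B => f x.1 x.2) (a : A) (b : B) :
    lift f hf (tmul a b) = f a b :=
  (ContinuousLinearMap.fromCompletion_apply_coe _ _).trans (TensorProduct.lift.tmul a b)

theorem map_comp {A' B' A'' B'' : Type*}
    [AddCommGroup A'] [Module ℂ A'] [TopologicalSpace A']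
    [AddCommGroup B'] [Module ℂ B'] [TopologicalSpace B']
    [AddCommGroup A''] [Module ℂ A''] [TopologicalSpace A'']
    [AddCommGroup B''] [Module ℂ B''] [TopologicalSpace B'']
    (φ' : A' →L[ℂ] A'') (φ : A →L[ℂ] A') (ψ' : B' →L[ℂ] B'') (ψ : B →L[ℂ] B') (x : CTensor A B) :
    map φ' ψ' (map φ ψ x) = map (φ'.comp φ) (ψ'.comp ψ) x := by
  have : (map φ' ψ').comp (map φ ψ) = map (φ'.comp φ) (ψ'.comp ψ) :=
    ext_tmul fun a b => by simp [map_tmul]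
  exact DFunLike.congr_fun this x

end CTensor

theorem PolynormableSpace.exists_continuous_seminorm_ball_subset [IsTopologicalAddGroup A]
    [PolynormableSpace ℂ A] {U : Set A} (hU : U ∈ 𝓝 0) :
    ∃ (P : Seminorm ℂ A) (r : ℝ), Continuous P ∧ 0 < r ∧ ∀ a, P a < r → a ∈ U := by
  obtain ⟨⟨s, r⟩, hr, hs⟩ :=
    (PolynormableSpace.withSeminorms ℂ A).hasBasis_zero_ball.mem_iff.1 hU
  refine ⟨_, r, ?_, hr, fun a ha => hs ((Seminorm.mem_ball_zero _).2 ha)⟩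
  refine Finset.sup_induction (p := fun q : Seminorm ℂ A => Continuous q) continuous_zero ?_
    fun q _ => q.2
  exact fun p hp q hq => hp.sup hq

/-- A continuous seminorm on a tensor product is bounded by products of seminorms. -/
theorem PTensor.exists_seminorm_tmul_le [IsTopologicalAddGroup A] [IsTopologicalAddGroup B]
    [PolynormableSpace ℂ A] [PolynormableSpace ℂ B]
    (p : Seminorm ℂ (PTensor A B)) (hp : Continuous p) :
    ∃ (P : Seminorm ℂ A) (Q : Seminorm ℂ B) (c : ℝ), Continuous P ∧ Continuous Q ∧
      ∀ a b (α β : ℝ), P a < α → Q b < β → p (PTensor.tmul a b) ≤ c * (α * β) := by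
  have h0 : {x : A × B | p (PTensor.tmul x.1 x.2) < 1} ∈ 𝓝 (0 : A) ×ˢ 𝓝 (0 : B) := by
    rw [← nhds_prod_eq]
    refine (isOpen_lt (hp.comp (PTensor.continuous_tmul A B)) continuous_const).mem_nhds ?_
    have : PTensor.tmul (0 : A) (0 : B) = 0 := TensorProduct.zero_tmul A (0 : B)
    simp [this]
  obtain ⟨U, hU, W, hW, hUW⟩ := mem_prod_iff.1 h0
  obtain ⟨P, r, hP, hr, hPU⟩ := PolynormableSpace.exists_continuous_seminorm_ball_subset hU
  obtain ⟨Q, r', hQ, hr', hQW⟩ := PolynormableSpace.exists_continuous_seminorm_ball_subset hW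
  refine ⟨P, Q, (r * r')⁻¹, hP, hQ, fun a b α β ha hb => ?_⟩
  have hα : 0 < α := (apply_nonneg P a).trans_lt ha
  have hβ : 0 < β := (apply_nonneg Q b).trans_lt hb
  -- Rescaling by `α > P a`, rather than by `P a` itself, avoids dividing by zero when `P a = 0`.
  have h1 : ((r / α : ℝ) : ℂ) • a ∈ U := hPU _ (by
    rw [map_smul_eq_mul, Complex.norm_real, Real.norm_of_nonneg (by positivity), div_mul_comm]
    exact mul_lt_of_lt_one_left hr ((div_lt_one hα).2 ha))
  have h2 : ((r' / β : ℝ) : ℂ) • b ∈ W := hQW _ (by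
    rw [map_smul_eq_mul, Complex.norm_real, Real.norm_of_nonneg (by positivity), div_mul_comm]
    exact mul_lt_of_lt_one_left hr' ((div_lt_one hβ).2 hb))
  have h3 : p (PTensor.tmul (((r / α : ℝ) : ℂ) • a) (((r' / β : ℝ) : ℂ) • b)) < 1 :=
    hUW (mk_mem_prod h1 h2)
  have h4 : PTensor.tmul (((r / α : ℝ) : ℂ) • a) (((r' / β : ℝ) : ℂ) • b) =
      ((r / α * (r' / β) : ℝ) : ℂ) • PTensor.tmul a b := by
    push_cast
    exact TensorProduct.smul_tmul_smul _ _ a b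
  rw [h4, map_smul_eq_mul, Complex.norm_real, Real.norm_of_nonneg (by positivity)] at h3
  rw [inv_mul_eq_div, le_div_iff₀ (by positivity)]
  have h5 : r / α * (r' / β) * p (PTensor.tmul a b) * (α * β) < α * β :=
    mul_lt_of_lt_one_left (by positivity) h3
  refine le_of_eq_of_le ?_ h5.le
  field_simp

/-- Let the strict upper bounds `P a + ε` and `Q b + ε` of the previous estimate tend to `P a` and
`Q b`. -/
theorem PTensor.exists_seminorm_tmul_le_mul [IsTopologicalAddGroup A] [IsTopologicalAddGroup B]
    [PolynormableSpace ℂ A] [PolynormableSpace ℂ B]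
    (p : Seminorm ℂ (PTensor A B)) (hp : Continuous p) :
    ∃ (P : Seminorm ℂ A) (Q : Seminorm ℂ B) (c : ℝ), Continuous P ∧ Continuous Q ∧
      ∀ a b, p (PTensor.tmul a b) ≤ c * (P a * Q b) := by
  obtain ⟨P, Q, c, hP, hQ, h⟩ := PTensor.exists_seminorm_tmul_le p hp
  refine ⟨P, Q, c, hP, hQ, fun a b => ?_⟩
  have hc : Continuous fun ε : ℝ => c * ((P a + ε) * (Q b + ε)) := by fun_prop
  have h0 : Tendsto (fun ε : ℝ => c * ((P a + ε) * (Q b + ε))) (𝓝[>] 0) (𝓝 (c * (P a * Q b))) := by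
    simpa using (hc.tendsto 0).mono_left nhdsWithin_le_nhds
  refine ge_of_tendsto h0 ?_
  filter_upwards [self_mem_nhdsWithin] with ε hε
  exact h a b _ _ (lt_add_of_pos_right _ hε) (lt_add_of_pos_right _ hε)

end Tensor
end

noncomputable section

set_option linter.unusedSectionVars false

open Filter Topology Set

/-! ### Partitions of unity, periodic parametrizations, cut-off pull-backs -/

namespace Cinf

open TorusAction

section Localization

variable {E : Type*} [NormedAddCommGroup E] [NormedSpace ℝ E] [FiniteDimensional ℝ E]
  {X : Type*} [TopologicalSpace X] [ChartedSpace E X] [IsManifold 𝓘(ℝ, E) ∞ X]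
  {E' : Type*} [NormedAddCommGroup E'] [NormedSpace ℝ E'] [FiniteDimensional ℝ E']
  {Y : Type*} [TopologicalSpace Y] [ChartedSpace E' Y] [IsManifold 𝓘(ℝ, E') ∞ Y]

/-- A finite quadratic partition of unity subordinate to an open cover of a compact manifold. -/
theorem exists_quadratic_partition [CompactSpace X] [T2Space X] {ι : Type*} (U : ι → Set X)
    (hU : ∀ i, IsOpen (U i)) (hc : ∀ x, ∃ i, x ∈ U i) :
    ∃ (s : Finset ι) (φ : ι → Cinf E X) (w : Cinf E X), (∀ i, tsupport (φ i) ⊆ U i) ∧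
      ∀ x, ∑ i ∈ s, w x * φ i x * φ i x = 1 := by
  classical
  obtain ⟨f, hf⟩ := SmoothPartitionOfUnity.exists_isSubordinate 𝓘(ℝ, E) (isClosed_univ (X := X)) U
    hU fun x _ => mem_iUnion.2 (hc x)
  have hfin := f.locallyFinite.finite_nonempty_of_compact
  have hsum : ∀ x, ∑ i ∈ hfin.toFinset, f i x = 1 := fun x => by
    rw [← f.sum_eq_one (mem_univ x)]
    refine (finsum_eq_sum_of_support_subset _ fun i hi => ?_).symm
    exact (Finite.mem_toFinset hfin).2 ⟨x, hi⟩
  -- If all squares vanished at `x`, so would the `f i x`, whose sum is `1`. The normalizing factor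
  -- `w` is the reciprocal of this sum of squares. The quadratic form leaves two copies of each
  -- cut-off, one for each variable.
  have hpos : ∀ x, (∑ i ∈ hfin.toFinset, f i x ^ 2) ≠ 0 := fun x h0 => by
    rw [Finset.sum_eq_zero_iff_of_nonneg fun i _ => sq_nonneg _] at h0
    have := hsum x
    rw [Finset.sum_eq_zero fun i hi => by simpa using h0 i hi] at this
    exact zero_ne_one this
  have hof : ContMDiff 𝓘(ℝ, ℝ) 𝓘(ℝ, ℂ) ∞ (fun r : ℝ => (r : ℂ)) :=
    Complex.ofRealCLM.contDiff.contMDiff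
  let φ : ι → Cinf E X := fun i => mk (fun x => ((f i x : ℝ) : ℂ)) (hof.comp (f i).contMDiff)
  let g : Cinf E X := ∑ i ∈ hfin.toFinset, pmul (φ i) (φ i)
  have hgx : ∀ x, g x = ∑ i ∈ hfin.toFinset, φ i x * φ i x := fun x => by simp [g]
  have hg : ∀ x, g x ≠ 0 := fun x h0 => hpos x <| by
    have : ((∑ i ∈ hfin.toFinset, f i x ^ 2 : ℝ) : ℂ) = 0 := by
      rw [← h0, hgx]
      push_cast
      exact Finset.sum_congr rfl fun i _ => sq _
    exact_mod_cast this
  let w : Cinf E X := mk (fun x => (g x)⁻¹) fun x =>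
    ((contDiffAt_inv ℝ (hg x)).contMDiffAt).comp x (g.contMDiff x)
  refine ⟨hfin.toFinset, φ, w, fun i => ?_, fun x => ?_⟩
  · refine subset_trans (closure_mono ?_) (hf i)
    intro x hx h0
    exact hx (by simp [φ, h0])
  · simp_rw [mul_assoc]
    rw [← Finset.mul_sum, ← hgx]
    exact inv_mul_cancel₀ (hg x)

/-- The function `x ↦ φ x * f (t x)`, where `t` is smooth near the support of `φ`. -/
def cutoffPullback [SigmaCompactSpace Y] (φ : Cinf E X) (t : X → Y) {U : Set X} (hU : IsOpen U)
    (hφ : tsupport φ ⊆ U) (ht : ContMDiffOn 𝓘(ℝ, E) 𝓘(ℝ, E') ∞ t U) : Cinf E' Y →L[ℂ] Cinf E X :=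
  mkCLM
    { toFun := fun f => mk (fun x => φ x * f (t x)) <| contMDiff_of_tsupport fun x hx =>
        ((φ.contMDiff.contMDiffOn.cmul (f.contMDiff.comp_contMDiffOn ht)).contMDiffAt
          (hU.mem_nhds (hφ (tsupport_mul_subset_left hx))))
      map_add' := fun f g => by ext; simp [mul_add]
      map_smul' := fun c f => by ext; simp [mul_left_comm] }
    fun x => continuous_const.mul (continuous_eval E' (t x))

@[simp] theorem cutoffPullback_apply [SigmaCompactSpace Y] (φ : Cinf E X) (t : X → Y) {U : Set X}
    (hU : IsOpen U) (hφ : tsupport φ ⊆ U) (ht : ContMDiffOn 𝓘(ℝ, E) 𝓘(ℝ, E') ∞ t U)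
    (f : Cinf E' Y) (x : X) : cutoffPullback φ t hU hφ ht f x = φ x * f (t x) := rfl

/-- Every point of a manifold has a neighbourhood on which a smooth map from a torus admits a smooth
section. -/
theorem exists_periodic_parametrization (x₀ : X) :
    ∃ (U : Set X) (τ : (Fin (Module.finrank ℝ E) → ℝ) → X)
      (t : X → (Fin (Module.finrank ℝ E) → ℝ)), IsOpen U ∧ x₀ ∈ U ∧
      ContMDiff 𝓘(ℝ, Fin (Module.finrank ℝ E) → ℝ) 𝓘(ℝ, E) ∞ τ ∧
      (∀ s (k : Fin (Module.finrank ℝ E) → ℤ), τ (s + fun j => (k j : ℝ)) = τ s) ∧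
      ContMDiffOn 𝓘(ℝ, E) 𝓘(ℝ, Fin (Module.finrank ℝ E) → ℝ) ∞ t U ∧ ∀ x ∈ U, τ (t x) = x := by
  set c := chartAt E x₀
  set L : E ≃L[ℝ] (Fin (Module.finrank ℝ E) → ℝ) := (Module.finBasis ℝ E).equivFunL
  have hmap : ContDiff ℝ ∞ fun v => c x₀ + L.symm v := contDiff_const.add L.symm.contDiff
  -- A closed ball is needed because `R * sin` attains `±R`. The section exists only on the open
  -- ball, where `arcsin` is smooth.
  obtain ⟨R, hR, hball⟩ : ∃ R > 0, ∀ v : Fin (Module.finrank ℝ E) → ℝ, ‖v‖ ≤ R →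
      c x₀ + L.symm v ∈ c.target := by
    have h : (fun v => c x₀ + L.symm v) ⁻¹' c.target ∈ 𝓝 (0 : Fin (Module.finrank ℝ E) → ℝ) :=
      hmap.continuous.continuousAt.preimage_mem_nhds
        (c.open_target.mem_nhds (by rw [map_zero, add_zero]; exact mem_chart_target E x₀))
    obtain ⟨R, hR, h⟩ := Metric.nhds_basis_closedBall.mem_iff.1 h
    exact ⟨R, hR, fun v hv => h (by simpa using hv)⟩
  have hsin : ∀ s : Fin (Module.finrank ℝ E) → ℝ, ‖fun j => R * Real.sin (2 * Real.pi * s j)‖ ≤ R :=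
    fun s => (pi_norm_le_iff_of_nonneg hR.le).2 fun j => by
      rw [norm_mul, Real.norm_of_nonneg hR.le]
      exact mul_le_of_le_one_right hR.le (Real.abs_sin_le_one _)
  have hopen : IsOpen {e : E | ‖L (e - c x₀)‖ < R} :=
    isOpen_lt (L.continuous.comp (continuous_id.sub continuous_const)).norm continuous_const
  refine ⟨c.source ∩ c ⁻¹' {e : E | ‖L (e - c x₀)‖ < R},
    fun s => c.symm (c x₀ + L.symm fun j => R * Real.sin (2 * Real.pi * s j)),
    fun x j => Real.arcsin (L (c x - c x₀) j / R) / (2 * Real.pi), c.isOpen_inter_preimage hopen,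
    ⟨mem_chart_source E x₀, by simpa using hR⟩, ?_, fun s k => ?_, ?_, fun x hx => ?_⟩
  · refine (contMDiffOn_chart_symm (I := 𝓘(ℝ, E)) (x := x₀)).comp_contMDiff (t := c.target) ?_
      fun s => hball _ (hsin s)
    refine (hmap.comp ?_).contMDiff
    exact contDiff_pi.2 fun j => contDiff_const.mul
      (Real.contDiff_sin.comp (contDiff_const.mul (contDiff_apply ℝ ℝ j)))
  · have h1 : (fun j => R * Real.sin (2 * Real.pi * (s + fun j => (k j : ℝ)) j)) =
        fun j => R * Real.sin (2 * Real.pi * s j) := by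
      ext j
      rw [← Real.sin_add_int_mul_two_pi (2 * Real.pi * s j) (k j)]
      congr 2
      simp only [Pi.add_apply]
      ring
    simp only [h1]
  · refine contMDiffOn_pi_space.2 fun j x hx => ?_
    have hlt : |L (c x - c x₀) j / R| < 1 := by
      rw [abs_div, abs_of_pos hR, div_lt_one hR]
      exact (norm_le_pi_norm (L (c x - c x₀)) j).trans_lt hx.2
    have h1 : ContDiffAt ℝ ∞ (fun e : E => Real.arcsin (L (e - c x₀) j / R) / (2 * Real.pi))
        (c x) := by
      refine ContDiffAt.div_const ?_ _
      refine ContDiffAt.comp (g := Real.arcsin) (f := fun e : E => L (e - c x₀) j / R) (c x) (Real.contDiffAt_arcsin (neg_lt_of_abs_lt hlt).ne'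
        (lt_of_abs_lt hlt).ne) ?_
      exact (((contDiff_apply ℝ ℝ j).comp
        (L.contDiff.comp (contDiff_id.sub contDiff_const))).div_const R).contDiffAt
    exact h1.contMDiffAt.comp_contMDiffWithinAt x
      ((contMDiffOn_chart (I := 𝓘(ℝ, E)) (x := x₀)).mono inter_subset_left x hx)
  · have h1 : (fun j => R * Real.sin (2 * Real.pi *
        (Real.arcsin (L (c x - c x₀) j / R) / (2 * Real.pi)))) = L (c x - c x₀) := by
      ext j
      have hlt : |L (c x - c x₀) j / R| < 1 := by
        rw [abs_div, abs_of_pos hR, div_lt_one hR]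
        exact (norm_le_pi_norm (L (c x - c x₀)) j).trans_lt hx.2
      rw [mul_div_cancel₀ _ (by positivity), Real.sin_arcsin (neg_lt_of_abs_lt hlt).le
        (lt_of_abs_lt hlt).le]
      field_simp
    simp only [h1, ContinuousLinearEquiv.symm_apply_apply, add_sub_cancel]
    exact c.left_inv hx.1

end Localization

/-! ### Polynomial growth of characters. -/

section Growth

variable {d : ℕ}

theorem iteratedDeriv_cexp_ofReal (n : ℕ) (c : ℂ) :
    iteratedDeriv n (fun u : ℝ => Complex.exp (c * u)) = fun u : ℝ => c ^ n * Complex.exp (c * u) := by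
  induction n with
  | zero => simp
  | succ n ih =>
    ext u
    rw [iteratedDeriv_succ, ih]
    have h1 : HasDerivAt (fun u : ℝ => c * (u : ℂ)) c u := by
      simpa using (Complex.ofRealCLM.hasDerivAt (x := u)).const_mul c
    have h2 := (h1.cexp).const_mul (c ^ n)
    rw [h2.deriv]
    ring

/-- A character is `u ↦ exp(2πiu)` composed with the functional `s ↦ k ⬝ s`, whose norm is at most
`∑ |k_j|`. Each `|k_j| ≤ 1 + k_j²` is bounded by the weight, which is convenient although far from
sharp. -/
theorem norm_iteratedFDeriv_char_le (m : ℕ) (k : Fin d → ℤ) (s : Fin d → ℝ) :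
    ‖iteratedFDeriv ℝ m (char k) s‖ ≤ (2 * Real.pi) ^ m * (d * intWeight k) ^ m := by
  let g : (Fin d → ℝ) →L[ℝ] ℝ := ∑ j, (k j : ℝ) • ContinuousLinearMap.proj j
  have hg : ‖g‖ ≤ d * intWeight k := by
    refine (norm_sum_le _ _).trans ?_
    refine (Finset.sum_le_card_nsmul _ _ (intWeight k) fun j _ => ?_).trans_eq (by simp)
    rw [norm_smul]
    have h1 : ‖(ContinuousLinearMap.proj j : (Fin d → ℝ) →L[ℝ] ℝ)‖ ≤ 1 :=
      ContinuousLinearMap.opNorm_le_bound _ zero_le_one fun v => by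
        simpa using norm_le_pi_norm v j
    have h2 : ‖(k j : ℝ)‖ ≤ 1 + (k j : ℝ) ^ 2 := by
      rw [Real.norm_eq_abs]
      nlinarith [sq_abs (k j : ℝ), sq_nonneg (|(k j : ℝ)| - 1), abs_nonneg (k j : ℝ)]
    have h3 : 1 + (k j : ℝ) ^ 2 ≤ intWeight k := by
      rw [intWeight, ← Finset.mul_prod_erase _ _ (Finset.mem_univ j)]
      refine le_mul_of_one_le_right (by positivity) ?_
      exact Finset.prod_induction _ (fun x => (1 : ℝ) ≤ x)
        (fun _ _ => one_le_mul_of_one_le_of_one_le) le_rfl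
        fun _ _ => le_add_of_nonneg_right (sq_nonneg _)
    exact (mul_le_of_le_one_right (norm_nonneg _) h1).trans (h2.trans h3)
  have hchar : char k = (fun u : ℝ => Complex.exp (2 * Real.pi * Complex.I * u)) ∘ g := by
    ext s
    simp [char, g]
  have hf : ContDiff ℝ ∞ fun u : ℝ => Complex.exp (2 * Real.pi * Complex.I * u) :=
    (contDiff_const.mul Complex.ofRealCLM.contDiff).cexp
  rw [hchar, g.iteratedFDeriv_comp_right hf s (mod_cast le_top)]
  refine (ContinuousMultilinearMap.norm_compContinuousLinearMap_le _ _).trans ?_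
  rw [norm_iteratedFDeriv_eq_norm_iteratedDeriv, iteratedDeriv_cexp_ofReal]
  have h4 : ‖(2 * Real.pi * Complex.I) ^ m * Complex.exp (2 * Real.pi * Complex.I * (g s : ℂ))‖ =
      (2 * Real.pi) ^ m := by
    rw [norm_mul, norm_pow, Complex.norm_exp]
    simp [abs_of_pos Real.pi_pos]
  rw [h4]
  simp only [Finset.prod_const, Finset.card_univ, Fintype.card_fin]
  gcongr

/-- The character `char k` as an element of `C^∞(ℝ^d)`. -/
def charFun (k : Fin d → ℤ) : Cinf (Fin d → ℝ) (Fin d → ℝ) := mk (char k) (contDiff_char k).contMDiff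

@[simp] theorem charFun_apply (k : Fin d → ℤ) (s : Fin d → ℝ) : charFun k s = char k s := rfl

/-- Seminorms of characters grow at most polynomially. -/
theorem exists_seminorm_charFun_le {q : Seminorm ℂ (Cinf (Fin d → ℝ) (Fin d → ℝ))}
    (hq : Continuous q) : ∃ (C : ℝ) (N : ℕ), 0 ≤ C ∧ ∀ k, q (charFun k) ≤ C * intWeight k ^ N := by
  obtain ⟨s, c, -, hc⟩ := Seminorm.bound_of_continuous withSeminorms q hq
  have h : ∃ (C : ℝ) (N : ℕ), 0 ≤ C ∧ ∀ k : Fin d → ℤ,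
      s.sup semi (charFun k) ≤ C * intWeight k ^ N := by
    refine Finset.sup_induction (p := fun p : Seminorm ℂ (Cinf (Fin d → ℝ) (Fin d → ℝ)) =>
      ∃ (C : ℝ) (N : ℕ), 0 ≤ C ∧ ∀ k : Fin d → ℤ, p (charFun k) ≤ C * intWeight k ^ N)
      ⟨0, 0, le_rfl, by simp⟩ ?_ fun i _ => ?_
    · rintro p ⟨C, N, hC, hp⟩ p' ⟨C', N', hC', hp'⟩
      refine ⟨C + C', N + N', by positivity, fun k => sup_le ?_ ?_⟩
      · refine (hp k).trans ?_
        have h1 := one_le_intWeight k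
        gcongr
        · exact le_add_of_nonneg_right ‹_›
        · exact Nat.le_add_right _ _
      · refine (hp' k).trans ?_
        have h1 := one_le_intWeight k
        gcongr
        · exact le_add_of_nonneg_left ‹_›
        · exact Nat.le_add_left _ _
    · refine ⟨(2 * Real.pi) ^ i.2.1 * d ^ i.2.1, i.2.1, by positivity, fun k => ?_⟩
      have h0 := intWeight_pos k
      refine (semi_le_iff i _ (by positivity)).2 fun y _ => ?_
      refine (norm_iteratedFDeriv_char_le i.2.1 k y).trans_eq ?_
      ring
  obtain ⟨C, N, hC, h⟩ := h
  refine ⟨c * C, N, by positivity, fun k => (hc _).trans ?_⟩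
  rw [mul_assoc]
  exact mul_le_mul_of_nonneg_left (h k) c.2

end Growth

end Cinf
end

noncomputable section

set_option linter.unusedSectionVars false

open Filter Topology Set

/-! ### `C^∞(X) ⊗̂ C^∞(Y) = C^∞(X × Y)` -/

/-- Polynomial growth of one factor is beaten by rapid decay of the other. One extra power of the
weight is kept to make the series summable. -/
theorem CTensor.summable_seminorm_tmul {d : ℕ} {A B : Type*} [AddCommGroup A] [Module ℂ A]
    [TopologicalSpace A] [IsTopologicalAddGroup A] [PolynormableSpace ℂ A]
    [AddCommGroup B] [Module ℂ B] [TopologicalSpace B] [IsTopologicalAddGroup B]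
    [PolynormableSpace ℂ B] (p : {p : Seminorm ℂ (PTensor A B) // Continuous p})
    {u : (Fin d → ℤ) → A} {v : (Fin d → ℤ) → B}
    (hu : ∀ P : Seminorm ℂ A, Continuous P →
      ∃ (C : ℝ) (N : ℕ), 0 ≤ C ∧ ∀ k, P (u k) ≤ C * intWeight k ^ N)
    (hv : ∀ Q : Seminorm ℂ B, Continuous Q → ∀ N, ∃ C, ∀ k, intWeight k ^ N * Q (v k) ≤ C) :
    Summable fun k => p.1.toCompletion p.2 (tmul (u k) (v k)) := by
  obtain ⟨P, Q, c, hP, hQ, h⟩ := PTensor.exists_seminorm_tmul_le_mul p.1 p.2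
  obtain ⟨C, N, hC, h1⟩ := hu P hP
  obtain ⟨D, h2⟩ := hv Q hQ (N + 1)
  refine Summable.of_nonneg_of_le (fun k => apply_nonneg _ _) (fun k => ?_)
    (((summable_intWeight_inv d).mul_left (C * D)).mul_left |c|)
  rw [tmul, Seminorm.toCompletion_coe]
  have hw := intWeight_pos k
  refine (h (u k) (v k)).trans (mul_le_mul (le_abs_self c) ?_ (by positivity) (abs_nonneg c))
  calc _ ≤ C * intWeight k ^ N * Q (v k) := by gcongr; exact h1 k
    _ = C * (intWeight k ^ (N + 1) * Q (v k)) * (intWeight k)⁻¹ := by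
      field_simp
      ring
    _ ≤ _ := by gcongr; exact h2 k

/-- The finite partial sums are continuous and converge pointwise. As `ι` is countable,
Banach–Steinhaus applies along the filter of finite sets. -/
theorem exists_continuousLinearMap_hasSum {V W ι : Type*} [Countable ι]
    [AddCommGroup V] [Module ℂ V] [UniformSpace V] [IsUniformAddGroup V] [ContinuousSMul ℂ V]
    [BarrelledSpace ℂ V] [AddCommGroup W] [Module ℂ W] [UniformSpace W] [IsUniformAddGroup W]
    [ContinuousSMul ℂ W] [PolynormableSpace ℂ W] [T2Space W] (g : ι → V →L[ℂ] W)
    (hg : ∀ v, Summable fun i => g i v) : ∃ T : V →L[ℂ] W, ∀ v, HasSum (fun i => g i v) (T v) := by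
  have h : Tendsto (fun (s : Finset ι) (v : V) => (∑ i ∈ s, g i) v) atTop
      (𝓝 fun v => ∑' i, g i v) := tendsto_pi_nhds.2 fun v => by
    have h1 := (hg v).hasSum
    rw [HasSum, SummationFilter.unconditional_filter] at h1
    simpa using h1
  exact ⟨continuousLinearMapOfTendsto (fun s : Finset ι => ∑ i ∈ s, g i) h, fun v => (hg v).hasSum⟩

namespace Cinf

open TorusAction

section TensorProduct

variable {E : Type*} [NormedAddCommGroup E] [NormedSpace ℝ E] [FiniteDimensional ℝ E]
  {X : Type*} [TopologicalSpace X] [ChartedSpace E X] [IsManifold 𝓘(ℝ, E) ∞ X]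
  {E' : Type*} [NormedAddCommGroup E'] [NormedSpace ℝ E'] [FiniteDimensional ℝ E']
  {Y : Type*} [TopologicalSpace Y] [ChartedSpace E' Y] [IsManifold 𝓘(ℝ, E') ∞ Y]
  [SigmaCompactSpace Y]

instance : UniformContinuousConstSMul ℂ (Cinf E X) :=
  uniformContinuousConstSMul_of_continuousConstSMul ℂ (Cinf E X)

/-- The map `C^∞(X) ⊗̂ C^∞(Y) → C^∞(X × Y)`. -/
def ofTensor [SigmaCompactSpace X] :
    CTensor (Cinf E X) (Cinf E' Y) →L[ℂ] Cinf (E × E') (X × Y) :=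
  CTensor.lift box continuous_box

@[simp] theorem ofTensor_tmul [SigmaCompactSpace X] (f : Cinf E X) (g : Cinf E' Y) :
    ofTensor (CTensor.tmul f g) = box f g :=
  CTensor.lift_tmul _ _ _ _

variable (E' Y) in
-- Pulled back along the torus parametrization `τ`, `F` becomes periodic: `F(τ s, y) = ∑ char_k(s)
-- c_k(y)`. Substituting `s = t(x)` and multiplying by `φ` writes `φ(x) F(x, y)` as `∑ φ(x) char_k(t
-- x) c_k(y)`. This series converges in the completed tensor product because characters grow
-- polynomially and the `c_k` decay rapidly.
theorem exists_local_section [SigmaCompactSpace X] (x₀ : X) : ∃ U : Set X, IsOpen U ∧ x₀ ∈ U ∧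
    ∀ φ : Cinf E X, tsupport φ ⊆ U →
      ∃ S : Cinf (E × E') (X × Y) →L[ℂ] CTensor (Cinf E X) (Cinf E' Y),
        (∀ F x y, ofTensor (S F) (x, y) = φ x * F (x, y)) ∧
        ∀ f g, S (box f g) = CTensor.tmul (pmul φ f) g := by
  set d := Module.finrank ℝ E
  obtain ⟨U, τ, t, hU, hx₀, hτ, hper, ht, hτt⟩ : ∃ (U : Set X) (τ : (Fin d → ℝ) → X)
    (t : X → (Fin d → ℝ)), _ := exists_periodic_parametrization (E := E) x₀
  refine ⟨U, hU, hx₀, fun φ hφ => ?_⟩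
  let R : Cinf (Fin d → ℝ) (Fin d → ℝ) →L[ℂ] Cinf E X := cutoffPullback φ t hU hφ ht
  have hR : ∀ P : Seminorm ℂ (Cinf E X), Continuous P →
      ∃ (C : ℝ) (N : ℕ), 0 ≤ C ∧ ∀ k, P (R (charFun k)) ≤ C * intWeight k ^ N := fun P hP =>
    exists_seminorm_charFun_le (q := P.comp (R : Cinf (Fin d → ℝ) (Fin d → ℝ) →ₗ[ℂ] Cinf E X)) (hP.comp R.continuous)
  let Q : Cinf (E × E') (X × Y) →L[ℂ] Cinf ((Fin d → ℝ) × E') ((Fin d → ℝ) × Y) :=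
    comap (fun z => (τ z.1, z.2)) ((hτ.comp contMDiffFst).pair contMDiffSnd)
  have hQ : ∀ F, IsPeriodic (Q F) := fun F k s y => by
    change F (_, _) = F (_, _)
    rw [hper]
  -- To expand `f` alone, `f ∘ τ` is regarded as a function with a dummy second variable. Its
  -- coefficients are constant functions, and their values at `x₀` serve as the scalars.
  let Q' : Cinf E X →L[ℂ] Cinf ((Fin d → ℝ) × E) ((Fin d → ℝ) × X) :=
    comap (fun z => τ z.1) (hτ.comp contMDiffFst)
  have hQ' : ∀ F, IsPeriodic (Q' F) := fun F k s y => congrArg F (hper s k)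
  obtain ⟨S, hS⟩ := exists_continuousLinearMap_hasSum
    (fun k : Fin d → ℤ => (CTensor.tmulL (R (charFun k))).comp ((coeff k).comp Q)) fun F =>
      CTensor.withSeminorms.summable fun p => CTensor.summable_seminorm_tmul p hR
        fun q hq N => exists_weight_mul_seminorm_coeff_le hq N (Q F) (hQ F)
  have hφ0 : ∀ x, x ∉ U → φ x = 0 := fun x hx => image_eq_zero_of_notMem_tsupport fun h => hx (hφ h)
  refine ⟨S, fun F x y => ?_, fun f g => ?_⟩
  · have h1 := ((eval (E × E') (x, y)).comp ofTensor).hasSum (hS F)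
    have h2 := (hasSum_coeff_apply (Q F) (hQ F) (t x) y).mul_left (φ x)
    have h3 : φ x * Q F (t x, y) = φ x * F (x, y) := by
      by_cases hx : x ∈ U
      · change φ x * F (τ (t x), y) = _
        rw [hτt x hx]
      · rw [hφ0 x hx, zero_mul, zero_mul]
    rw [← h3]
    refine h1.unique (h2.congr_fun ?_)
    intro k
    simp [R, mul_assoc]
  · have hdecay : ∀ N, ∃ C, ∀ k : Fin d → ℤ, intWeight k ^ N * ‖coeff k (Q' f) x₀‖ ≤ C := fun N =>
      exists_weight_mul_seminorm_coeff_le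
        (q := (normSeminorm ℂ ℂ).comp (eval E x₀ : Cinf E X →ₗ[ℂ] ℂ))
        (continuous_norm.comp (continuous_eval E x₀)) N (Q' f) (hQ' f)
    have hsum : Summable fun k : Fin d → ℤ => coeff k (Q' f) x₀ • R (charFun k) := by
      refine withSeminorms.summable fun i => ?_
      obtain ⟨C, N, hC, h1⟩ := hR (semi i) (withSeminorms.continuous_seminorm i)
      obtain ⟨D, h2⟩ := hdecay (N + 1)
      refine Summable.of_nonneg_of_le (fun k => apply_nonneg _ _) (fun k => ?_)
        ((summable_intWeight_inv d).mul_left (D * C))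
      have hw := intWeight_pos k
      rw [map_smul_eq_mul]
      calc _ ≤ ‖coeff k (Q' f) x₀‖ * (C * intWeight k ^ N) := by gcongr; exact h1 k
        _ = (intWeight k ^ (N + 1) * ‖coeff k (Q' f) x₀‖) * C * (intWeight k)⁻¹ := by
          field_simp
          ring
        _ ≤ _ := by gcongr; exact h2 k
    have h1 : HasSum (fun k : Fin d → ℤ => coeff k (Q' f) x₀ • R (charFun k)) (pmul φ f) := by
      convert hsum.hasSum using 1
      ext x
      have h2 := (eval E x).hasSum hsum.hasSum
      have h3 := (hasSum_coeff_apply (Q' f) (hQ' f) (t x) x₀).mul_left (φ x)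
      have h4 : φ x * Q' f (t x, x₀) = φ x * f x := by
        by_cases hx : x ∈ U
        · change φ x * f (τ (t x)) = _
          rw [hτt x hx]
        · rw [hφ0 x hx, zero_mul, zero_mul]
      rw [pmul_apply, ← h4]
      refine (h3.congr_fun ?_).unique h2
      intro k
      simp [R]
      ring
    refine (hS (box f g)).unique (((CTensor.tmulR g).hasSum h1).congr_fun ?_)
    intro k
    have h5 : coeff k (Q (box f g)) = coeff k (Q' f) x₀ • g := by
      ext y
      rw [smul_apply, coeff_apply, coeff_apply, ← MeasureTheory.integral_mul_const]
      congr 1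
      ext s
      simp [Q, Q', mul_assoc]
    change CTensor.tmul _ (coeff k (Q (box f g))) = _
    rw [h5, CTensor.tmul_smul, CTensor.tmulR_apply, CTensor.smul_tmul]

variable [CompactSpace X] [T2Space X]

variable (E X E' Y) in
-- Local sections cut off by a partition of unity are summed. The left inverse property is checked
-- on elementary tensors only, so injectivity of `ofTensor` follows without a separate approximation
-- argument.
theorem exists_ofTensor_inverse :
    ∃ S : Cinf (E × E') (X × Y) →L[ℂ] CTensor (Cinf E X) (Cinf E' Y),
      (∀ z, S (ofTensor z) = z) ∧ ∀ F, ofTensor (S F) = F := by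
  choose U hU hxU h using fun x : X => exists_local_section (E := E) E' Y x
  obtain ⟨s, φ, w, hφ, hsum⟩ := exists_quadratic_partition (E := E) U hU fun x => ⟨x, hxU x⟩
  have hsupp : ∀ x, tsupport (pmul (pmul w (φ x)) (φ x) : Cinf E X) ⊆ U x := fun x =>
    (tsupport_mul_subset_right).trans (hφ x)
  choose S hS1 hS2 using fun x => h x _ (hsupp x)
  have hone : ∀ f : Cinf E X, ∑ i ∈ s, pmul (pmul (pmul w (φ i)) (φ i)) f = f := fun f => by
    ext x
    simp only [sum_apply, pmul_apply]
    rw [← Finset.sum_mul, hsum, one_mul]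
  refine ⟨∑ i ∈ s, S i, fun z => ?_, fun F => ?_⟩
  · have : (∑ i ∈ s, S i).comp ofTensor = .id ℂ (CTensor (Cinf E X) (Cinf E' Y)) :=
      CTensor.ext_tmul fun f g => by
        simp only [ContinuousLinearMap.comp_apply, ofTensor_tmul, _root_.sum_apply, hS2,
          ContinuousLinearMap.id_apply]
        rw [← hone f]
        exact (map_sum (CTensor.tmulR g) _ s).symm.trans (by rw [hone]; rfl)
    exact DFunLike.congr_fun this z
  · ext ⟨x, y⟩
    rw [_root_.sum_apply, map_sum, sum_apply]
    simp only [hS1, pmul_apply]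
    rw [← Finset.sum_mul, hsum, one_mul]

variable (E X E' Y) in
/-- The identification `C^∞(X) ⊗̂ C^∞(Y) = C^∞(X × Y)`. -/
def tensorEquiv : CTensor (Cinf E X) (Cinf E' Y) ≃L[ℂ] Cinf (E × E') (X × Y) :=
  ContinuousLinearEquiv.equivOfInverse ofTensor (exists_ofTensor_inverse E X E' Y).choose
    (exists_ofTensor_inverse E X E' Y).choose_spec.1 (exists_ofTensor_inverse E X E' Y).choose_spec.2

@[simp] theorem tensorEquiv_tmul (f : Cinf E X) (g : Cinf E' Y) :
    tensorEquiv E X E' Y (CTensor.tmul f g) = box f g :=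
  ofTensor_tmul f g

/-- Relates the pairings used to characterize coproduct and coaction to evaluation of functions on
the product. -/
theorem pair_eval_eval (z : CTensor (Cinf E X) (Cinf E' Y)) (x : X) (y : Y) :
    CTensor.pair (eval E x) (eval E' y) z = tensorEquiv E X E' Y z (x, y) := by
  have : CTensor.pair (eval E x) (eval E' y) = (eval (E × E') (x, y)).comp
      (tensorEquiv E X E' Y : CTensor (Cinf E X) (Cinf E' Y) →L[ℂ] _) :=
    CTensor.ext_tmul fun f g => by simp [CTensor.pair_tmul]
  exact DFunLike.congr_fun this z

/-- The products `f ⊠ g` span a dense subspace of `C^∞(X × Y)`. -/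
theorem mem_of_box_mem {S : Submodule ℂ (Cinf (E × E') (X × Y))}
    (hS : IsClosed (S : Set (Cinf (E × E') (X × Y)))) (h : ∀ f g, box f g ∈ S) (F) : F ∈ S := by
  have := CTensor.mem_of_tmul_mem (S := S.comap (tensorEquiv E X E' Y : CTensor (Cinf E X) (Cinf E' Y) →ₗ[ℂ] Cinf (E × E') (X × Y)))
    (hS.preimage (tensorEquiv E X E' Y).continuous)
    (fun f g => by simpa using h f g) ((tensorEquiv E X E' Y).symm F)
  simpa using this

end TensorProduct

end Cinf
end

noncomputable section

set_option linter.unusedSectionVars false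

open Filter Topology Set MeasureTheory

/-! ### Spectral decomposition for smooth torus actions -/

/-- Integrals over any two unit cubes both equal the integral over the torus, up to null boundary
faces. -/
theorem setIntegral_Icc_add_of_periodic {d : ℕ} {h : (Fin d → ℝ) → ℂ}
    (hp : ∀ (k : Fin d → ℤ) t, h (t + (fun i => (k i : ℝ))) = h t) (s : Fin d → ℝ) :
    ∫ t in Icc (0 : Fin d → ℝ) 1, h (t + s) = ∫ t in Icc (0 : Fin d → ℝ) 1, h t := by
  let q : (Fin d → ℝ) → UnitAddTorus (Fin d) := fun t i => (t i : UnitAddCircle)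
  have hq : Function.Surjective q :=
    Function.Surjective.piMap fun _ => QuotientAddGroup.mk_surjective
  have hfac : ∀ a b, q a = q b → h a = h b := by
    intro a b hab
    have : ∀ i, ∃ m : ℤ, (m : ℝ) = b i - a i := fun i => by
      have h1 := congrFun hab i
      rw [QuotientAddGroup.eq, AddSubgroup.mem_zmultiples_iff] at h1
      obtain ⟨m, hm⟩ := h1
      exact ⟨m, by rw [zsmul_one] at hm; rw [hm, neg_add_eq_sub]⟩
    choose m hm using this
    rw [← hp m a]
    congr 1
    ext i
    simp [hm]
  have hf : ∀ t, h (Function.surjInv hq (q t)) = h t := fun t =>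
    hfac _ _ (Function.surjInv_eq hq (q t))
  have hcube : ∀ a : Fin d → ℝ, ∫ t in Icc a (a + 1), h t =
      ∫ t in {x : Fin d → ℝ | ∀ i, x i ∈ Ioc (a i) (a i + 1)}, h (Function.surjInv hq (q t)) :=
    fun a => by
    have hset : {x : Fin d → ℝ | ∀ i, x i ∈ Ioc (a i) (a i + 1)} =
        univ.pi fun i => Ioc (a i) ((a + 1) i) := by
      ext x; simp
    have hae : (univ.pi fun i => Ioc (a i) ((a + 1) i)) =ᵐ[volume] Icc a (a + 1) :=
      Measure.univ_pi_Ioc_ae_eq_Icc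
    rw [hset, setIntegral_congr_set hae]
    exact integral_congr_ae (.of_forall fun t => (hf t).symm)
  have hint : ∫ t in Icc s (s + 1), h t = ∫ t in Icc 0 (0 + 1), h t := by
    rw [hcube, hcube]
    exact (UnitAddTorus.integral_preimage (fun x => h (Function.surjInv hq x)) s).symm.trans
      (UnitAddTorus.integral_preimage (fun x => h (Function.surjInv hq x)) 0)
  have h1 := (measurePreserving_add_right (volume : Measure (Fin d → ℝ)) s).setIntegral_preimage_emb
    (measurableEmbedding_addRight s) h (Icc s (s + 1))
  have h2 : (fun x => x + s) ⁻¹' Icc s (s + 1) = Icc (0 : Fin d → ℝ) 1 := by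
    ext x
    simp [add_comm s]
  rw [h2, hint, zero_add] at h1
  exact h1

namespace TorusAction

open Cinf

section Spectral

variable {n : ℕ} {E : Type*} [NormedAddCommGroup E] [NormedSpace ℝ E] [FiniteDimensional ℝ E]
  {X : Type*} [TopologicalSpace X] [ChartedSpace E X] [IsManifold 𝓘(ℝ, E) ∞ X]
  [SigmaCompactSpace X] (σ : TorusAction n E X)

theorem integral_char (m : Fin n → ℤ) :
    ∫ t in Icc (0 : Fin n → ℝ) 1, char m t = if m = 0 then 1 else 0 := by
  split_ifs with hm
  · subst hm
    simp [char_zero_left, Measure.real, Real.volume_Icc_pi]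
  · obtain ⟨j, hj⟩ := Function.ne_iff.1 hm
    have h := integral_fderiv_eq_zero (contDiff_char m)
      (fun k t => by rw [char_add_right, char_int, mul_one]) j
    simp_rw [fderiv_char] at h
    rw [integral_const_mul] at h
    refine (mul_eq_zero.1 h).resolve_left ?_
    simpa [Real.pi_ne_zero] using hj

/-- The action of a torus element on functions, as a continuous linear map. -/
def actL (s : Fin n → ℝ) : Cinf E X →L[ℂ] Cinf E X := comap (σ.act s) (σ.smooth_act s)

@[simp] theorem actL_apply (s : Fin n → ℝ) (f : Cinf E X) (x : X) : σ.actL s f x = f (σ.act s x) :=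
  rfl

theorem onFun_eq (s : Fin n → ℝ) (f : Cinf E X) : σ.onFun s f = σ.actL s f := rfl

theorem actL_zero (f : Cinf E X) : σ.actL 0 f = f := by
  ext x; rw [actL_apply, σ.zero_act]

theorem actL_add (s t : Fin n → ℝ) (f : Cinf E X) : σ.actL (s + t) f = σ.actL t (σ.actL s f) := by
  ext x; simp [σ.add_act]

theorem actL_pmul (s : Fin n → ℝ) (f g : Cinf E X) :
    σ.actL s (pmul f g) = pmul (σ.actL s f) (σ.actL s g) := rfl

theorem isHomogeneous_iff {r : Fin n → ℤ} {f : Cinf E X} :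
    σ.IsHomogeneous r f ↔ ∀ s, σ.actL s f = char r s • f := Iff.rfl

theorem IsHomogeneous.apply {σ : TorusAction n E X} {r : Fin n → ℤ} {f : Cinf E X}
    (hf : σ.IsHomogeneous r f) (s : Fin n → ℝ) (x : X) : f (σ.act s x) = char r s * f x :=
  congrArg (fun g : Cinf E X => g x) (hf s)

theorem IsHomogeneous.pmul {σ : TorusAction n E X} {r k : Fin n → ℤ} {f g : Cinf E X}
    (hf : σ.IsHomogeneous r f) (hg : σ.IsHomogeneous k g) :
    σ.IsHomogeneous (r + k) (Cinf.pmul f g) := fun s => by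
  ext x
  rw [onFun_eq, actL_apply, pmul_apply, hf.apply, hg.apply, Cinf.smul_apply, pmul_apply, char_add_left]
  ring

theorem IsHomogeneous.smul {σ : TorusAction n E X} {r : Fin n → ℤ} {f : Cinf E X}
    (hf : σ.IsHomogeneous r f) (c : ℂ) : σ.IsHomogeneous r (c • f) := fun s => by
  rw [map_smul, hf s, smul_comm]

theorem isHomogeneous_one : σ.IsHomogeneous 0 one := fun s => by
  ext x
  simp [onFun_eq, char_zero_left]

/-- The function `(s, x) ↦ f (σ_s x)`. -/
def orbitL : Cinf E X →L[ℂ] Cinf ((Fin n → ℝ) × E) ((Fin n → ℝ) × X) :=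
  comap (fun z => σ.act z.1 z.2) (contMDiff_prod_dom.2 σ.smooth)

theorem act_add_int (k : Fin n → ℤ) (t : Fin n → ℝ) (x : X) :
    σ.act (t + fun i => (k i : ℝ)) x = σ.act t x := by
  rw [add_comm, σ.add_act, σ.periodic]

theorem isPeriodic_orbitL (f : Cinf E X) : IsPeriodic (σ.orbitL f) := fun k t y =>
  congrArg f (σ.act_add_int k t y)

/-- The projection onto the spectral subspace of degree `r`. -/
def proj (r : Fin n → ℤ) : Cinf E X →L[ℂ] Cinf E X := (coeff r).comp σ.orbitL

theorem proj_apply (r : Fin n → ℤ) (f : Cinf E X) (x : X) : σ.proj r f x = σ.component f r x :=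
  coeff_apply _ _ _

/-- Translating the integration variable by `s` pulls out the factor `char r s`; periodicity leaves
the integral over the cube unchanged. -/
theorem isHomogeneous_proj (r : Fin n → ℤ) (f : Cinf E X) : σ.IsHomogeneous r (σ.proj r f) :=
  fun s => by
    ext x
    rw [onFun_eq, actL_apply, Cinf.smul_apply, proj_apply, proj_apply, component, component,
      ← integral_const_mul]
    have h1 : ∀ (k : Fin n → ℤ) t, char r s * (char (-r) (t + fun i => (k i : ℝ)) *
        f (σ.act (t + fun i => (k i : ℝ)) x)) = char r s * (char (-r) t * f (σ.act t x)) :=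
      fun k t => by rw [char_add_right, char_int, mul_one, act_add_int]
    refine Eq.trans ?_ (setIntegral_Icc_add_of_periodic h1 s)
    refine integral_congr_ae (.of_forall fun t => ?_)
    simp only
    rw [σ.add_act, char_add_right, char_neg_left r s]
    have : char r s ≠ 0 := Complex.exp_ne_zero _
    field_simp

theorem IsHomogeneous.proj_eq {σ : TorusAction n E X} {r : Fin n → ℤ} {f : Cinf E X}
    (hf : σ.IsHomogeneous r f) (k : Fin n → ℤ) : σ.proj k f = if k = r then f else 0 := by
  ext x
  rw [proj_apply, component]
  simp_rw [hf.apply, ← mul_assoc, ← char_add_left]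
  rw [integral_mul_const, integral_char]
  by_cases h : k = r
  · simp [h]
  · rw [if_neg h, if_neg (by rwa [neg_add_eq_zero]), zero_mul, Cinf.zero_apply]

theorem summable_seminorm_proj {q : Seminorm ℂ (Cinf E X)} (hq : Continuous q) (f : Cinf E X) :
    Summable fun r => q (σ.proj r f) :=
  summable_seminorm_coeff hq _ (σ.isPeriodic_orbitL f)

/-- Characters have modulus one, so the series converges absolutely in every seminorm for all `s`.
Evaluation at points identifies the sum by pointwise Fourier inversion. -/
theorem hasSum_char_smul_proj (s : Fin n → ℝ) (f : Cinf E X) :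
    HasSum (fun r => char r s • σ.proj r f) (σ.actL s f) := by
  have h : Summable fun r => char r s • σ.proj r f := withSeminorms.summable fun i => by
    simp only [map_smul_eq_mul, norm_char, one_mul]
    exact σ.summable_seminorm_proj (withSeminorms.continuous_seminorm i) f
  convert h.hasSum using 1
  ext x
  exact (hasSum_coeff_apply _ (σ.isPeriodic_orbitL f) s x).unique ((eval E x).hasSum h.hasSum)

theorem hasSum_proj (f : Cinf E X) : HasSum (fun r => σ.proj r f) f := by
  simpa [char_zero_right, actL_zero] using σ.hasSum_char_smul_proj 0 f

/-- A closed subspace containing all homogeneous elements is everything. -/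
theorem mem_of_homogeneous_mem {S : Submodule ℂ (Cinf E X)} (hS : IsClosed (S : Set (Cinf E X)))
    (h : ∀ r f, σ.IsHomogeneous r f → f ∈ S) (f : Cinf E X) : f ∈ S :=
  hS.mem_of_tendsto (σ.hasSum_proj f)
    (.of_forall fun _ => S.sum_mem fun r _ => h r _ (σ.isHomogeneous_proj r f))

theorem ext_homogeneous {V : Type*} [AddCommGroup V] [Module ℂ V] [TopologicalSpace V] [T2Space V]
    {S T : Cinf E X →L[ℂ] V} (h : ∀ r f, σ.IsHomogeneous r f → S f = T f) : S = T := by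
  ext f
  exact σ.mem_of_homogeneous_mem (S := LinearMap.eqLocus (S : Cinf E X →ₗ[ℂ] V) T)
    (isClosed_eq S.continuous T.continuous) h f

/-- The torus acts equicontinuously. -/
theorem exists_seminorm_actL_le {q : Seminorm ℂ (Cinf E X)} (hq : Continuous q) :
    ∃ Q : Seminorm ℂ (Cinf E X), Continuous Q ∧ ∀ s f, q (σ.actL s f) ≤ Q f := by
  -- For each `f` the sum `∑ q(f_r)` bounds `q` along the whole orbit. On a barrelled space the
  -- pointwise finite supremum of continuous seminorms is again continuous, which gives `Q`.
  have hbdd : BddAbove (range fun s => q.comp (σ.actL s : Cinf E X →ₗ[ℂ] Cinf E X)) := by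
    refine Seminorm.bddAbove_range_iff.2 fun f => ⟨∑' r, q (σ.proj r f), ?_⟩
    rintro _ ⟨s, rfl⟩
    have h1 := (hq.tendsto _).comp (σ.hasSum_char_smul_proj s f)
    refine le_of_tendsto h1 (.of_forall fun t => ?_)
    refine (Finset.le_sum_of_subadditive q (map_zero q).le (map_add_le_add q) t _).trans ?_
    simp only [map_smul_eq_mul, norm_char, one_mul]
    exact (σ.summable_seminorm_proj hq f).sum_le_tsum t fun _ _ => apply_nonneg _ _
  refine ⟨⨆ s, q.comp (σ.actL s : Cinf E X →ₗ[ℂ] Cinf E X), ?_, fun s f => ?_⟩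
  · rw [Seminorm.coe_iSup_eq hbdd]
    exact Seminorm.continuous_iSup _
      (fun s => show Continuous fun f => q (σ.actL s f) from hq.comp (σ.actL s).continuous) hbdd
  · rw [Seminorm.iSup_apply hbdd]
    exact le_ciSup (Seminorm.bddAbove_range_iff.1 hbdd f) s

end Spectral

end TorusAction
end

noncomputable section

set_option linter.unusedSectionVars false

open Filter Topology Set

/-! ### Twisted tensor products and the deformed product -/

section Bilinear

variable {A B V : Type*} [AddCommGroup A] [Module ℂ A] [TopologicalSpace A]
  [AddCommGroup B] [Module ℂ B] [TopologicalSpace B]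
  [AddCommGroup V] [Module ℂ V] [TopologicalSpace V]
  (b : A →ₗ[ℂ] B →ₗ[ℂ] V) (hb : Continuous fun x : A × B => b x.1 x.2)

/-- A continuous bilinear map with the first argument fixed. -/
def bilinLeft (x : A) : B →L[ℂ] V := ⟨b x, hb.comp (continuous_const.prodMk continuous_id)⟩

/-- A continuous bilinear map with the second argument fixed. -/
def bilinRight (y : B) : A →L[ℂ] V := ⟨b.flip y, hb.comp (continuous_id.prodMk continuous_const)⟩

end Bilinear

namespace TorusAction

open Cinf

section Twist

variable {n m : ℕ} {E : Type*} [NormedAddCommGroup E] [NormedSpace ℝ E] [FiniteDimensional ℝ E]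
  {X : Type*} [TopologicalSpace X] [ChartedSpace E X] [IsManifold 𝓘(ℝ, E) ∞ X]
  [SigmaCompactSpace X] (σ : TorusAction n E X)
  {E' : Type*} [NormedAddCommGroup E'] [NormedSpace ℝ E'] [FiniteDimensional ℝ E']
  {Y : Type*} [TopologicalSpace Y] [ChartedSpace E' Y] [IsManifold 𝓘(ℝ, E') ∞ Y]
  [SigmaCompactSpace Y] (τ : TorusAction m E' Y) (s : (Fin n → ℤ) → Fin m → ℝ)

/-- Equicontinuity of the torus action bounds the second factor uniformly in `r`, whatever the
shifts `s r` are. Summability comes from the first factor alone. -/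
theorem summable_twist (f : Cinf E X) (g : Cinf E' Y) :
    Summable fun r => CTensor.tmul (σ.proj r f) (τ.actL (s r) g) := by
  refine CTensor.withSeminorms.summable fun p => ?_
  obtain ⟨P, Q, c, hP, hQ, h⟩ := PTensor.exists_seminorm_tmul_le_mul p.1 p.2
  obtain ⟨Q', -, hQ'⟩ := τ.exists_seminorm_actL_le hQ
  refine Summable.of_nonneg_of_le (fun r => apply_nonneg _ _) (fun r => ?_)
    (((σ.summable_seminorm_proj hP f).mul_right (Q' g)).mul_left |c|)
  rw [CTensor.tmul, Seminorm.toCompletion_coe]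
  refine (h _ _).trans (mul_le_mul (le_abs_self c) ?_ (by positivity) (abs_nonneg c))
  exact mul_le_mul_of_nonneg_left (hQ' _ _) (apply_nonneg _ _)

/-- The bilinear map `(f, g) ↦ ∑_r f_r ⊗ τ_{s(r)} g`. -/
def twistBilin : Cinf E X →ₗ[ℂ] Cinf E' Y →ₗ[ℂ] CTensor (Cinf E X) (Cinf E' Y) :=
  LinearMap.mk₂ ℂ (fun f g => ∑' r, CTensor.tmul (σ.proj r f) (τ.actL (s r) g))
    (fun f f' g => by
      rw [← (summable_twist σ τ s f g).tsum_add (summable_twist σ τ s f' g)]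
      simp only [map_add, CTensor.add_tmul])
    (fun c f g => by
      rw [← (summable_twist σ τ s f g).tsum_const_smul]
      simp only [map_smul, CTensor.smul_tmul])
    (fun f g g' => by
      rw [← (summable_twist σ τ s f g).tsum_add (summable_twist σ τ s f g')]
      simp only [map_add, CTensor.tmul_add])
    (fun c f g => by
      rw [← (summable_twist σ τ s f g).tsum_const_smul]
      simp only [map_smul, CTensor.tmul_smul])

theorem hasSum_twistBilin (f : Cinf E X) (g : Cinf E' Y) :
    HasSum (fun r => CTensor.tmul (σ.proj r f) (τ.actL (s r) g)) (twistBilin σ τ s f g) :=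
  (summable_twist σ τ s f g).hasSum

/-- With either variable fixed, the map is a convergent series of continuous operators, hence
continuous; separate continuity then gives joint continuity. -/
theorem continuous_twistBilin :
    Continuous fun x : Cinf E X × Cinf E' Y => twistBilin σ τ s x.1 x.2 := by
  refine continuous_of_separately_continuous _ (fun g => ?_) (fun f => ?_)
  · obtain ⟨T, hT⟩ := exists_continuousLinearMap_hasSum
      (fun r => (CTensor.tmulR (A := Cinf E X) (τ.actL (s r) g)).comp (σ.proj r))
      fun f => summable_twist σ τ s f g
    exact T.continuous.congr fun f => (hT f).unique (hasSum_twistBilin σ τ s f g)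
  · obtain ⟨T, hT⟩ := exists_continuousLinearMap_hasSum
      (fun r => (CTensor.tmulL (B := Cinf E' Y) (σ.proj r f)).comp (τ.actL (s r)))
      fun g => summable_twist σ τ s f g
    exact T.continuous.congr fun g => (hT g).unique (hasSum_twistBilin σ τ s f g)

/-- The continuous linear map `f ⊗ g ↦ ∑_r f_r ⊗ τ_{s(r)} g`. -/
def twist : CTensor (Cinf E X) (Cinf E' Y) →L[ℂ] CTensor (Cinf E X) (Cinf E' Y) :=
  CTensor.lift (twistBilin σ τ s) (continuous_twistBilin σ τ s)

theorem twist_tmul (f : Cinf E X) (g : Cinf E' Y) :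
    twist σ τ s (CTensor.tmul f g) = twistBilin σ τ s f g :=
  CTensor.lift_tmul _ _ _ _

variable {σ} in
theorem IsHomogeneous.twistBilin_eq {r : Fin n → ℤ} {f : Cinf E X} (hf : σ.IsHomogeneous r f)
    (g : Cinf E' Y) : twistBilin σ τ s f g = CTensor.tmul f (τ.actL (s r) g) := by
  refine (hasSum_twistBilin σ τ s f g).unique ?_
  have h := hasSum_single (f := fun k => CTensor.tmul (σ.proj k f) (τ.actL (s k) g)) r
    fun k hk => by
      rw [hf.proj_eq, if_neg hk]
      exact map_zero (CTensor.tmulR _)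
  rwa [hf.proj_eq, if_pos rfl] at h

variable {σ} in
theorem IsHomogeneous.twist_tmul {r : Fin n → ℤ} {f : Cinf E X} (hf : σ.IsHomogeneous r f)
    (g : Cinf E' Y) : twist σ τ s (CTensor.tmul f g) = CTensor.tmul f (τ.actL (s r) g) := by
  rw [TorusAction.twist_tmul, hf.twistBilin_eq]

theorem ext_homogeneous_tmul {V : Type*} [AddCommGroup V] [Module ℂ V] [TopologicalSpace V]
    [T2Space V] {S T : CTensor (Cinf E X) (Cinf E' Y) →L[ℂ] V}
    (h : ∀ r f g, σ.IsHomogeneous r f → S (CTensor.tmul f g) = T (CTensor.tmul f g)) : S = T :=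
  CTensor.ext_tmul fun f g => DFunLike.congr_fun (σ.ext_homogeneous
    (S := S.comp (CTensor.tmulR g)) (T := T.comp (CTensor.tmulR g)) fun r f hf => h r f g hf) f

/-- On `f ⊗ g` with `f` of degree `r` the two shifts of `g` add up to `s r + t r = 0`. -/
theorem twist_twist {s t : (Fin n → ℤ) → Fin m → ℝ} (hst : ∀ r, s r + t r = 0)
    (z : CTensor (Cinf E X) (Cinf E' Y)) : twist σ τ t (twist σ τ s z) = z := by
  have : (twist σ τ t).comp (twist σ τ s) = .id ℂ (CTensor (Cinf E X) (Cinf E' Y)) :=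
    σ.ext_homogeneous_tmul fun r f g hf => by
      simp only [ContinuousLinearMap.comp_apply, hf.twist_tmul, ← actL_add, hst, actL_zero,
        ContinuousLinearMap.id_apply]
  exact DFunLike.congr_fun this z

end Twist

section Halftwist

variable {n : ℕ} (θ : Matrix (Fin n) (Fin n) ℝ)

theorem _root_.halfTwist_zero : halfTwist θ 0 = 0 := by
  ext j
  simp [halfTwist, Matrix.vecMul, dotProduct]

theorem _root_.halfTwist_add (r k : Fin n → ℤ) :
    halfTwist θ (r + k) = halfTwist θ r + halfTwist θ k := by
  ext j
  simp [halfTwist, Matrix.vecMul, dotProduct, add_mul, Finset.sum_add_distrib, mul_add]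

theorem _root_.halfTwist_neg (r : Fin n → ℤ) : halfTwist (-θ) r = -halfTwist θ r := by
  ext j
  simp [halfTwist, Matrix.vecMul_neg]

end Halftwist

/-! ### The deformed algebra `C^∞(X_θ)` and its functoriality. -/

section Deformed

variable {n : ℕ} {E : Type*} [NormedAddCommGroup E] [NormedSpace ℝ E] [FiniteDimensional ℝ E]
  {X : Type*} [TopologicalSpace X] [ChartedSpace E X] [IsManifold 𝓘(ℝ, E) ∞ X]
  [SigmaCompactSpace X] (σ : TorusAction n E X) (θ : Matrix (Fin n) (Fin n) ℝ)

/-- Multiplication as a map on the completed tensor product. -/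
def mulTensor : CTensor (Cinf E X) (Cinf E X) →L[ℂ] Cinf E X := CTensor.lift pmul continuous_pmul

theorem mulTensor_tmul (f g : Cinf E X) : mulTensor (CTensor.tmul f g) = pmul f g :=
  CTensor.lift_tmul _ _ _ _

/-- The product `f ×_θ g = ∑_r f_r σ_{½ r ⬝ θ}(g)`. -/
def deformedMul : Cinf E X →ₗ[ℂ] Cinf E X →ₗ[ℂ] Cinf E X :=
  (twistBilin σ σ (halfTwist θ)).compr₂
    (mulTensor (E := E) (X := X)).toLinearMap

theorem hasSum_deformedMul (f g : Cinf E X) :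
    HasSum (fun r => pmul (σ.proj r f) (σ.actL (halfTwist θ r) g)) (deformedMul σ θ f g) := by
  have h := mulTensor.hasSum (hasSum_twistBilin σ σ (halfTwist θ) f g)
  simp only [mulTensor_tmul] at h
  exact h

theorem continuous_deformedMul :
    Continuous fun x : Cinf E X × Cinf E X => deformedMul σ θ x.1 x.2 :=
  mulTensor.continuous.comp (continuous_twistBilin σ σ (halfTwist θ))

variable {σ} in
theorem IsHomogeneous.deformedMul_eq {r : Fin n → ℤ} {f : Cinf E X} (hf : σ.IsHomogeneous r f)
    (g : Cinf E X) :
    TorusAction.deformedMul σ θ f g = Cinf.pmul f (σ.actL (halfTwist θ r) g) := by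
  change mulTensor (twistBilin σ σ _ f g) = _
  rw [hf.twistBilin_eq, mulTensor_tmul]

variable {σ} in
theorem IsHomogeneous.deformedMul_eq_smul {r k : Fin n → ℤ} {f g : Cinf E X}
    (hf : σ.IsHomogeneous r f) (hg : σ.IsHomogeneous k g) :
    TorusAction.deformedMul σ θ f g = char k (halfTwist θ r) • Cinf.pmul f g := by
  rw [hf.deformedMul_eq, σ.isHomogeneous_iff.1 hg, map_smul]

variable {σ} in
theorem IsHomogeneous.deformedMul {r k : Fin n → ℤ} {f g : Cinf E X}
    (hf : σ.IsHomogeneous r f) (hg : σ.IsHomogeneous k g) :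
    σ.IsHomogeneous (r + k) (TorusAction.deformedMul σ θ f g) := by
  rw [hf.deformedMul_eq_smul θ hg]
  exact (hf.pmul hg).smul _

/-- Left multiplication in the deformed algebra. -/
def deformedMulL (f : Cinf E X) : Cinf E X →L[ℂ] Cinf E X :=
  bilinLeft (deformedMul σ θ) (continuous_deformedMul σ θ) f

/-- Right multiplication in the deformed algebra. -/
def deformedMulR (g : Cinf E X) : Cinf E X →L[ℂ] Cinf E X :=
  bilinRight (deformedMul σ θ) (continuous_deformedMul σ θ) g

/-- For `f`, `g` of degrees `r`, `k` both sides are `f · σ_{½ r ⬝ θ}(g) · σ_{½ (r+k) ⬝ θ}(h)`,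
because degrees add under the product. Density of sums of homogeneous elements extends this to all
`f` and `g`; `h` is arbitrary throughout. -/
theorem deformedMul_assoc (f g h : Cinf E X) :
    deformedMul σ θ (deformedMul σ θ f g) h = deformedMul σ θ f (deformedMul σ θ g h) := by
  have key : ∀ r k f g, σ.IsHomogeneous r f → σ.IsHomogeneous k g →
      deformedMul σ θ (deformedMul σ θ f g) h = deformedMul σ θ f (deformedMul σ θ g h) :=
    fun r k f g hf hg => by
    rw [(hf.deformedMul θ hg).deformedMul_eq, hf.deformedMul_eq, hf.deformedMul_eq,
      hg.deformedMul_eq]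
    ext x
    simp only [pmul_apply, actL_apply, halfTwist_add, add_act, mul_assoc]
    rw [← σ.add_act, ← σ.add_act, add_comm]
  have h1 : ∀ r f, σ.IsHomogeneous r f →
      deformedMul σ θ (deformedMul σ θ f g) h = deformedMul σ θ f (deformedMul σ θ g h) :=
    fun r f hf => DFunLike.congr_fun (σ.ext_homogeneous
      (S := (deformedMulR σ θ h).comp (deformedMulL σ θ f))
      (T := (deformedMulL σ θ f).comp (deformedMulR σ θ h)) fun k g hg => key r k f g hf hg) g
  exact DFunLike.congr_fun (σ.ext_homogeneous
      (S := (deformedMulR σ θ h).comp (deformedMulR σ θ g))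
      (T := deformedMulR σ θ (deformedMul σ θ g h)) h1) f

/-- The algebra `C^∞(X_θ)`. -/
def deformed : TopAlg (Cinf E X) where
  mul := deformedMul σ θ
  one := one
  continuous_mul := continuous_deformedMul σ θ
  mul_assoc := deformedMul_assoc σ θ
  one_mul f := by
    rw [σ.isHomogeneous_one.deformedMul_eq, halfTwist_zero, actL_zero]
    ext x
    simp
  mul_one f := by
    refine (hasSum_deformedMul σ θ f one).unique ?_
    convert! σ.hasSum_proj f using 2 with r
    ext x
    simp

theorem isToricDeformation_deformed : IsToricDeformation σ θ (deformed σ θ) := by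
  refine ⟨fun x => rfl, fun f g x => ?_⟩
  have h := (eval E x).hasSum (hasSum_deformedMul σ θ f g)
  simp only [eval_apply, pmul_apply, actL_apply, proj_apply] at h
  exact h

section Comap

variable {E' : Type*} [NormedAddCommGroup E'] [NormedSpace ℝ E'] [FiniteDimensional ℝ E']
  {Y : Type*} [TopologicalSpace Y] [ChartedSpace E' Y] [IsManifold 𝓘(ℝ, E') ∞ Y]
  [SigmaCompactSpace Y] (τ : TorusAction n E' Y) (C : Matrix (Fin n) (Fin n) ℤ)

/-- Degrees transform by the transpose of the map on tori: `r ⬝ (C s) = (r C) ⬝ s`. -/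
theorem isHomogeneous_comap {φ : X → Y} (hφ : ContMDiff 𝓘(ℝ, E) 𝓘(ℝ, E') ∞ φ)
    (hC : ∀ s x, φ (σ.act s x) = τ.act ((C.map (Int.cast : ℤ → ℝ)) *ᵥ s) (φ x)) {r : Fin n → ℤ}
    {f : Cinf E' Y} (hf : τ.IsHomogeneous r f) :
    σ.IsHomogeneous (r ᵥ* C) (Cinf.comap φ hφ f) := fun s => by
  ext x
  rw [onFun_eq, actL_apply, Cinf.comap_apply, hC, hf.apply, Cinf.smul_apply, Cinf.comap_apply]
  congr 1
  have h : (∑ j, ((r ᵥ* C) j : ℝ) * s j) = ∑ j, (r j : ℝ) * ((C.map (Int.cast : ℤ → ℝ)) *ᵥ s) j := by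
    simp only [Matrix.vecMul, Matrix.mulVec, dotProduct, Matrix.map_apply, Int.cast_sum,
      Int.cast_mul, Finset.sum_mul, Finset.mul_sum]
    rw [Finset.sum_comm]
    simp only [mul_assoc]
  rw [char, char, h]

/-- The shift `½ (r C) ⬝ θ` upstairs covers `C (½ (r C) ⬝ θ) = ½ r ⬝ (C θ Cᵗ)` downstairs, which is
why the two matrices must be related in this way. Used with the given `C` for `π`, and with `C = 1`
for the action map `P × G → P`. -/
theorem comap_deformedMul {φ : X → Y} (hφ : ContMDiff 𝓘(ℝ, E) 𝓘(ℝ, E') ∞ φ)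
    (hC : ∀ s x, φ (σ.act s x) = τ.act ((C.map (Int.cast : ℤ → ℝ)) *ᵥ s) (φ x))
    {θ' : Matrix (Fin n) (Fin n) ℝ}
    (hθ : θ' = C.map (Int.cast : ℤ → ℝ) * θ * (C.map (Int.cast : ℤ → ℝ))ᵀ) (f g : Cinf E' Y) :
    Cinf.comap φ hφ (deformedMul τ θ' f g) = deformedMul σ θ (Cinf.comap φ hφ f) (Cinf.comap φ hφ g) := by
  have h1 : ∀ r : Fin n → ℤ, (C.map (Int.cast : ℤ → ℝ)) *ᵥ halfTwist θ (r ᵥ* C) = halfTwist θ' r :=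
    fun r => by
    have h2 : (fun j => ((r ᵥ* C) j : ℝ)) = (fun j => (r j : ℝ)) ᵥ* C.map (Int.cast : ℤ → ℝ) := by
      ext j
      simp [Matrix.vecMul, dotProduct]
    rw [halfTwist, h2, halfTwist, hθ, Matrix.mulVec_smul, Matrix.vecMul_vecMul, ← Matrix.vecMul_vecMul _ _ (_)ᵀ,
      Matrix.vecMul_transpose]
  refine DFunLike.congr_fun (τ.ext_homogeneous
    (S := (Cinf.comap φ hφ).comp (deformedMulR τ θ' g))
    (T := (deformedMulR σ θ (Cinf.comap φ hφ g)).comp (Cinf.comap φ hφ)) fun r f hf => ?_) f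
  change Cinf.comap φ hφ (deformedMul τ θ' f g) = deformedMul σ θ (Cinf.comap φ hφ f) (Cinf.comap φ hφ g)
  rw [hf.deformedMul_eq, (isHomogeneous_comap σ τ C hφ hC hf).deformedMul_eq]
  ext x
  simp only [Cinf.comap_apply, pmul_apply, actL_apply, hC, h1]

end Comap

end Deformed

end TorusAction

/-- `C^∞(X)` with the pointwise product. -/
def Cinf.pointwise (E X : Type*) [NormedAddCommGroup E] [NormedSpace ℝ E] [FiniteDimensional ℝ E]
    [TopologicalSpace X] [ChartedSpace E X] [IsManifold 𝓘(ℝ, E) ∞ X] [SigmaCompactSpace X] :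
    TopAlg (Cinf E X) where
  mul := Cinf.pmul
  one := Cinf.one
  continuous_mul := Cinf.continuous_pmul
  mul_assoc f g h := by ext; simp [mul_assoc]
  one_mul f := by ext; simp
  mul_one f := by ext; simp

end

noncomputable section

set_option linter.unusedSectionVars false

open Filter Topology Set

/-! ### Algebra structures on `C^∞(X) ⊗̂ C^∞(Y)`, coactions, and the Hopf algebra `C^∞(G)` -/

/-- An algebra structure transported along a linear homeomorphism. -/
def TopAlg.transport {A B : Type*} [AddCommGroup A] [Module ℂ A] [TopologicalSpace A]
    [AddCommGroup B] [Module ℂ B] [TopologicalSpace B] (ℬ : TopAlg B) (e : A ≃L[ℂ] B) :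
    TopAlg A where
  mul := LinearMap.mk₂ ℂ (fun a a' => e.symm (ℬ.mul (e a) (e a'))) (by simp) (by simp) (by simp)
    (by simp)
  one := e.symm ℬ.one
  continuous_mul := e.symm.continuous.comp (ℬ.continuous_mul.comp
    ((e.continuous.comp continuous_fst).prodMk (e.continuous.comp continuous_snd)))
  mul_assoc a b c := by simp [ℬ.mul_assoc]
  one_mul a := by simp [ℬ.one_mul]
  mul_one a := by simp [ℬ.mul_one]

namespace Cinf

section ToTensor

variable {E : Type*} [NormedAddCommGroup E] [NormedSpace ℝ E] [FiniteDimensional ℝ E]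
  {X : Type*} [TopologicalSpace X] [ChartedSpace E X] [IsManifold 𝓘(ℝ, E) ∞ X]
  [CompactSpace X] [T2Space X]
  {E' : Type*} [NormedAddCommGroup E'] [NormedSpace ℝ E'] [FiniteDimensional ℝ E']
  {Y : Type*} [TopologicalSpace Y] [ChartedSpace E' Y] [IsManifold 𝓘(ℝ, E') ∞ Y]
  [SigmaCompactSpace Y]

/-- The inverse of `ofTensor`. -/
def toTensor : Cinf (E × E') (X × Y) →L[ℂ] CTensor (Cinf E X) (Cinf E' Y) :=
  ((tensorEquiv E X E' Y).symm : Cinf (E × E') (X × Y) →L[ℂ] CTensor (Cinf E X) (Cinf E' Y))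

@[simp] theorem ofTensor_toTensor (F : Cinf (E × E') (X × Y)) : ofTensor (toTensor F) = F :=
  (tensorEquiv E X E' Y).apply_symm_apply F

@[simp] theorem toTensor_ofTensor (z : CTensor (Cinf E X) (Cinf E' Y)) :
    toTensor (ofTensor z) = z :=
  (tensorEquiv E X E' Y).symm_apply_apply z

theorem ofTensor_injective : Function.Injective
    (ofTensor : CTensor (Cinf E X) (Cinf E' Y) →L[ℂ] Cinf (E × E') (X × Y)) :=
  (tensorEquiv E X E' Y).injective

@[simp] theorem toTensor_box (f : Cinf E X) (g : Cinf E' Y) : toTensor (box f g) = CTensor.tmul f g := by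
  rw [← ofTensor_tmul, toTensor_ofTensor]

theorem transport_mul (ℬ : TopAlg (Cinf (E × E') (X × Y))) (z w : CTensor (Cinf E X) (Cinf E' Y)) :
    (ℬ.transport (tensorEquiv E X E' Y)).mul z w = toTensor (ℬ.mul (ofTensor z) (ofTensor w)) := rfl

end ToTensor

section Coaction

variable {E : Type*} [NormedAddCommGroup E] [NormedSpace ℝ E] [FiniteDimensional ℝ E]
  {X : Type*} [TopologicalSpace X] [ChartedSpace E X] [IsManifold 𝓘(ℝ, E) ∞ X]
  [CompactSpace X] [T2Space X]
  {E' : Type*} [NormedAddCommGroup E'] [NormedSpace ℝ E'] [FiniteDimensional ℝ E']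
  {Y : Type*} [TopologicalSpace Y] [ChartedSpace E' Y] [IsManifold 𝓘(ℝ, E') ∞ Y]
  [CompactSpace Y] [T2Space Y]
  {E'' : Type*} [NormedAddCommGroup E''] [NormedSpace ℝ E''] [FiniteDimensional ℝ E'']
  {Z : Type*} [TopologicalSpace Z] [ChartedSpace E'' Z] [IsManifold 𝓘(ℝ, E'') ∞ Z]
  [SigmaCompactSpace Z]

/-- The tensor product algebra is realized as functions on the product manifold, transported along
`tensorEquiv`; this avoids constructing its multiplication by hand. -/
theorem isTensorAlg_pointwise : IsTensorAlg (pointwise E X) (pointwise E'' Z)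
    ((pointwise (E × E'') (X × Z)).transport (tensorEquiv E X E'' Z)) := by
  refine ⟨ofTensor_injective ?_, fun a a' h h' => ofTensor_injective ?_⟩
  · refine (ofTensor_toTensor _).trans ?_
    rw [ofTensor_tmul]
    ext z
    exact (mul_one (1 : ℂ)).symm
  · rw [transport_mul, ofTensor_toTensor]
    simp only [ofTensor_tmul]
    ext z
    exact mul_mul_mul_comm _ _ _ _

theorem ofTensor_map_comap {D : Type*} [NormedAddCommGroup D] [NormedSpace ℝ D]
    [FiniteDimensional ℝ D] {W : Type*} [TopologicalSpace W] [ChartedSpace D W]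
    [IsManifold 𝓘(ℝ, D) ∞ W] [SigmaCompactSpace W] {φ : X → Y}
    (hφ : ContMDiff 𝓘(ℝ, E) 𝓘(ℝ, E') ∞ φ) {ψ : W → Z} (hψ : ContMDiff 𝓘(ℝ, D) 𝓘(ℝ, E'') ∞ ψ)
    (z : CTensor (Cinf E' Y) (Cinf E'' Z)) (x : X) (w : W) :
    ofTensor (CTensor.map (comap φ hφ) (comap ψ hψ) z) (x, w) = ofTensor z (φ x, ψ w) := by
  have h : ofTensor.comp (CTensor.map (comap φ hφ) (comap ψ hψ)) =
      (comap (fun z : X × W => (φ z.1, ψ z.2))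
        ((hφ.comp contMDiffFst).pair (hψ.comp contMDiffSnd))).comp ofTensor :=
    CTensor.ext_tmul fun f g => by
      simp only [ContinuousLinearMap.comp_apply, CTensor.map_tmul, ofTensor_tmul]
      rfl
  exact congrArg (fun f => f (x, w)) (DFunLike.congr_fun h z)

theorem comap_id_eq : (comap id contMDiff_id : Cinf E X →L[ℂ] Cinf E X) = .id ℂ (Cinf E X) := rfl

theorem contMDiff_assoc :
    ContMDiff 𝓘(ℝ, E × E' × E'') 𝓘(ℝ, (E × E') × E'') ∞
      (fun z : X × Y × Z => ((z.1, z.2.1), z.2.2)) :=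
  (contMDiffFst.pair (contMDiffFst.comp contMDiffSnd)).pair (contMDiffSnd.comp contMDiffSnd)

variable (E X E' Y E'' Z) in
/-- The associativity map `(C^∞(X) ⊗̂ C^∞(Y)) ⊗̂ C^∞(Z) → C^∞(X) ⊗̂ (C^∞(Y) ⊗̂ C^∞(Z))`. -/
def associator : CTensor (CTensor (Cinf E X) (Cinf E' Y)) (Cinf E'' Z) →L[ℂ]
    CTensor (Cinf E X) (CTensor (Cinf E' Y) (Cinf E'' Z)) :=
  (CTensor.map (.id ℂ (Cinf E X)) toTensor).comp <| toTensor.comp <|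
    (comap _ contMDiff_assoc).comp <| ofTensor.comp <| CTensor.map ofTensor (.id ℂ (Cinf E'' Z))

theorem isAssociator_associator : IsAssociator (associator E X E' Y E'' Z) := fun a b h => by
  have h1 : comap _ contMDiff_assoc (box (box a b) h) = box a (box b h) := by
    ext z
    exact mul_assoc _ _ _
  simp only [associator, ContinuousLinearMap.comp_apply, CTensor.map_tmul, ofTensor_tmul,
    ContinuousLinearMap.id_apply, h1, toTensor_box]

/-- The map `C^∞(X) → C^∞(X) ⊗̂ C^∞(Y)` dual to a smooth map `X × Y → X`. -/
def coaction (a : X × Y → X) (ha : ContMDiff 𝓘(ℝ, E × E') 𝓘(ℝ, E) ∞ a) :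
    Cinf E X →L[ℂ] CTensor (Cinf E X) (Cinf E' Y) :=
  toTensor.comp (comap a ha)

@[simp] theorem ofTensor_coaction {a : X × Y → X} (ha : ContMDiff 𝓘(ℝ, E × E') 𝓘(ℝ, E) ∞ a)
    (f : Cinf E X) : ofTensor (coaction a ha f) = comap a ha f :=
  ofTensor_toTensor _

/-- After passing to functions of three variables, both sides are `f` composed with the two
bracketings of `h`. Serves for the coproduct of `C^∞(G)` as well as for coactions. -/
theorem coaction_coassoc {a : X × Y → X} (ha : ContMDiff 𝓘(ℝ, E × E') 𝓘(ℝ, E) ∞ a)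
    {m : Y × Y → Y} (hm : ContMDiff 𝓘(ℝ, E' × E') 𝓘(ℝ, E') ∞ m)
    (h : ∀ x y z, a (a (x, y), z) = a (x, m (y, z))) (f : Cinf E X) :
    associator E X E' Y E' Y (CTensor.map (coaction a ha) (.id ℂ _) (coaction a ha f)) =
      CTensor.map (.id ℂ _) (coaction m hm) (coaction a ha f) := by
  have h1 : ofTensor.comp (coaction a ha) = comap a ha := by ext1 f; exact ofTensor_coaction ha f
  -- Extracting `toTensor` from the second factor exposes the map that also ends `associator`, so it
  -- can be cancelled from both sides.
  have h2 : CTensor.map (.id ℂ _) (coaction m hm) (coaction a ha f) =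
      CTensor.map (.id ℂ (Cinf E X)) toTensor
        (CTensor.map (comap id contMDiff_id) (comap m hm) (coaction a ha f)) := by
    rw [CTensor.map_comp]
    rfl
  rw [h2]
  simp only [associator, ContinuousLinearMap.comp_apply]
  rw [CTensor.map_comp, h1]
  congr 1
  refine ofTensor_injective ?_
  rw [ofTensor_toTensor]
  ext ⟨x, y, z⟩
  rw [ofTensor_map_comap, comap_apply]
  refine (ofTensor_map_comap ha contMDiff_id (coaction a ha f) (x, y) z).trans ?_
  rw [ofTensor_coaction]
  exact congrArg f (h x y z)

/-- Applying an evaluation to one tensor factor is restriction to a slice, so counit axioms reduce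
to the unit laws of the group. -/
theorem map_eval_left (x : X) (z : CTensor (Cinf E X) (Cinf E'' Z)) :
    CTensor.map (eval E x) (.id ℂ (Cinf E'' Z)) z =
      CTensor.tmul 1 (comap (fun w => (x, w)) (contMDiff_const.pair contMDiff_id) (ofTensor z)) := by
  have h : CTensor.map (eval E x) (.id ℂ (Cinf E'' Z)) =
      (CTensor.tmulL (1 : ℂ)).comp ((comap (fun w : Z => (x, w))
        (contMDiff_const.pair contMDiff_id)).comp ofTensor) := CTensor.ext_tmul fun f g => by
    have h1 : comap (fun w : Z => (x, w)) (contMDiff_const.pair contMDiff_id) (box f g) =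
      f x • g := rfl
    rw [CTensor.map_tmul, ContinuousLinearMap.comp_apply, ContinuousLinearMap.comp_apply,
      ofTensor_tmul, h1, CTensor.tmulL_apply, CTensor.tmul_smul, ← CTensor.smul_tmul, smul_eq_mul,
      mul_one, eval_apply, ContinuousLinearMap.id_apply]
  exact DFunLike.congr_fun h z

theorem map_eval_right (y : Z) (z : CTensor (Cinf E X) (Cinf E'' Z)) :
    CTensor.map (.id ℂ (Cinf E X)) (eval E'' y) z =
      CTensor.tmul (comap (fun w => (w, y)) (contMDiff_id.pair contMDiff_const) (ofTensor z)) 1 := by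
  have h : CTensor.map (.id ℂ (Cinf E X)) (eval E'' y) =
      (CTensor.tmulR (1 : ℂ)).comp ((comap (fun w : X => (w, y))
        (contMDiff_id.pair contMDiff_const)).comp ofTensor) := CTensor.ext_tmul fun f g => by
    have h1 : comap (fun w : X => (w, y)) (contMDiff_id.pair contMDiff_const) (box f g) =
        g y • f := by
      ext x
      exact mul_comm _ _
    rw [CTensor.map_tmul, ContinuousLinearMap.comp_apply, ContinuousLinearMap.comp_apply,
      ofTensor_tmul, h1, CTensor.tmulR_apply, CTensor.smul_tmul, ← CTensor.tmul_smul, smul_eq_mul,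
      mul_one, eval_apply, ContinuousLinearMap.id_apply]
  exact DFunLike.congr_fun h z

end Coaction

/-! ### The Hopf algebra of smooth functions on a compact Lie group. -/

section Hopf

variable (EG G : Type*) [NormedAddCommGroup EG] [NormedSpace ℝ EG] [FiniteDimensional ℝ EG]
  [TopologicalSpace G] [ChartedSpace EG G] [Group G] [LieGroup 𝓘(ℝ, EG) ∞ G]
  [CompactSpace G] [T2Space G]

instance isManifold_of_lieGroup : IsManifold 𝓘(ℝ, EG) ∞ G := inferInstance

theorem contMDiff_groupMul : ContMDiff 𝓘(ℝ, EG × EG) 𝓘(ℝ, EG) ∞ fun z : G × G => z.1 * z.2 :=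
  contMDiff_prod_dom.2 (contMDiff_mul 𝓘(ℝ, EG) ∞)

/-- Multiplication is restriction to the diagonal, which reduces the antipode axioms to `g⁻¹ g = 1 =
g g⁻¹`. -/
theorem mulTensor_apply (z : CTensor (Cinf EG G) (Cinf EG G)) (g : G) :
    TorusAction.mulTensor z g = ofTensor z (g, g) := by
  have h : (TorusAction.mulTensor : CTensor (Cinf EG G) (Cinf EG G) →L[ℂ] Cinf EG G) =
      (comap (fun g : G => (g, g)) (contMDiff_id.pair contMDiff_id)).comp ofTensor :=
    CTensor.ext_tmul fun f g => by
      rw [TorusAction.mulTensor_tmul, ContinuousLinearMap.comp_apply, ofTensor_tmul]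
      rfl
  exact congrArg (fun f => f g) (DFunLike.congr_fun h z)

/-- The topological Hopf algebra `C^∞(G)`. -/
def hopfAlg : TopHopfAlg (Cinf EG G) where
  toTopAlg := pointwise EG G
  comul := coaction (fun z : G × G => z.1 * z.2) (contMDiff_groupMul EG G)
  counit := eval EG 1
  antipode := comap (fun g => g⁻¹) (contMDiff_inv 𝓘(ℝ, EG) ∞)
  comul_one := ofTensor_injective <| by
    rw [ofTensor_coaction, ofTensor_tmul]
    ext z
    exact (mul_one (1 : ℂ)).symm
  comul_mul := ⟨_, isTensorAlg_pointwise, fun h k => ofTensor_injective <| by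
    rw [transport_mul, ofTensor_toTensor]
    simp only [ofTensor_coaction]
    rfl⟩
  counit_one := rfl
  counit_mul _ _ := rfl
  coassoc := ⟨_, isAssociator_associator, coaction_coassoc _ _ fun x y z => mul_assoc x y z⟩
  counit_comul h := by
    rw [map_eval_left, ofTensor_coaction]
    congr 1
    ext g
    exact congrArg h (one_mul g)
  comul_counit h := by
    rw [map_eval_right, ofTensor_coaction]
    congr 1
    ext g
    exact congrArg h (mul_one g)
  antipode_comul := ⟨TorusAction.mulTensor, TorusAction.mulTensor_tmul, fun h => by
    constructor
    · ext g
      rw [mulTensor_apply, ← comap_id_eq, ofTensor_map_comap, ofTensor_coaction]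
      refine (congrArg h (inv_mul_cancel g)).trans ?_
      exact (mul_one _).symm
    · ext g
      rw [mulTensor_apply, ← comap_id_eq, ofTensor_map_comap, ofTensor_coaction]
      refine (congrArg h (mul_inv_cancel g)).trans ?_
      exact (mul_one _).symm⟩

theorem isFunctionHopfAlg_hopfAlg : IsFunctionHopfAlg (hopfAlg EG G) where
  pointwise := ⟨fun _ => rfl, fun _ _ _ => rfl⟩
  comul_apply h g g' := by
    rw [pair_eval_eval]
    exact congrArg (fun f => f (g, g')) (ofTensor_coaction (contMDiff_groupMul EG G) h)
  counit_apply _ := rfl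
  antipode_apply _ _ := rfl

end Hopf

end Cinf
end

noncomputable section

set_option linter.unusedSectionVars false

open Filter Topology Set

/-! ### The canonical map -/

section Canonical

variable {A B H : Type*} [AddCommGroup A] [Module ℂ A] [TopologicalSpace A]
  [AddCommGroup B] [Module ℂ B] [TopologicalSpace B]
  [AddCommGroup H] [Module ℂ H] [TopologicalSpace H]
  {𝒜 : TopAlg A} {ℋ : TopAlg H} {𝒯 : TopAlg (CTensor A H)}

/-- Passes between the defining form `a δ(c)` of the canonical map and the product `(a ⊗ 1) δ(c)`,
to which associativity applies. -/
theorem IsTensorAlg.map_mulLeft (hT : IsTensorAlg 𝒜 ℋ 𝒯) (a : A) (z : CTensor A H) :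
    CTensor.map (𝒜.mulLeft a) (.id ℂ H) z = 𝒯.mul (CTensor.tmul a ℋ.one) z := by
  have h : CTensor.map (𝒜.mulLeft a) (.id ℂ H) = 𝒯.mulLeft (CTensor.tmul a ℋ.one) :=
    CTensor.ext_tmul fun b h => by
      refine (CTensor.map_tmul _ _ _ _).trans ((hT.2 a b ℋ.one h).trans ?_).symm
      rw [ℋ.one_mul]
      rfl
  exact DFunLike.congr_fun h z

theorem continuous_canonicalBilin (𝒯 : TopAlg (CTensor A H)) (h : H) (δ : A →L[ℂ] CTensor A H) :
    Continuous fun x : A × A =>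
      (𝒯.mul.comp (CTensor.tmulBilin.flip h)).compl₂ δ.toLinearMap x.1 x.2 :=
  𝒯.continuous_mul.comp (((CTensor.tmulR (A := A) h).continuous.comp continuous_fst).prodMk
    (δ.continuous.comp continuous_snd))

/-- The map `a ⊗ c ↦ (a ⊗ 1) δ(c)` on `A ⊗̂ A`. -/
def canonicalTensor (𝒯 : TopAlg (CTensor A H)) (h : H) (δ : A →L[ℂ] CTensor A H) :
    CTensor A A →L[ℂ] CTensor A H :=
  CTensor.lift ((𝒯.mul.comp (CTensor.tmulBilin.flip h)).compl₂ δ.toLinearMap)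
    (continuous_canonicalBilin 𝒯 h δ)

theorem canonicalTensor_tmul (h : H) (δ : A →L[ℂ] CTensor A H) (a c : A) :
    canonicalTensor 𝒯 h δ (CTensor.tmul a c) = 𝒯.mul (CTensor.tmul a h) (δ c) :=
  CTensor.lift_tmul _ _ _ _

/-- For a coinvariant `b`, `δ(b c) = (b ⊗ 1) δ(c)`, so `(a b ⊗ 1) δ(c)` and `(a ⊗ 1) δ(b c)` agree
by associativity. The kernel is closed, hence also contains the closed span. -/
theorem balancingRelations_le_ker (hT : IsTensorAlg 𝒜 ℋ 𝒯) {δ : A →L[ℂ] CTensor A H}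
    (hδ : ∀ a b, δ (𝒜.mul a b) = 𝒯.mul (δ a) (δ b)) {ι : B →ₗ[ℂ] A}
    (hι : ∀ b, δ (ι b) = CTensor.tmul (ι b) ℋ.one) :
    (balancingRelations 𝒜 ι).topologicalClosure ≤
      (canonicalTensor 𝒯 ℋ.one δ).ker := by
  refine Submodule.topologicalClosure_minimal _ (Submodule.span_le.2 ?_)
    (canonicalTensor 𝒯 ℋ.one δ).isClosed_ker
  rintro _ ⟨a, c, b, rfl⟩
  change canonicalTensor 𝒯 ℋ.one δ _ = 0
  rw [map_sub, canonicalTensor_tmul, canonicalTensor_tmul, hδ, hι, ← 𝒯.mul_assoc, hT.2,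
    ℋ.one_mul, sub_self]

/-- The canonical map on the balanced tensor product. -/
def canonicalMap (hT : IsTensorAlg 𝒜 ℋ 𝒯) {δ : A →L[ℂ] CTensor A H}
    (hδ : ∀ a b, δ (𝒜.mul a b) = 𝒯.mul (δ a) (δ b)) {ι : B →ₗ[ℂ] A}
    (hι : ∀ b, δ (ι b) = CTensor.tmul (ι b) ℋ.one) : BalTensor 𝒜 ι →L[ℂ] CTensor A H :=
  Submodule.liftQL _ (canonicalTensor 𝒯 ℋ.one δ) (balancingRelations_le_ker hT hδ hι)

theorem canonicalMap_mk (hT : IsTensorAlg 𝒜 ℋ 𝒯) {δ : A →L[ℂ] CTensor A H}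
    (hδ : ∀ a b, δ (𝒜.mul a b) = 𝒯.mul (δ a) (δ b)) {ι : B →ₗ[ℂ] A}
    (hι : ∀ b, δ (ι b) = CTensor.tmul (ι b) ℋ.one) (z : CTensor A A) :
    canonicalMap hT hδ hι (Submodule.Quotient.mk z) = canonicalTensor 𝒯 ℋ.one δ z := rfl

theorem isCanonicalMap_canonicalMap (hT : IsTensorAlg 𝒜 ℋ 𝒯) {δ : A →L[ℂ] CTensor A H}
    (hδ : ∀ a b, δ (𝒜.mul a b) = 𝒯.mul (δ a) (δ b)) {ι : B →ₗ[ℂ] A}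
    (hι : ∀ b, δ (ι b) = CTensor.tmul (ι b) ℋ.one) :
    IsCanonicalMap 𝒜 ι δ (canonicalMap hT hδ hι) := fun a c => by
  rw [BalTensor.tmul, canonicalMap_mk, canonicalTensor_tmul, hT.map_mulLeft]

end Canonical

/-! ### Deformations of product manifolds and comodule algebras -/

section Product

open Cinf TorusAction

variable {n : ℕ} {E : Type*} [NormedAddCommGroup E] [NormedSpace ℝ E] [FiniteDimensional ℝ E]
  {X : Type*} [TopologicalSpace X] [ChartedSpace E X] [IsManifold 𝓘(ℝ, E) ∞ X]
  [CompactSpace X] [T2Space X]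
  {E' : Type*} [NormedAddCommGroup E'] [NormedSpace ℝ E'] [FiniteDimensional ℝ E']
  {Y : Type*} [TopologicalSpace Y] [ChartedSpace E' Y] [IsManifold 𝓘(ℝ, E') ∞ Y]
  [SigmaCompactSpace Y] (σ : TorusAction n E X) (θ : Matrix (Fin n) (Fin n) ℝ)

variable (E' Y) in
/-- The action of the torus on the first factor of a product. -/
def TorusAction.prodRight : TorusAction n (E × E') (X × Y) where
  act s z := (σ.act s z.1, z.2)
  zero_act z := by rw [σ.zero_act]
  add_act s t z := by rw [σ.add_act]
  periodic k z := by rw [σ.periodic]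
  smooth := by
    refine contMDiff_prod_dom.1 (ContMDiff.pair ?_ (contMDiffSnd.comp contMDiffSnd))
    exact (contMDiff_prod_dom.2 σ.smooth).comp
      (contMDiffFst.pair (contMDiffFst.comp contMDiffSnd))

theorem TorusAction.IsHomogeneous.box {σ : TorusAction n E X} {r : Fin n → ℤ} {f : Cinf E X}
    (hf : σ.IsHomogeneous r f) (g : Cinf E' Y) :
    (σ.prodRight E' Y).IsHomogeneous r (Cinf.box f g) := fun s => by
  ext z
  rw [onFun_eq, actL_apply, box_apply, Cinf.smul_apply, box_apply, ← mul_assoc, ← hf.apply]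
  rfl

/-- The torus acts trivially on the second factor, so deforming the product manifold deforms only
the first tensor factor. -/
theorem deformedMul_box (a a' : Cinf E X) (h h' : Cinf E' Y) :
    deformedMul (σ.prodRight E' Y) θ (box a h) (box a' h') =
      box (deformedMul σ θ a a') (pmul h h') := by
  have key := σ.ext_homogeneous
    (S := (deformedMulR (σ.prodRight E' Y) θ (box a' h')).comp (bilinRight box continuous_box h))
    (T := (bilinRight box continuous_box (pmul h h')).comp (deformedMulR σ θ a'))
    fun r a ha => by
      change deformedMul (σ.prodRight E' Y) θ (box a h) (box a' h') =
        box (deformedMul σ θ a a') (pmul h h')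
      rw [(ha.box h).deformedMul_eq, ha.deformedMul_eq]
      ext z
      exact mul_mul_mul_comm _ _ _ _
  exact DFunLike.congr_fun key a

theorem isTensorAlg_deformed : IsTensorAlg (deformed σ θ) (pointwise E' Y)
    ((deformed (σ.prodRight E' Y) θ).transport (tensorEquiv E X E' Y)) := by
  refine ⟨ofTensor_injective ?_, fun a a' h h' => ofTensor_injective ?_⟩
  · refine (ofTensor_toTensor _).trans ?_
    rw [ofTensor_tmul]
    ext z
    exact (mul_one (1 : ℂ)).symm
  · rw [Cinf.transport_mul, ofTensor_toTensor]
    simp only [ofTensor_tmul]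
    exact deformedMul_box σ θ a a' h h'

end Product

/-! ### Comodule algebras from smooth right actions. -/

section Comodule

open Cinf

variable {E : Type*} [NormedAddCommGroup E] [NormedSpace ℝ E] [FiniteDimensional ℝ E]
  {X : Type*} [TopologicalSpace X] [ChartedSpace E X] [IsManifold 𝓘(ℝ, E) ∞ X]
  [CompactSpace X] [T2Space X]
  {EG G : Type*} [NormedAddCommGroup EG] [NormedSpace ℝ EG] [FiniteDimensional ℝ EG]
  [TopologicalSpace G] [ChartedSpace EG G] [Group G] [LieGroup 𝓘(ℝ, EG) ∞ G]
  [CompactSpace G] [T2Space G]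

theorem coaction_mul {𝒜 : TopAlg (Cinf E X)} {𝒮 : TopAlg (Cinf (E × EG) (X × G))}
    {a : X × G → X} (ha : ContMDiff 𝓘(ℝ, E × EG) 𝓘(ℝ, E) ∞ a)
    (h : ∀ f g, comap a ha (𝒜.mul f g) = 𝒮.mul (comap a ha f) (comap a ha g)) (f g : Cinf E X) :
    coaction a ha (𝒜.mul f g) =
      (𝒮.transport (tensorEquiv E X EG G)).mul (coaction a ha f) (coaction a ha g) := by
  rw [Cinf.transport_mul, ofTensor_coaction, ofTensor_coaction, ← h]
  rfl

theorem isComoduleAlgebra_coaction {𝒜 : TopAlg (Cinf E X)} {𝒮 : TopAlg (Cinf (E × EG) (X × G))}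
    (hT : IsTensorAlg 𝒜 (pointwise EG G) (𝒮.transport (tensorEquiv E X EG G)))
    {a : X × G → X} (ha : ContMDiff 𝓘(ℝ, E × EG) 𝓘(ℝ, E) ∞ a)
    (h : ∀ f g, comap a ha (𝒜.mul f g) = 𝒮.mul (comap a ha f) (comap a ha g))
    (hone : 𝒜.one = one) (ha1 : ∀ x, a (x, 1) = x)
    (hamul : ∀ x g g', a (a (x, g), g') = a (x, g * g')) :
    IsComoduleAlgebra (hopfAlg EG G) 𝒜 (coaction a ha) where
  coassoc := ⟨_, isAssociator_associator, coaction_coassoc ha (contMDiff_groupMul EG G) hamul⟩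
  counit f := by
    refine (map_eval_right (1 : G) _).trans ?_
    rw [ofTensor_coaction]
    congr 1
    ext x
    exact congrArg f (ha1 x)
  map_one := ofTensor_injective <| by
    rw [ofTensor_coaction, ofTensor_tmul, hone]
    ext z
    exact (mul_one (1 : ℂ)).symm
  map_mul := ⟨_, hT, coaction_mul ha h⟩

end Comodule
end

noncomputable section

set_option linter.unusedSectionVars false

open Filter Topology Set

/-! ### Smooth principal bundles -/

namespace IsSmoothPrincipalBundle

open Cinf

variable {EM EP EG M P G : Type*}
  [NormedAddCommGroup EM] [NormedSpace ℝ EM] [FiniteDimensional ℝ EM]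
  [NormedAddCommGroup EP] [NormedSpace ℝ EP] [FiniteDimensional ℝ EP]
  [NormedAddCommGroup EG] [NormedSpace ℝ EG] [FiniteDimensional ℝ EG]
  [TopologicalSpace M] [ChartedSpace EM M] [IsManifold 𝓘(ℝ, EM) ∞ M]
  [CompactSpace M] [T2Space M]
  [TopologicalSpace P] [ChartedSpace EP P] [IsManifold 𝓘(ℝ, EP) ∞ P] [T2Space P]
  [TopologicalSpace G] [ChartedSpace EG G] [Group G] [LieGroup 𝓘(ℝ, EG) ∞ G]
  [CompactSpace G] [T2Space G] [MulAction G P]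
  {π : P → M}

variable (EM EP EG) in
/-- A local trivialization over `U`, in terms of the fibre coordinate `κ` and the inverse `s`. -/
structure LocalTriv (G : Type*) [TopologicalSpace G] [ChartedSpace EG G] [Group G] [MulAction G P]
    (π : P → M) (U : Set M) (κ : P → G) (s : M × G → P) : Prop where
  isOpen : IsOpen U
  smooth_coord : ContMDiffOn 𝓘(ℝ, EP) 𝓘(ℝ, EG) ∞ κ (π ⁻¹' U)
  smooth_symm : ContMDiffOn 𝓘(ℝ, EM × EG) 𝓘(ℝ, EP) ∞ s (U ×ˢ univ)
  coord_smul : ∀ (g : G) p, π p ∈ U → κ (g • p) = g * κ p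
  symm_coord : ∀ p, π p ∈ U → s (π p, κ p) = p
  proj_symm : ∀ y g, y ∈ U → π (s (y, g)) = y

theorem exists_localTriv (hπ : IsSmoothPrincipalBundle EM EP EG G π) (m : M) :
    ∃ (U : Set M) (κ : P → G) (s : M × G → P), m ∈ U ∧ LocalTriv EM EP EG G π U κ s := by
  obtain ⟨e, hm, h1, h2, h3⟩ := hπ.locally_trivial m
  refine ⟨e.baseSet, fun p => (e p).2, e.toOpenPartialHomeomorph.symm, hm, e.open_baseSet, ?_, ?_,
    fun g p hp => h3 g p (e.mem_source.2 hp), fun p hp => ?_, fun y g hy => ?_⟩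
  · rw [← e.source_eq]
    exact contMDiff_snd.comp_contMDiffOn h1
  · rw [← e.target_eq]
    exact contMDiffOn_prod_dom.2 h2
  · exact e.symm_apply_mk_proj (e.mem_source.2 hp)
  · exact e.proj_symm_apply' hy

/-- Equivariance of the fibre coordinate determines the point of a fibre: the group element moving
`p` to coordinate `g` is `g (κ p)⁻¹`. -/
theorem symm_eq_smul (hπ : IsSmoothPrincipalBundle EM EP EG G π) {U : Set M} {κ : P → G}
    {s : M × G → P} (h : LocalTriv EM EP EG G π U κ s) {p : P} (hp : π p ∈ U) (g : G) :
    s (π p, g) = (g * (κ p)⁻¹) • p := by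
  have h1 := h.symm_coord ((g * (κ p)⁻¹) • p) (by rwa [hπ.proj_smul])
  rwa [hπ.proj_smul, h.coord_smul _ _ hp, inv_mul_cancel_right] at h1

theorem surjective_proj (hπ : IsSmoothPrincipalBundle EM EP EG G π) : Function.Surjective π :=
  fun m => by
  obtain ⟨U, κ, s, hm, h⟩ := hπ.exists_localTriv m
  exact ⟨s (m, 1), h.proj_symm m 1 hm⟩

/-- Over a compact set `K` inside a trivializing set, the preimage is the continuous image of `K ×
G`; finitely many such `K` cover `M`. -/
theorem compactSpace (hπ : IsSmoothPrincipalBundle EM EP EG G π) : CompactSpace P := by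
  choose U κ s hm h using hπ.exists_localTriv
  choose K hK hmK hKU using fun m => exists_compact_subset (h m).isOpen (hm m)
  obtain ⟨t, ht⟩ := isCompact_univ.elim_nhds_subcover (fun m => interior (K m))
    fun m _ => isOpen_interior.mem_nhds (hmK m)
  have h1 : ∀ m, IsCompact (π ⁻¹' K m) := fun m => by
    have h2 : π ⁻¹' K m = s m '' (K m ×ˢ univ) := by
      ext p
      constructor
      · exact fun hp => ⟨(π p, κ m p), ⟨hp, mem_univ _⟩, (h m).symm_coord p (hKU m hp)⟩
      · rintro ⟨⟨y, g⟩, ⟨hy, -⟩, rfl⟩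
        rwa [mem_preimage, (h m).proj_symm y g (hKU m hy)]
    rw [h2]
    exact ((hK m).prod isCompact_univ).image_of_continuousOn
      ((h m).smooth_symm.continuousOn.mono (prod_mono (hKU m) subset_rfl))
  refine ⟨(t.isCompact_biUnion fun m _ => h1 m).of_isClosed_subset isClosed_univ fun p _ => ?_⟩
  obtain ⟨m, hmt, hpm⟩ := mem_iUnion₂.1 (ht.2 (mem_univ (π p)))
  exact mem_iUnion₂.2 ⟨m, hmt, (interior_subset hpm : π p ∈ K m)⟩

/-- Fibres are orbits, so `a` descends to `M`. Near each point the descended function is `a`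
composed with the smooth local section `y ↦ s (y, 1)`. -/
theorem exists_eq_comp_of_invariant (hπ : IsSmoothPrincipalBundle EM EP EG G π) {a : Cinf EP P}
    (ha : ∀ (g : G) p, a (g • p) = a p) : ∃ b : Cinf EM M, ∀ p, b (π p) = a p := by
  have hinv : ∀ p q, π p = π q → a p = a q := fun p q hpq => by
    obtain ⟨U, κ, s, hm, h⟩ := hπ.exists_localTriv (π p)
    have h1 := hπ.symm_eq_smul h hm (κ q)
    rw [hpq, h.symm_coord q (hpq ▸ hm)] at h1
    rw [h1, ha]
  refine ⟨Cinf.mk (fun y => a (Function.surjInv hπ.surjective_proj y)) fun m => ?_,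
    fun p => hinv _ _ (Function.surjInv_eq hπ.surjective_proj _)⟩
  obtain ⟨U, κ, s, hm, h⟩ := hπ.exists_localTriv m
  have h1 : ContMDiffOn 𝓘(ℝ, EM) 𝓘(ℝ, ℂ) ∞ (fun y => a (s (y, 1))) U :=
    a.contMDiff.comp_contMDiffOn (h.smooth_symm.comp
      (ContMDiffOn.pair contMDiffOn_id contMDiffOn_const) fun y hy => ⟨hy, mem_univ _⟩)
  refine (h1.contMDiffAt (h.isOpen.mem_nhds hm)).congr_of_eventuallyEq ?_
  filter_upwards [h.isOpen.mem_nhds hm] with y hy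
  refine hinv _ _ ?_
  rw [h.proj_symm y 1 hy, Function.surjInv_eq hπ.surjective_proj]

theorem contMDiff_rightAction (hπ : IsSmoothPrincipalBundle EM EP EG G π) :
    ContMDiff 𝓘(ℝ, EP × EG) 𝓘(ℝ, EP) ∞ fun z : P × G => z.2⁻¹ • z.1 :=
  (contMDiff_prod_dom.2 hπ.smooth_smul).comp
    (((contMDiff_inv 𝓘(ℝ, EG) ∞).comp contMDiffSnd).pair contMDiffFst)

theorem contMDiff_shear (hπ : IsSmoothPrincipalBundle EM EP EG G π) :
    ContMDiff 𝓘(ℝ, EP × EG) 𝓘(ℝ, EP × EP) ∞ fun z : P × G => (z.1, z.2⁻¹ • z.1) :=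
  contMDiffFst.pair hπ.contMDiff_rightAction

/-! ### Inverting the shear modulo balancing relations. -/

section Galois

variable [CompactSpace P]

/-- Pull-back along the map `(p, g) ↦ (p, g⁻¹ • p)`. -/
def shear (hπ : IsSmoothPrincipalBundle EM EP EG G π) :
    Cinf (EP × EP) (P × P) →L[ℂ] Cinf (EP × EG) (P × G) :=
  comap _ hπ.contMDiff_shear

theorem shear_apply (hπ : IsSmoothPrincipalBundle EM EP EG G π) (F : Cinf (EP × EP) (P × P))
    (p : P) (g : G) : hπ.shear F (p, g) = F (p, g⁻¹ • p) := rfl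

theorem tsupport_comap_subset (hπ : IsSmoothPrincipalBundle EM EP EG G π) {U : Set M}
    {φ : Cinf EM M} (hφ : tsupport φ ⊆ U) : tsupport (comap π hπ.smooth_proj φ) ⊆ π ⁻¹' U :=
  (tsupport_comp_subset_preimage φ hπ.smooth_proj.continuous).trans (preimage_mono hφ)

theorem tsupport_box_subset {U V : Set P} {f g : Cinf EP P} (hf : tsupport f ⊆ U)
    (hg : tsupport g ⊆ V) : tsupport (box f g) ⊆ U ×ˢ V := fun _ hz =>
  ⟨hf (tsupport_comp_subset_preimage f continuous_fst (tsupport_mul_subset_left hz)),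
    hg (tsupport_comp_subset_preimage g continuous_snd (tsupport_mul_subset_right hz))⟩

/-- The subspace of balancing relations of the undeformed algebra. -/
abbrev relations (hπ : IsSmoothPrincipalBundle EM EP EG G π) :
    Submodule ℂ (CTensor (Cinf EP P) (Cinf EP P)) :=
  (balancingRelations (pointwise EP P) (pullback π hπ.smooth_proj)).topologicalClosure

theorem sub_mem_relations (hπ : IsSmoothPrincipalBundle EM EP EG G π) (a c : Cinf EP P)
    (b : Cinf EM M) : CTensor.tmul (pmul a (comap π hπ.smooth_proj b)) c -
      CTensor.tmul a (pmul (comap π hπ.smooth_proj b) c) ∈ hπ.relations :=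
  Submodule.le_topologicalClosure _ (Submodule.subset_span ⟨a, c, b, rfl⟩)

/-- Functions on `P × P` that differ by moving the base point from the first to the second factor
agree modulo the balancing relations. -/
theorem exists_balanced (hπ : IsSmoothPrincipalBundle EM EP EG G π) {U : Set M} {κ : P → G}
    {s : M × G → P} (h : LocalTriv EM EP EG G π U κ s) {ψ : Cinf EM M} (hψ : tsupport ψ ⊆ U)
    (a : Cinf EP P) (D : Cinf (EM × EG) (M × G)) : ∃ F F' : Cinf (EP × EP) (P × P),
      (∀ p q, F (p, q) = a p * ψ (π q) * D (π p, κ q)) ∧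
      (∀ p q, F' (p, q) = a p * ψ (π q) * D (π q, κ q)) ∧
      toTensor F - toTensor F' ∈ hπ.relations := by
  have hU : IsOpen (π ⁻¹' U) := h.isOpen.preimage hπ.smooth_proj.continuous
  have hV : IsOpen ((univ : Set P) ×ˢ (π ⁻¹' U)) := isOpen_univ.prod hU
  have hψ' := hπ.tsupport_comap_subset hψ
  have hsupp : tsupport (box a (comap π hπ.smooth_proj ψ)) ⊆ (univ : Set P) ×ˢ (π ⁻¹' U) :=
    tsupport_box_subset (subset_univ _) hψ'
  have hκ : ContMDiffOn 𝓘(ℝ, EP × EP) 𝓘(ℝ, EG) ∞ (fun z : P × P => κ z.2) (univ ×ˢ (π ⁻¹' U)) :=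
    h.smooth_coord.comp contMDiffSnd.contMDiffOn fun z hz => hz.2
  let Λ := cutoffPullback (box a (comap π hπ.smooth_proj ψ)) (fun z : P × P => (π z.1, κ z.2)) hV
    hsupp (ContMDiffOn.pair (hπ.smooth_proj.comp contMDiffFst).contMDiffOn hκ)
  let Λ' := cutoffPullback (box a (comap π hπ.smooth_proj ψ)) (fun z : P × P => (π z.2, κ z.2)) hV
    hsupp (ContMDiffOn.pair (hπ.smooth_proj.comp contMDiffSnd).contMDiffOn hκ)
  refine ⟨Λ D, Λ' D, fun p q => rfl, fun p q => rfl, ?_⟩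
  let Q : Cinf (EM × EG) (M × G) →L[ℂ] CTensor (Cinf EP P) (Cinf EP P) :=
    toTensor.comp (Λ - Λ')
  have hclosed : IsClosed (hπ.relations : Set (CTensor (Cinf EP P) (Cinf EP P))) :=
    Submodule.isClosed_topologicalClosure _
  -- The difference is continuous and linear in `D`, and products `u ⊠ v` span a dense subspace. For
  -- `D = u ⊠ v` it is exactly the relation that moves `u ∘ π` across the tensor sign.
  have hQ : Q D ∈ hπ.relations := by
    refine mem_of_box_mem (S := hπ.relations.comap Q.toLinearMap) (hclosed.preimage Q.continuous)
      (fun u v => ?_) D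
    let v' : Cinf EP P := cutoffPullback (comap π hπ.smooth_proj ψ) κ hU hψ' h.smooth_coord v
    have h1 : Λ (box u v) = box (pmul a (comap π hπ.smooth_proj u)) v' := by
      ext z
      change a z.1 * ψ (π z.2) * (u (π z.1) * v (κ z.2)) =
        a z.1 * u (π z.1) * (ψ (π z.2) * v (κ z.2))
      ring
    have h2 : Λ' (box u v) = box a (pmul (comap π hπ.smooth_proj u) v') := by
      ext z
      change a z.1 * ψ (π z.2) * (u (π z.2) * v (κ z.2)) =
        a z.1 * (u (π z.2) * (ψ (π z.2) * v (κ z.2)))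
      ring
    change toTensor (Λ (box u v) - Λ' (box u v)) ∈ hπ.relations
    rw [map_sub, h1, h2, toTensor_box, toTensor_box]
    exact hπ.sub_mem_relations a v' u
  change toTensor (Λ D - Λ' D) ∈ hπ.relations at hQ
  rwa [map_sub] at hQ

/-- A right inverse of the pull-back along `(p, g) ↦ (p, g⁻¹ • p)`, which is also a left inverse
modulo the balancing relations. -/
theorem exists_shear_inverse (hπ : IsSmoothPrincipalBundle EM EP EG G π) :
    ∃ R : Cinf (EP × EG) (P × G) →L[ℂ] Cinf (EP × EP) (P × P), (∀ H, hπ.shear (R H) = H) ∧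
      ∀ z : CTensor (Cinf EP P) (Cinf EP P),
        z - toTensor (R (hπ.shear (ofTensor z))) ∈ hπ.relations := by
  choose U κ s hm h using hπ.exists_localTriv
  obtain ⟨t, φ, w, hφ, hsum⟩ := exists_quadratic_partition (E := EM) U (fun m => (h m).isOpen)
    fun m => ⟨m, hm m⟩
  have hψ : ∀ i, tsupport (pmul w (φ i)) ⊆ U i := fun i =>
    tsupport_mul_subset_right.trans (hφ i)
  have hzero : ∀ i y, y ∉ U i → φ i y = 0 := fun i y hy =>
    image_eq_zero_of_notMem_tsupport fun hy' => hy (hφ i hy')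
  have hU : ∀ i, IsOpen (π ⁻¹' U i) := fun i => (h i).isOpen.preimage hπ.smooth_proj.continuous
  have hsm : ∀ i, ContMDiffOn 𝓘(ℝ, EP × EP) 𝓘(ℝ, EP × EG) ∞
      (fun z : P × P => (z.1, κ i z.1 * (κ i z.2)⁻¹)) ((π ⁻¹' U i) ×ˢ (π ⁻¹' U i)) := fun i =>
    ContMDiffOn.pair contMDiffFst.contMDiffOn
      (((h i).smooth_coord.comp contMDiffFst.contMDiffOn fun z hz => hz.1).mul
        ((h i).smooth_coord.comp contMDiffSnd.contMDiffOn fun z hz => hz.2).inv)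
  -- When `q = g⁻¹ • p`, equivariance gives `κ p (κ q)⁻¹ = g`, so this formula extends a function on
  -- the fibre product to nearby pairs. The cut-offs in both variables make it globally smooth.
  let R : M → Cinf (EP × EG) (P × G) →L[ℂ] Cinf (EP × EP) (P × P) := fun i =>
    cutoffPullback (box (comap π hπ.smooth_proj (φ i)) (comap π hπ.smooth_proj (pmul w (φ i))))
      (fun z : P × P => (z.1, κ i z.1 * (κ i z.2)⁻¹)) ((hU i).prod (hU i))
      (tsupport_box_subset (hπ.tsupport_comap_subset (hφ i)) (hπ.tsupport_comap_subset (hψ i)))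
      (hsm i)
  have hR : ∀ i H p q, R i H (p, q) =
      φ i (π p) * (w (π q) * φ i (π q)) * H (p, κ i p * (κ i q)⁻¹) := fun _ _ _ _ => rfl
  refine ⟨∑ i ∈ t, R i, fun H => ?_, fun z => ?_⟩
  · ext ⟨p, g⟩
    rw [shear_apply, _root_.sum_apply, Cinf.sum_apply]
    have h1 : ∀ i, R i H (p, g⁻¹ • p) = w (π p) * φ i (π p) * φ i (π p) * H (p, g) := fun i => by
      rw [hR, hπ.proj_smul]
      by_cases hp : π p ∈ U i
      · rw [(h i).coord_smul _ _ hp, mul_inv_rev, inv_inv, mul_inv_cancel_left]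
        ring
      · simp [hzero i _ hp]
    simp_rw [h1]
    rw [← Finset.sum_mul, hsum, one_mul]
  · let Q : CTensor (Cinf EP P) (Cinf EP P) →L[ℂ] CTensor (Cinf EP P) (Cinf EP P) :=
      .id ℂ _ - toTensor.comp ((∑ i ∈ t, R i).comp (hπ.shear.comp ofTensor))
    have hclosed : IsClosed (hπ.relations : Set (CTensor (Cinf EP P) (Cinf EP P))) :=
      Submodule.isClosed_topologicalClosure _
    refine CTensor.mem_of_tmul_mem (S := hπ.relations.comap Q.toLinearMap)
      (hclosed.preimage Q.continuous) (fun a c => ?_) z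
    change CTensor.tmul a c - toTensor ((∑ i ∈ t, R i) (hπ.shear (ofTensor (CTensor.tmul a c)))) ∈
      hπ.relations
    rw [ofTensor_tmul, _root_.sum_apply, ← toTensor_box]
    -- Since `(κ q (κ p)⁻¹) • p = s (π p, κ q)`, the value of `R i` on `a ⊠ c` involves only `π p`
    -- and `κ q` besides `a p` and the cut-off at `π q`; `D i` records that dependence.
    let D : M → Cinf (EM × EG) (M × G) := fun i =>
      cutoffPullback (comap Prod.fst contMDiffFst (φ i)) (s i) ((h i).isOpen.prod isOpen_univ)
        (fun z hz => ⟨hφ i (tsupport_comp_subset_preimage (φ i) continuous_fst hz), mem_univ _⟩)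
        (h i).smooth_symm c
    have hD : ∀ i y g, D i (y, g) = φ i y * c (s i (y, g)) := fun _ _ _ => rfl
    choose F F' hF hF' hrel using fun i => hπ.exists_balanced (h i) (hψ i) a (D i)
    have h1 : ∀ i, R i (hπ.shear (box a c)) = F i := fun i => by
      ext ⟨p, q⟩
      rw [hR, hF, shear_apply, box_apply, hD, pmul_apply]
      by_cases hp : π p ∈ U i
      · rw [hπ.symm_eq_smul (h i) hp, mul_inv_rev, inv_inv]
        ring
      · simp [hzero i _ hp]
    -- With the base point moved to `π q`, `s (π q, κ q) = q` turns the value into `c q`, and the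
    -- quadratic partition sums to one.
    have h2 : box a c = ∑ i ∈ t, F' i := by
      ext ⟨p, q⟩
      rw [Cinf.sum_apply, box_apply]
      have h3 : ∀ i, F' i (p, q) = w (π q) * φ i (π q) * φ i (π q) * (a p * c q) := fun i => by
        rw [hF', hD, pmul_apply]
        by_cases hq : π q ∈ U i
        · rw [(h i).symm_coord q hq]
          ring
        · simp [hzero i _ hq]
      simp_rw [h3]
      rw [← Finset.sum_mul, hsum, one_mul]
    rw [Finset.sum_congr rfl fun i _ => h1 i, h2, map_sum, map_sum, ← Finset.sum_sub_distrib]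
    refine Submodule.sum_mem _ fun i _ => ?_
    rw [← neg_sub]
    exact Submodule.neg_mem _ (hrel i)

end Galois

end IsSmoothPrincipalBundle
end

noncomputable section

set_option linter.unusedSectionVars false

open Filter Topology Set

/-! ### Hopf-Galois extensions from principal bundles -/

/-- Mutually inverse maps preserving closed subspaces induce a linear homeomorphism of quotients. -/
def quotientEquivOfInverse {V : Type*} [AddCommGroup V] [Module ℂ V] [TopologicalSpace V]
    [IsTopologicalAddGroup V] {S S' : Submodule ℂ V} (f g : V →L[ℂ] V)
    (hf : S ≤ S'.comap f.toLinearMap) (hg : S' ≤ S.comap g.toLinearMap) (hgf : ∀ v, g (f v) = v)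
    (hfg : ∀ v, f (g v) = v) : (V ⧸ S) ≃L[ℂ] (V ⧸ S') :=
  ContinuousLinearEquiv.equivOfInverse
    (S.liftQL (S'.mkQL.comp f) fun v hv => (Submodule.Quotient.mk_eq_zero S').2 (hf hv))
    (S'.liftQL (S.mkQL.comp g) fun v hv => (Submodule.Quotient.mk_eq_zero S).2 (hg hv))
    (fun x => by
      obtain ⟨v, rfl⟩ := Submodule.Quotient.mk_surjective S x
      exact congrArg Submodule.Quotient.mk (hgf v))
    (fun x => by
      obtain ⟨v, rfl⟩ := Submodule.Quotient.mk_surjective S' x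
      exact congrArg Submodule.Quotient.mk (hfg v))

theorem TorusAction.char_neg_right {n : ℕ} (r : Fin n → ℤ) (s : Fin n → ℝ) :
    char r (-s) * char r s = 1 := by
  rw [← Cinf.char_add_right, neg_add_cancel, Cinf.char_zero_right]

namespace IsSmoothPrincipalBundle

open Cinf TorusAction

variable {n : ℕ} {EM EP EG M P G : Type*}
  [NormedAddCommGroup EM] [NormedSpace ℝ EM] [FiniteDimensional ℝ EM]
  [NormedAddCommGroup EP] [NormedSpace ℝ EP] [FiniteDimensional ℝ EP]
  [NormedAddCommGroup EG] [NormedSpace ℝ EG] [FiniteDimensional ℝ EG]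
  [TopologicalSpace M] [ChartedSpace EM M] [IsManifold 𝓘(ℝ, EM) ∞ M]
  [CompactSpace M] [T2Space M]
  [TopologicalSpace P] [ChartedSpace EP P] [IsManifold 𝓘(ℝ, EP) ∞ P] [T2Space P]
  [TopologicalSpace G] [ChartedSpace EG G] [Group G] [LieGroup 𝓘(ℝ, EG) ∞ G]
  [CompactSpace G] [T2Space G] [MulAction G P] [CompactSpace P]
  {π : P → M} (hπ : IsSmoothPrincipalBundle EM EP EG G π)

/-- The coaction of `C^∞(G)` on `C^∞(P)` dual to the action of `G`. -/
def dualCoaction : Cinf EP P →L[ℂ] CTensor (Cinf EP P) (Cinf EG G) :=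
  coaction _ hπ.contMDiff_rightAction

theorem ofTensor_dualCoaction (f : Cinf EP P) (p : P) (g : G) :
    ofTensor (hπ.dualCoaction f) (p, g) = f (g⁻¹ • p) :=
  congrArg (fun F => F (p, g)) (ofTensor_coaction hπ.contMDiff_rightAction f)

theorem isDualCoaction : IsDualCoaction hπ.dualCoaction := fun f p g => by
  rw [pair_eval_eval]
  exact hπ.ofTensor_dualCoaction f p g

theorem dualCoaction_pullback (b : Cinf EM M) :
    hπ.dualCoaction (pullback π hπ.smooth_proj b) =
      CTensor.tmul (pullback π hπ.smooth_proj b) one := ofTensor_injective <| by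
  ext ⟨p, g⟩
  rw [ofTensor_dualCoaction, ofTensor_tmul, box_apply, one_apply, mul_one]
  exact congrArg b (hπ.proj_smul _ _)

theorem dualCoaction_eq_iff (a : Cinf EP P) : hπ.dualCoaction a = CTensor.tmul a one ↔
    a ∈ LinearMap.range (pullback π hπ.smooth_proj) := by
  constructor
  · intro h
    have h1 : ∀ (g : G) p, a (g • p) = a p := fun g p => by
      have h2 := hπ.ofTensor_dualCoaction a p g⁻¹
      rw [h, ofTensor_tmul, inv_inv, box_apply, one_apply, mul_one] at h2
      exact h2.symm
    obtain ⟨b, hb⟩ := hπ.exists_eq_comp_of_invariant h1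
    exact ⟨b, Cinf.ext hb⟩
  · rintro ⟨b, rfl⟩
    exact hπ.dualCoaction_pullback b

theorem injective_pullback : Function.Injective (pullback π hπ.smooth_proj) := fun b b' h => by
  ext y
  obtain ⟨p, rfl⟩ := hπ.surjective_proj y
  exact congrArg (fun f : Cinf EP P => f p) h

/-- The extension `C^∞(M) ⊆ C^∞(P)`, for any products compatible with the pull-backs. -/
theorem isHopfGaloisExtension {𝒜 : TopAlg (Cinf EP P)} {ℬ : TopAlg (Cinf EM M)}
    {𝒮 : TopAlg (Cinf (EP × EG) (P × G))}
    (hT : IsTensorAlg 𝒜 (pointwise EG G) (𝒮.transport (tensorEquiv EP P EG G)))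
    (hδ : ∀ f g, comap _ hπ.contMDiff_rightAction (𝒜.mul f g) =
      𝒮.mul (comap _ hπ.contMDiff_rightAction f) (comap _ hπ.contMDiff_rightAction g))
    (h𝒜 : 𝒜.one = one) (hℬ : ℬ.one = one)
    (hmul : ∀ b b', comap π hπ.smooth_proj (ℬ.mul b b') =
      𝒜.mul (comap π hπ.smooth_proj b) (comap π hπ.smooth_proj b'))
    {χ : BalTensor 𝒜 (pullback π hπ.smooth_proj) →L[ℂ] CTensor (Cinf EP P) (Cinf EG G)}
    (hχ : IsCanonicalMap 𝒜 (pullback π hπ.smooth_proj) hπ.dualCoaction χ)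
    (hbij : Function.Bijective χ) :
    IsHopfGaloisExtension (hopfAlg EG G) ℬ 𝒜 (pullback π hπ.smooth_proj) hπ.dualCoaction where
  incl_continuous := (comap π hπ.smooth_proj).continuous
  incl_injective := hπ.injective_pullback
  incl_one := by rw [h𝒜, hℬ]; rfl
  incl_mul := hmul
  comodule := isComoduleAlgebra_coaction hT hπ.contMDiff_rightAction hδ h𝒜
    (fun p => by simp) (fun p g g' => by simp [mul_smul])
  coinvariants := hπ.dualCoaction_eq_iff
  canonical := ⟨χ, hχ, hbij⟩

/-! ### The undeformed extension -/

theorem comap_rightAction_pointwise_mul (f g : Cinf EP P) :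
    comap _ hπ.contMDiff_rightAction ((pointwise EP P).mul f g) =
      (pointwise (EP × EG) (P × G)).mul (comap _ hπ.contMDiff_rightAction f)
        (comap _ hπ.contMDiff_rightAction g) := rfl

/-- The canonical map of the undeformed extension. -/
def canonicalMapPointwise : BalTensor (pointwise EP P) (pullback π hπ.smooth_proj) →L[ℂ]
    CTensor (Cinf EP P) (Cinf EG G) :=
  canonicalMap isTensorAlg_pointwise
    (coaction_mul hπ.contMDiff_rightAction hπ.comap_rightAction_pointwise_mul)
    hπ.dualCoaction_pullback

/-- On `a ⊗ c` both sides send `(p, g)` to `a(p) c(g⁻¹ • p)`, so the algebraic canonical map becomes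
a geometric pull-back. -/
theorem ofTensor_canonicalTensor_pointwise (z : CTensor (Cinf EP P) (Cinf EP P)) :
    ofTensor (canonicalTensor ((pointwise (EP × EG) (P × G)).transport (tensorEquiv EP P EG G))
      one hπ.dualCoaction z) = hπ.shear (ofTensor z) := by
  have h : ofTensor.comp (canonicalTensor
      ((pointwise (EP × EG) (P × G)).transport (tensorEquiv EP P EG G)) one hπ.dualCoaction) =
      hπ.shear.comp ofTensor := CTensor.ext_tmul fun a c => by
    rw [ContinuousLinearMap.comp_apply, ContinuousLinearMap.comp_apply, canonicalTensor_tmul,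
      Cinf.transport_mul, ofTensor_toTensor, ofTensor_tmul, ofTensor_tmul]
    ext ⟨p, g⟩
    refine (congrArg (a p * 1 * ·) (hπ.ofTensor_dualCoaction c p g)).trans ?_
    rw [mul_one]
    rfl
  exact DFunLike.congr_fun h z

/-- If `shear z = 0`, then `z - R (shear z)` is `z` itself and lies in the relations; surjectivity
is the right inverse property of `R`. -/
theorem bijective_canonicalMapPointwise : Function.Bijective hπ.canonicalMapPointwise := by
  obtain ⟨R, hR, hrel⟩ := hπ.exists_shear_inverse
  constructor
  · rw [injective_iff_map_eq_zero]
    intro x hx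
    obtain ⟨z, rfl⟩ := Submodule.Quotient.mk_surjective _ x
    have h1 : hπ.shear (ofTensor z) = 0 := by
      rw [← ofTensor_canonicalTensor_pointwise]
      exact (congrArg ofTensor hx).trans (map_zero _)
    have h2 := hrel z
    rw [h1, map_zero, map_zero, sub_zero] at h2
    exact (Submodule.Quotient.mk_eq_zero _).2 h2
  · intro y
    refine ⟨Submodule.Quotient.mk (toTensor (R (ofTensor y))), ofTensor_injective ?_⟩
    refine (hπ.ofTensor_canonicalTensor_pointwise _).trans ?_
    rw [ofTensor_toTensor, hR]

/-! ### The deformed extension -/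

/-- Commutation with `G` makes `(p, g) ↦ g⁻¹ • p` equivariant for the torus acting on the first
factor, so its pull-back respects the deformed products. -/
theorem comap_rightAction_deformedMul {σ' : TorusAction n EP P}
    (hcomm : ∀ s (g : G) p, σ'.act s (g • p) = g • σ'.act s p) (θ : Matrix (Fin n) (Fin n) ℝ)
    (f g : Cinf EP P) :
    comap _ hπ.contMDiff_rightAction ((deformed σ' θ).mul f g) =
      (deformed (σ'.prodRight EG G) θ).mul (comap _ hπ.contMDiff_rightAction f)
        (comap _ hπ.contMDiff_rightAction g) := by
  refine comap_deformedMul (σ'.prodRight EG G) θ σ' 1 hπ.contMDiff_rightAction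
    (fun s z => ?_) (by simp) f g
  simp only [Matrix.map_one (Int.cast : ℤ → ℝ) Int.cast_zero Int.cast_one, Matrix.one_mulVec]
  exact (hcomm s z.2⁻¹ z.1).symm

end IsSmoothPrincipalBundle
end

noncomputable section

set_option linter.unusedSectionVars false

open Filter Topology Set

/-! ### Untwisting the deformed extension -/

namespace IsSmoothPrincipalBundle

open Cinf TorusAction

variable {n : ℕ} {EM EP EG M P G : Type*}
  [NormedAddCommGroup EM] [NormedSpace ℝ EM] [FiniteDimensional ℝ EM]
  [NormedAddCommGroup EP] [NormedSpace ℝ EP] [FiniteDimensional ℝ EP]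
  [NormedAddCommGroup EG] [NormedSpace ℝ EG] [FiniteDimensional ℝ EG]
  [TopologicalSpace M] [ChartedSpace EM M] [IsManifold 𝓘(ℝ, EM) ∞ M]
  [CompactSpace M] [T2Space M]
  [TopologicalSpace P] [ChartedSpace EP P] [IsManifold 𝓘(ℝ, EP) ∞ P] [T2Space P]
  [TopologicalSpace G] [ChartedSpace EG G] [Group G] [LieGroup 𝓘(ℝ, EG) ∞ G]
  [CompactSpace G] [T2Space G] [MulAction G P] [CompactSpace P]
  {π : P → M} (hπ : IsSmoothPrincipalBundle EM EP EG G π)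

variable (σ : TorusAction n EM M) (σ' : TorusAction n EP P) {C : Matrix (Fin n) (Fin n) ℤ}
  (θ : Matrix (Fin n) (Fin n) ℝ)

/-- The balancing relations are generated by those with homogeneous first two arguments. -/
theorem balancingRelations_le_comap
    (hlift : ∀ s p, π (σ'.act s p) = σ.act ((C.map (Int.cast : ℤ → ℝ)) *ᵥ s) (π p))
    (𝒜 : TopAlg (Cinf EP P)) {S : Submodule ℂ (CTensor (Cinf EP P) (Cinf EP P))}
    (hS : IsClosed (S : Set (CTensor (Cinf EP P) (Cinf EP P))))
    (L : CTensor (Cinf EP P) (Cinf EP P) →L[ℂ] CTensor (Cinf EP P) (Cinf EP P))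
    (h : ∀ r k a b c, σ'.IsHomogeneous r a → σ'.IsHomogeneous k (comap π hπ.smooth_proj b) →
      L (CTensor.tmul (𝒜.mul a (comap π hπ.smooth_proj b)) c) -
        L (CTensor.tmul a (𝒜.mul (comap π hπ.smooth_proj b) c)) ∈ S) :
    (balancingRelations 𝒜 (pullback π hπ.smooth_proj)).topologicalClosure ≤
      S.comap L.toLinearMap := by
  refine Submodule.topologicalClosure_minimal _ (Submodule.span_le.2 ?_)
    (hS.preimage L.continuous)
  rintro _ ⟨a, c, b, rfl⟩
  change L _ ∈ S
  rw [map_sub]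
  let ι : Cinf EM M →L[ℂ] Cinf EP P := comap π hπ.smooth_proj
  -- Fix `a` homogeneous and decompose `b` downstairs on `M`; the lift condition makes each
  -- pulled-back component homogeneous on `P`. Then `a` is decomposed.
  have h1 : ∀ r a b, σ'.IsHomogeneous r a →
      L (CTensor.tmul (𝒜.mul a (ι b)) c) - L (CTensor.tmul a (𝒜.mul (ι b) c)) ∈ S := by
    intro r a b ha
    let Q : Cinf EM M →L[ℂ] CTensor (Cinf EP P) (Cinf EP P) :=
      L.comp ((CTensor.tmulR c).comp ((𝒜.mulLeft a).comp ι)) -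
        L.comp ((CTensor.tmulL a).comp ((bilinRight 𝒜.mul 𝒜.continuous_mul c).comp ι))
    exact σ.mem_of_homogeneous_mem (S := S.comap Q.toLinearMap) (hS.preimage Q.continuous)
      (fun k b hb => h r _ a b c ha (isHomogeneous_comap σ' σ C hπ.smooth_proj hlift hb)) b
  let Q : Cinf EP P →L[ℂ] CTensor (Cinf EP P) (Cinf EP P) :=
    L.comp ((CTensor.tmulR c).comp (bilinRight 𝒜.mul 𝒜.continuous_mul (ι b))) -
      L.comp (CTensor.tmulR (𝒜.mul (ι b) c))
  exact σ'.mem_of_homogeneous_mem (S := S.comap Q.toLinearMap) (hS.preimage Q.continuous)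
    (fun r a ha => h1 r a b ha) a

/-- For `a` of degree `r` and `b` of degree `k` upstairs, put `c' = σ'_{½ (r+k) ⬝ θ}(c)`. The
relation maps to `char k (½ r ⬝ θ)` times `a b ⊗ c' - a ⊗ b c'`: the scalar comes from the deformed
product in the first term and from shifting `b` in the second. -/
theorem deformed_relations_le
    (hlift : ∀ s p, π (σ'.act s p) = σ.act ((C.map (Int.cast : ℤ → ℝ)) *ᵥ s) (π p)) :
    (balancingRelations (deformed σ' θ) (pullback π hπ.smooth_proj)).topologicalClosure ≤
      hπ.relations.comap (twist σ' σ' (halfTwist θ)).toLinearMap := by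
  refine hπ.balancingRelations_le_comap σ σ' hlift _ (Submodule.isClosed_topologicalClosure _) _
    fun r k a b c ha hb => ?_
  change twist σ' σ' _ (CTensor.tmul (deformedMul σ' θ a _) c) -
    twist σ' σ' _ (CTensor.tmul a (deformedMul σ' θ _ c)) ∈ _
  rw [(ha.deformedMul θ hb).twist_tmul, ha.twist_tmul, ha.deformedMul_eq_smul θ hb,
    hb.deformedMul_eq, actL_pmul, σ'.isHomogeneous_iff.1 hb, ← actL_add,
    ← halfTwist_add, add_comm k r, CTensor.smul_tmul, map_smul, LinearMap.smul_apply,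
    CTensor.tmul_smul, ← smul_sub]
  exact Submodule.smul_mem _ _ (hπ.sub_mem_relations _ _ _)

/-- The reverse computation: the twist by `-θ` turns an undeformed relation into a scalar multiple
of a deformed one, with `c` replaced by its shift by `-½ (r+k) ⬝ θ`. -/
theorem relations_le_deformed
    (hlift : ∀ s p, π (σ'.act s p) = σ.act ((C.map (Int.cast : ℤ → ℝ)) *ᵥ s) (π p)) :
    hπ.relations ≤
      (balancingRelations (deformed σ' θ) (pullback π hπ.smooth_proj)).topologicalClosure.comap
        (twist σ' σ' (halfTwist (-θ))).toLinearMap := by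
  refine hπ.balancingRelations_le_comap σ σ' hlift _ (Submodule.isClosed_topologicalClosure _) _
    fun r k a b c ha hb => ?_
  change twist σ' σ' _ (CTensor.tmul (pmul a _) c) -
    twist σ' σ' _ (CTensor.tmul a (pmul _ c)) ∈ _
  have h1 : pmul a (comap π hπ.smooth_proj b) = char k (halfTwist (-θ) r) •
      deformedMul σ' θ a (comap π hπ.smooth_proj b) := by
    rw [ha.deformedMul_eq_smul θ hb, smul_smul, halfTwist_neg, char_neg_right, one_smul]
  have h2 : deformedMul σ' θ (comap π hπ.smooth_proj b) (σ'.actL (halfTwist (-θ) (r + k)) c) =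
      pmul (comap π hπ.smooth_proj b) (σ'.actL (halfTwist (-θ) r) c) := by
    rw [hb.deformedMul_eq, ← actL_add, halfTwist_add, halfTwist_neg θ k, neg_add_cancel_right]
  rw [(ha.pmul hb).twist_tmul, ha.twist_tmul, actL_pmul, σ'.isHomogeneous_iff.1 hb, h1, map_smul,
    LinearMap.smul_apply, ← h2, CTensor.smul_tmul, CTensor.tmul_smul, ← smul_sub]
  exact Submodule.smul_mem _ _
    (Submodule.le_topologicalClosure _ (Submodule.subset_span ⟨a, _, b, rfl⟩))

/-- The homeomorphism between the balanced tensor products of the deformed and of the undeformed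
algebra. -/
def untwist (hlift : ∀ s p, π (σ'.act s p) = σ.act ((C.map (Int.cast : ℤ → ℝ)) *ᵥ s) (π p)) :
    BalTensor (deformed σ' θ) (pullback π hπ.smooth_proj) ≃L[ℂ]
      BalTensor (pointwise EP P) (pullback π hπ.smooth_proj) :=
  quotientEquivOfInverse (twist σ' σ' (halfTwist θ)) (twist σ' σ' (halfTwist (-θ)))
    (hπ.deformed_relations_le σ σ' θ hlift) (hπ.relations_le_deformed σ σ' θ hlift)
    (twist_twist σ' σ' fun r => by rw [halfTwist_neg, add_neg_cancel])
    (twist_twist σ' σ' fun r => by rw [halfTwist_neg, neg_add_cancel])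

theorem untwist_tmul
    (hlift : ∀ s p, π (σ'.act s p) = σ.act ((C.map (Int.cast : ℤ → ℝ)) *ᵥ s) (π p))
    {r : Fin n → ℤ} {a : Cinf EP P} (ha : σ'.IsHomogeneous r a) (c : Cinf EP P) :
    hπ.untwist σ σ' θ hlift (BalTensor.tmul _ _ a c) =
      BalTensor.tmul _ _ a (σ'.actL (halfTwist θ r) c) :=
  congrArg Submodule.Quotient.mk (ha.twist_tmul σ' _ c)

/-- The canonical map of the deformed extension. -/
def canonicalMapDeformed (hcomm : ∀ s (g : G) p, σ'.act s (g • p) = g • σ'.act s p) :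
    BalTensor (deformed σ' θ) (pullback π hπ.smooth_proj) →L[ℂ]
      CTensor (Cinf EP P) (Cinf EG G) :=
  canonicalMap (isTensorAlg_deformed σ' θ)
    (coaction_mul hπ.contMDiff_rightAction (hπ.comap_rightAction_deformedMul hcomm θ))
    hπ.dualCoaction_pullback

/-- For `a` of degree `r`, the deformed product `(a ⊗ 1) δ(c)` is `(a ⊗ 1)` times `δ(c)` shifted by
`½ r ⬝ θ` in the first variable. As the torus commutes with `G`, this shifted function is `δ` of the
shifted `c`. -/
theorem canonicalTensor_deformed (hcomm : ∀ s (g : G) p, σ'.act s (g • p) = g • σ'.act s p)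
    (z : CTensor (Cinf EP P) (Cinf EP P)) :
    canonicalTensor ((deformed (σ'.prodRight EG G) θ).transport (tensorEquiv EP P EG G)) one
        hπ.dualCoaction z =
      canonicalTensor ((pointwise (EP × EG) (P × G)).transport (tensorEquiv EP P EG G)) one
        hπ.dualCoaction (twist σ' σ' (halfTwist θ) z) := by
  have h : canonicalTensor ((deformed (σ'.prodRight EG G) θ).transport (tensorEquiv EP P EG G))
        one hπ.dualCoaction =
      (canonicalTensor ((pointwise (EP × EG) (P × G)).transport (tensorEquiv EP P EG G)) one
        hπ.dualCoaction).comp (twist σ' σ' (halfTwist θ)) :=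
    σ'.ext_homogeneous_tmul fun r a c ha => by
      rw [ContinuousLinearMap.comp_apply, ha.twist_tmul, canonicalTensor_tmul,
        canonicalTensor_tmul, Cinf.transport_mul, Cinf.transport_mul, ofTensor_tmul]
      refine congrArg toTensor (((ha.box (one : Cinf EG G)).deformedMul_eq θ _).trans ?_)
      ext ⟨p, g⟩
      refine congrArg (box a one (p, g) * ·) ?_
      refine (hπ.ofTensor_dualCoaction c _ g).trans
        (Eq.trans ?_ (hπ.ofTensor_dualCoaction (σ'.actL _ c) p g).symm)
      exact congrArg c (hcomm _ _ _).symm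
  exact DFunLike.congr_fun h z

theorem canonicalMapDeformed_apply
    (hlift : ∀ s p, π (σ'.act s p) = σ.act ((C.map (Int.cast : ℤ → ℝ)) *ᵥ s) (π p))
    (hcomm : ∀ s (g : G) p, σ'.act s (g • p) = g • σ'.act s p)
    (x : BalTensor (deformed σ' θ) (pullback π hπ.smooth_proj)) :
    hπ.canonicalMapDeformed σ' θ hcomm x =
      hπ.canonicalMapPointwise (hπ.untwist σ σ' θ hlift x) := by
  obtain ⟨z, rfl⟩ := Submodule.Quotient.mk_surjective _ x
  exact hπ.canonicalTensor_deformed σ' θ hcomm z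

theorem bijective_canonicalMapDeformed
    (hlift : ∀ s p, π (σ'.act s p) = σ.act ((C.map (Int.cast : ℤ → ℝ)) *ᵥ s) (π p))
    (hcomm : ∀ s (g : G) p, σ'.act s (g • p) = g • σ'.act s p) :
    Function.Bijective (hπ.canonicalMapDeformed σ' θ hcomm) := by
  rw [funext (hπ.canonicalMapDeformed_apply σ σ' θ hlift hcomm)]
  exact hπ.bijective_canonicalMapPointwise.comp (hπ.untwist σ σ' θ hlift).bijective

end IsSmoothPrincipalBundle
end

/-! ### The main theorem. -/

theorem mainTheorem9 {n : ℕ} {EM EP EG M P G : Type*}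
    [NormedAddCommGroup EM] [NormedSpace ℝ EM] [FiniteDimensional ℝ EM]
    [NormedAddCommGroup EP] [NormedSpace ℝ EP] [FiniteDimensional ℝ EP]
    [NormedAddCommGroup EG] [NormedSpace ℝ EG] [FiniteDimensional ℝ EG]
    [TopologicalSpace M] [ChartedSpace EM M] [IsManifold 𝓘(ℝ, EM) ∞ M]
    [CompactSpace M] [T2Space M]
    [TopologicalSpace P] [ChartedSpace EP P] [IsManifold 𝓘(ℝ, EP) ∞ P] [T2Space P]
    [TopologicalSpace G] [ChartedSpace EG G] [Group G] [LieGroup 𝓘(ℝ, EG) ∞ G]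
    [CompactSpace G] [T2Space G] [MulAction G P]
    (π : P → M) (hπ : IsSmoothPrincipalBundle EM EP EG G π)
    (σ : TorusAction n EM M) (σ' : TorusAction n EP P)
    (C : Matrix (Fin n) (Fin n) ℤ) (hC : C.det ≠ 0)
    (hlift : ∀ s p, π (σ'.act s p) = σ.act ((C.map (Int.cast : ℤ → ℝ)) *ᵥ s) (π p))
    (hcomm : ∀ s (g : G) p, σ'.act s (g • p) = g • σ'.act s p)
    (θ θ' : Matrix (Fin n) (Fin n) ℝ) (hθ' : θ'ᵀ = -θ')
    (hθ : θ = C.map (Int.cast : ℤ → ℝ) * θ' * (C.map (Int.cast : ℤ → ℝ))ᵀ) :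
    ∃ (HG : TopHopfAlg (Cinf EG G))
      (AM AM₀ : TopAlg (Cinf EM M)) (AP AP₀ : TopAlg (Cinf EP P))
      (δ : Cinf EP P →L[ℂ] CTensor (Cinf EP P) (Cinf EG G)),
      IsFunctionHopfAlg HG ∧ IsDualCoaction δ ∧
      IsToricDeformation σ θ AM ∧ IsToricDeformation σ' θ' AP ∧
      IsPointwise AM₀ ∧ IsPointwise AP₀ ∧
      IsHopfGaloisExtension HG AM AP (Cinf.pullback π hπ.smooth_proj) δ ∧
      IsHopfGaloisExtension HG AM₀ AP₀ (Cinf.pullback π hπ.smooth_proj) δ ∧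
      ∃ (χ : BalTensor AP (Cinf.pullback π hπ.smooth_proj) →L[ℂ]
            CTensor (Cinf EP P) (Cinf EG G))
        (χ₀ : BalTensor AP₀ (Cinf.pullback π hπ.smooth_proj) →L[ℂ]
            CTensor (Cinf EP P) (Cinf EG G))
        (T : BalTensor AP (Cinf.pullback π hπ.smooth_proj) ≃L[ℂ]
            BalTensor AP₀ (Cinf.pullback π hπ.smooth_proj)),
        IsCanonicalMap AP (Cinf.pullback π hπ.smooth_proj) δ χ ∧
        IsCanonicalMap AP₀ (Cinf.pullback π hπ.smooth_proj) δ χ₀ ∧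
        (∀ r f' f, σ'.IsHomogeneous r f' →
          T (BalTensor.tmul AP (Cinf.pullback π hπ.smooth_proj) f' f) =
            BalTensor.tmul AP₀ (Cinf.pullback π hπ.smooth_proj) f'
              (σ'.onFun (halfTwist θ' r) f)) ∧
        ∀ x, χ x = χ₀ (T x) := by
  -- Compactness of `P`, which the tensor identifications require, comes from that of `M` and `G`.
  have := hπ.compactSpace
  refine ⟨Cinf.hopfAlg EG G, TorusAction.deformed σ θ, Cinf.pointwise EM M,
    TorusAction.deformed σ' θ', Cinf.pointwise EP P, hπ.dualCoaction,
    Cinf.isFunctionHopfAlg_hopfAlg EG G, hπ.isDualCoaction,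
    TorusAction.isToricDeformation_deformed σ θ, TorusAction.isToricDeformation_deformed σ' θ',
    ⟨fun _ => rfl, fun _ _ _ => rfl⟩, ⟨fun _ => rfl, fun _ _ _ => rfl⟩, ?_, ?_,
    hπ.canonicalMapDeformed σ' θ' hcomm, hπ.canonicalMapPointwise, hπ.untwist σ σ' θ' hlift,
    isCanonicalMap_canonicalMap _ _ _, isCanonicalMap_canonicalMap _ _ _,
    fun r f' f hf' => hπ.untwist_tmul σ σ' θ' hlift hf' f,
    hπ.canonicalMapDeformed_apply σ σ' θ' hlift hcomm⟩
  · exact hπ.isHopfGaloisExtension (isTensorAlg_deformed σ' θ')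
      (hπ.comap_rightAction_deformedMul hcomm θ') rfl rfl
      (TorusAction.comap_deformedMul σ' θ' σ C hπ.smooth_proj hlift hθ)
      (isCanonicalMap_canonicalMap _ _ _)
      (hπ.bijective_canonicalMapDeformed σ σ' θ' hlift hcomm)
  · exact hπ.isHopfGaloisExtension Cinf.isTensorAlg_pointwise
      hπ.comap_rightAction_pointwise_mul rfl rfl (fun _ _ => rfl)
      (isCanonicalMap_canonicalMap _ _ _) hπ.bijective_canonicalMapPointwise
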